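/- **Theorem 6.3.** Let $X\subset\mathbb P^4_{\mathbb C}$ be a smooth cubic threefold, i.e. the zero locus of an irreducible homogeneous polynomial $F\in\mathbb C[x_1,\dots,x_5]$ of degree $3$ whose first partial derivatives have no common zero with $F$ in $\mathbb P^4$. Let $\mathrm{Aut}(X)=\{f\in\mathrm{PGL}(5,\mathbb C)=\mathrm{Aut}(\mathbb P^4) : f(X)=X\}$, and let $G\subset \mathrm{Aut}(X)$ be a $3$-group (a subgroup all of whose elements have order a power of $3$). Then $G$ is finite with $|G|\le 3^5$, and if $G$ is nontrivial, then $G$ is isomorphic to one of the following $12$ groups ($C_n$ is the cyclic group of order $n$, and $[a,b]$ is the number of the group in the GAP library of small groups): $$C_3,\quad C_9,\quad C_3^2,\quad C_9\times C_3,\quad C_3^2\rtimes C_3\ [27,3],\quad C_9\rtimes C_3\ [27,4],\quad C_3^3,\quad C_3^3\rtimes C_3\ [81,7],$$ $$C_3\times(C_3^2\rtimes C_3)\ [81,12],\quad C_3\times(C_9\rtimes C_3)\ [81,13],\quad C_3^4,\quad C_3\times(C_3^3\rtimes C_3)\ [243,51].$$ Here, in the semidirect products, a generator of the right-hand factor $C_3$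 acts on $C_3^2$ by $(a,b)\mapsto(a,ab)$, on $C_9$ by $x\mapsto x^4$, and on $C_3^3$ by the cyclic permutation $(a,b,c)\mapsto(c,a,b)$ of the factors. -/

import Mathlib

open scoped MatrixGroups LinearAlgebra.Projectivization Pointwise

noncomputable section

/-- The zero locus in complex projective 4-space of a polynomial `F` in five variables
(meaningful for homogeneous `F`, see `mk_mem_projZeroLocus`). -/
def projZeroLocus (F : MvPolynomial (Fin 5) ℂ) : Set (ℙ ℂ (Fin 5 → ℂ)) :=
  {p | MvPolynomial.eval p.rep F = 0}

/-- For homogeneous `F`, membership in the zero locus can be tested on any representative. -/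
theorem mk_mem_projZeroLocus {F : MvPolynomial (Fin 5) ℂ} {d : ℕ} (hF : F.IsHomogeneous d)
    (v : Fin 5 → ℂ) (hv : v ≠ 0) :
    Projectivization.mk ℂ v hv ∈ projZeroLocus F ↔ MvPolynomial.eval v F = 0 := by
  obtain ⟨a, ha⟩ := Projectivization.exists_smul_eq_mk_rep ℂ v hv
  have h : MvPolynomial.eval (Projectivization.mk ℂ v hv).rep F
      = (a : ℂ) ^ d * MvPolynomial.eval v F := by
    rw [← ha, MvPolynomial.eval_eq', MvPolynomial.eval_eq', Finset.mul_sum]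
    refine Finset.sum_congr rfl fun m hm => ?_
    have hm' : ∑ i, m i = d := by
      rw [← Finsupp.degree_eq_sum]
      exact (hF.degree_eq_sum_deg_support hm).symm
    simp only [Pi.smul_apply, Units.smul_def, smul_eq_mul, mul_pow, Finset.prod_mul_distrib,
      Finset.prod_pow_eq_pow_sum, hm']
    ring
  simp [projZeroLocus, h]

/-- `X` is a smooth cubic threefold in complex projective 4-space: the zero locus of an
irreducible cubic form all of whose zeros are nonsingular points (Jacobian criterion). -/
def IsSmoothCubicThreefold (X : Set (ℙ ℂ (Fin 5 → ℂ))) : Prop :=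
  ∃ F : MvPolynomial (Fin 5) ℂ, F.IsHomogeneous 3 ∧ Irreducible F ∧
    (∀ v : Fin 5 → ℂ, v ≠ 0 → MvPolynomial.eval v F = 0 →
      ∃ i : Fin 5, MvPolynomial.eval v (MvPolynomial.pderiv i F) ≠ 0) ∧
    X = projZeroLocus F

/-- `Aut(X) = {f ∈ Aut(ℙ⁴) = PGL(5, ℂ) | f(X) = X}`. -/
def projAut (X : Set (ℙ ℂ (Fin 5 → ℂ))) : Subgroup PGL(5, ℂ) :=
  MulAction.stabilizer PGL(5, ℂ) X

/-- The cyclic group of order `n` (for `n ≥ 1`), written multiplicatively. -/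
abbrev Cyc (n : ℕ) : Type := Multiplicative (ZMod n)

/-- The action of the cyclic group of order `n` on `N` in which the standard generator
acts by the automorphism `f`, where `f ^ n = 1`. -/
def cycAct {N : Type} [Group N] (n : ℕ) (f : MulAut N) (hf : f ^ n = 1) :
    Cyc n →* MulAut N :=
  AddMonoidHom.toMultiplicativeLeft
    (ZMod.lift n ⟨zmultiplesHom (Additive (MulAut N)) (Additive.ofMul f), by
      rw [zmultiplesHom_apply, natCast_zsmul, ← ofMul_pow, hf]; rfl⟩)

theorem cycAct_gen {N : Type} [Group N] (n : ℕ) (f : MulAut N) (hf : f ^ n = 1) :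
    cycAct n f hf (Multiplicative.ofAdd 1) = f := by
  have h : ZMod.lift n ⟨zmultiplesHom (Additive (MulAut N)) (Additive.ofMul f), by
      rw [zmultiplesHom_apply, natCast_zsmul, ← ofMul_pow, hf]; rfl⟩ ((1 : ℤ) : ZMod n)
      = Additive.ofMul f := by
    rw [ZMod.lift_coe]; simp
  rw [Int.cast_one] at h
  exact congrArg Additive.toMul h

/-- The automorphism `(a, b) ↦ (a, a * b)` of `C₃ × C₃`. -/
def shearAut : MulAut (Cyc 3 × Cyc 3) where
  toFun x := (x.1, x.1 * x.2)
  invFun x := (x.1, x.1⁻¹ * x.2)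
  left_inv x := by simp
  right_inv x := by simp
  map_mul' x y := Prod.ext rfl (mul_mul_mul_comm x.1 y.1 x.2 y.2)

theorem shearAut_pow : shearAut ^ 3 = 1 := by
  apply MulEquiv.ext
  decide

/-- The automorphism `x ↦ x ^ 4` of `C₉`. -/
def pow4Aut : MulAut (Cyc 9) where
  toFun x := x ^ 4
  invFun x := x ^ 7
  left_inv := by unfold Function.LeftInverse; decide
  right_inv := by unfold Function.RightInverse Function.LeftInverse; decide
  map_mul' x y := mul_pow x y 4

theorem pow4Aut_pow : pow4Aut ^ 3 = 1 := by
  apply MulEquiv.ext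
  decide

/-- The cyclic permutation `(a, b, c) ↦ (c, a, b)` of the factors of `C₃ × C₃ × C₃`. -/
def rotAut : MulAut (Cyc 3 × Cyc 3 × Cyc 3) where
  toFun x := (x.2.2, x.1, x.2.1)
  invFun x := (x.2.1, x.2.2, x.1)
  left_inv _ := rfl
  right_inv _ := rfl
  map_mul' _ _ := rfl

theorem rotAut_pow : rotAut ^ 3 = 1 := rfl

/-- `C₃² ⋊ C₃`, the nonabelian group of order 27 and exponent 3 (GAP ID `[27,3]`). -/
abbrev G27n3 : Type := SemidirectProduct (Cyc 3 × Cyc 3) (Cyc 3) (cycAct 3 shearAut shearAut_pow)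

/-- `C₉ ⋊ C₃`, the nonabelian group of order 27 and exponent 9 (GAP ID `[27,4]`). -/
abbrev G27n4 : Type := SemidirectProduct (Cyc 9) (Cyc 3) (cycAct 3 pow4Aut pow4Aut_pow)

/-- `C₃³ ⋊ C₃` with `C₃` permuting the three factors cyclically, i.e. the wreath product
`C₃ ≀ C₃`, of order 81 (GAP ID `[81,7]`). -/
abbrev G81n7 : Type :=
  SemidirectProduct (Cyc 3 × Cyc 3 × Cyc 3) (Cyc 3) (cycAct 3 rotAut rotAut_pow)

/-- `G` is isomorphic to one of the twelve groups `C₃`, `C₉`, `C₃²`, `C₉ × C₃`,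
`C₃² ⋊ C₃` (`[27,3]`), `C₉ ⋊ C₃` (`[27,4]`), `C₃³`, `C₃³ ⋊ C₃` (`[81,7]`),
`C₃ × (C₃² ⋊ C₃)` (`[81,12]`), `C₃ × (C₉ ⋊ C₃)` (`[81,13]`), `C₃⁴`,
`C₃ × (C₃³ ⋊ C₃)` (`[243,51]`). -/
def InListG3 (G : Type) [Group G] : Prop :=
  Nonempty (G ≃* Cyc 3) ∨
  Nonempty (G ≃* Cyc 9) ∨
  Nonempty (G ≃* Cyc 3 × Cyc 3) ∨
  Nonempty (G ≃* Cyc 9 × Cyc 3) ∨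
  Nonempty (G ≃* G27n3) ∨
  Nonempty (G ≃* G27n4) ∨
  Nonempty (G ≃* Cyc 3 × Cyc 3 × Cyc 3) ∨
  Nonempty (G ≃* G81n7) ∨
  Nonempty (G ≃* Cyc 3 × G27n3) ∨
  Nonempty (G ≃* Cyc 3 × G27n4) ∨
  Nonempty (G ≃* Cyc 3 × Cyc 3 × Cyc 3 × Cyc 3) ∨
  Nonempty (G ≃* Cyc 3 × G81n7)

end

/-!
Let `F` be the equation of the cubic threefold and let `P` be the group of matrices that preserve
`F` and represent an element of `G`. By the Nullstellensatz a projective symmetry multiplies `F`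
by a constant, which has a cube root, so `P` maps onto `G` (`MvPolynomial.exists_mem_linearLift`);
the kernel consists of the scalars of order dividing `3`, so `P` is again a `3`-group. It acts
faithfully on `ℂ⁵` and preserves the symmetric trilinear form `T` of `F`, and smoothness says that
`T v v ·` is nonzero for `v ≠ 0` (`IsCubicRep`).

* *Eigenvalues.* In an eigenbasis of an element of `P`, each eigenvalue `z` comes with the
  eigenvalue `z⁻²`. As there are only five, each is a ninth root of unity, and if one of them has
  order `9`, then the eigenvalues are `z, z⁻² = z ^ 7, z ^ 4` and two cube roots of unity
  (`IsCubicRep.eigenvalue_dichotomy`). Burnside's trace argument then shows that `P` is finite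
  (`IsCubicRep.finite`).
* *Monomial form.* Let `A` be an abelian normal subgroup of `P` that is its own centralizer. The
  quotient `P / A` permutes the at most five weights of `A` faithfully, so `A` has index `1` or
  `3`. In the second case an element `x` outside `A` rotates three basis vectors and has the two
  others as eigenvectors (`IsCubicRep.exists_monomial_basis`).
* *Splitting off the scalars.* The last basis vector is multiplied by cube roots of unity only, so
  its fixer in `P` is a complement of the scalars and is isomorphic to `G`
  (`MvPolynomial.nonempty_fixer_mulEquiv`).
* *Recognition.* If `P = A`, the fixer is elementary abelian of rank at most `4`, or it embeds in
  `C₉ × C₃` (`IsCubicRep.inListG3_of_diagonal`). Otherwise the relation `z ↦ z⁻²` among the three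
  rotated weights leaves two cases (`IsMonomialBasis.inListG3`). Either all weights of `A` are
  cube roots of unity, and the fixer is an extension by `C₃` of a subgroup of `𝔽₃⁴` on which `C₃`
  rotates three coordinates; `IsRotExt.inListG3` identifies it by the norm `1 + σ + σ²` of the
  rotation `σ` and by the cube of `x`. Or conjugation by `x` or by `x ^ 2` is `a ↦ a ^ 4`, and the
  fixer is `C₉ ⋊ C₃` up to a direct factor `C₃` (`inListG3_of_conj_eq_pow_four`).
-/

open Module


/-! ### Homomorphisms out of cyclic groups and semidirect products -/

/-- The homomorphism from the cyclic group of order `n` that sends the standard generator to `h`. -/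
noncomputable def cycHom {H : Type*} [Group H] (n : ℕ) (h : H) (hn : h ^ n = 1) : Cyc n →* H :=
  AddMonoidHom.toMultiplicativeLeft
    (ZMod.lift n ⟨zmultiplesHom (Additive H) (Additive.ofMul h), by
      rw [zmultiplesHom_apply, natCast_zsmul, ← ofMul_pow, hn]; rfl⟩)

theorem cycHom_ofAdd_natCast {H : Type*} [Group H] (n : ℕ) (h : H) (hn : h ^ n = 1) (k : ℕ) :
    cycHom n h hn (Multiplicative.ofAdd (k : ZMod n)) = h ^ k := by
  have e : ZMod.lift n ⟨zmultiplesHom (Additive H) (Additive.ofMul h), by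
      rw [zmultiplesHom_apply, natCast_zsmul, ← ofMul_pow, hn]; rfl⟩ ((k : ℤ) : ZMod n)
      = Additive.ofMul (h ^ k) := by
    rw [ZMod.lift_coe, zmultiplesHom_apply, natCast_zsmul, ofMul_pow]
  rw [Int.cast_natCast] at e
  exact congrArg Additive.toMul e

theorem cycHom_apply {H : Type*} [Group H] (n : ℕ) [NeZero n] (h : H) (hn : h ^ n = 1)
    (x : Cyc n) : cycHom n h hn x = h ^ x.toAdd.val := by
  rw [← cycHom_ofAdd_natCast n h hn, ZMod.natCast_zmod_val]; rfl

theorem cycHom_injective_of_orderOf {H : Type*} [Group H] (n : ℕ) [NeZero n] (h : H)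
    (hn : h ^ n = 1) (ho : orderOf h = n) : Function.Injective (cycHom n h hn) := by
  rw [injective_iff_map_eq_one]
  intro x hx
  rw [cycHom_apply] at hx
  have hd := orderOf_dvd_of_pow_eq_one hx
  rw [ho] at hd
  have h1 := Nat.eq_zero_of_dvd_of_lt hd (ZMod.val_lt _)
  exact congrArg Multiplicative.ofAdd ((ZMod.val_eq_zero _).1 h1)

/-- An intertwining relation for the standard generator of a cyclic group holds for
the whole group. -/
theorem cycAct_intertwines {N : Type} [Group N] {H : Type*} [Group H] {n : ℕ} [NeZero n]
    {f : MulAut N} {hf : f ^ n = 1} {fn : N →* H} {s : H} (hs : s ^ n = 1)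
    (h : ∀ y, fn (f y) = s * fn y * s⁻¹) (g : Cyc n) :
    fn.comp (cycAct n f hf g).toMonoidHom = (MulAut.conj (cycHom n s hs g)).toMonoidHom.comp fn := by
  have e : cycAct n f hf g = f ^ g.toAdd.val := cycHom_apply n f hf g
  rw [e, cycHom_apply]
  generalize g.toAdd.val = k
  ext y
  simp only [MonoidHom.coe_comp, Function.comp_apply, MulEquiv.coe_toMonoidHom, MulAut.conj_apply]
  induction k generalizing y with
  | zero => simp
  | succ k ih => rw [pow_succ, MulAut.mul_apply, ih, h, pow_succ]; group

/-- The homomorphism from `N ⋊ C_n` that restricts to `fn` on `N` and sends the standard generator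
of `C_n` to `s`. -/
noncomputable def semiHom {N : Type} [Group N] {H : Type*} [Group H] {n : ℕ} [NeZero n]
    {f : MulAut N} {hf : f ^ n = 1} (fn : N →* H) (s : H) (hs : s ^ n = 1)
    (h : ∀ y, fn (f y) = s * fn y * s⁻¹) : SemidirectProduct N (Cyc n) (cycAct n f hf) →* H :=
  SemidirectProduct.lift fn (cycHom n s hs) (cycAct_intertwines hs h)

theorem semiHom_apply {N : Type} [Group N] {H : Type*} [Group H] {n : ℕ} [NeZero n]
    {f : MulAut N} {hf : f ^ n = 1} (fn : N →* H) (s : H) (hs : s ^ n = 1)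
    (h : ∀ y, fn (f y) = s * fn y * s⁻¹) (x : SemidirectProduct N (Cyc n) (cycAct n f hf)) :
    semiHom fn s hs h x = fn x.left * s ^ x.right.toAdd.val := by
  rw [← cycHom_apply n s hs]; rfl

theorem mem_of_sq_mem {H : Type*} [Group H] {K : Subgroup H} {s : H} (hs : s ^ 3 = 1)
    (h : s ^ 2 ∈ K) : s ∈ K := by
  have e : s = s ^ 2 * s ^ 2 := by
    rw [← pow_add, show 2 + 2 = 3 + 1 from rfl, pow_add, hs, one_mul, pow_one]
  rw [e]; exact K.mul_mem h h

theorem eq_zero_of_pow_val_mem {H : Type*} [Group H] {K : Subgroup H} {s : H} (hs : s ^ 3 = 1)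
    (hK : s ∉ K) (k : ZMod 3) (hk : s ^ k.val ∈ K) : k = 0 := by
  obtain ⟨n, hn⟩ : ∃ n, n = k.val := ⟨_, rfl⟩
  have hlt : k.val < 3 := ZMod.val_lt k
  rw [← hn] at hk hlt
  interval_cases n
  · exact (ZMod.val_eq_zero k).1 hn.symm
  · exact absurd (by simpa using hk) hK
  · exact absurd (mem_of_sq_mem hs hk) hK

theorem semiHom_injective {N : Type} [Group N] {H : Type*} [Group H]
    {f : MulAut N} {hf : f ^ 3 = 1} {fn : N →* H} (hfn : Function.Injective fn) {s : H}
    (hs : s ^ 3 = 1) (h : ∀ y, fn (f y) = s * fn y * s⁻¹) (hsn : s ∉ fn.range) :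
    Function.Injective (semiHom (hf := hf) fn s hs h) := by
  rw [injective_iff_map_eq_one]
  intro x hx
  rw [semiHom_apply] at hx
  have h0 : x.right.toAdd = 0 := by
    refine eq_zero_of_pow_val_mem hs hsn _ ?_
    rw [← inv_eq_of_mul_eq_one_right hx]
    exact inv_mem ⟨_, rfl⟩
  rw [h0, ZMod.val_zero, pow_zero, mul_one] at hx
  exact SemidirectProduct.ext (hfn (hx.trans (map_one fn).symm)) (congrArg Multiplicative.ofAdd h0)

/-- The homomorphism from `C₃ × T` that sends the standard generator of `C₃` to a central
element `e` and restricts to `φ` on `T`. -/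
noncomputable def prodHom {T : Type*} [Group T] {H : Type*} [Group H] (e : H) (he : e ^ 3 = 1)
    (φ : T →* H) (hc : ∀ x, Commute e x) : Cyc 3 × T →* H :=
  (cycHom 3 e he).noncommCoprod φ fun x y => by
    rw [cycHom_apply]; exact (hc _).pow_left _

theorem prodHom_apply {T : Type*} [Group T] {H : Type*} [Group H] (e : H) (he : e ^ 3 = 1)
    (φ : T →* H) (hc : ∀ x, Commute e x) (x : Cyc 3 × T) :
    prodHom e he φ hc x = e ^ x.1.toAdd.val * φ x.2 := by
  rw [← cycHom_apply 3 e he]; rfl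

theorem prodHom_injective {T : Type*} [Group T] {H : Type*} [Group H] {e : H} (he : e ^ 3 = 1)
    {φ : T →* H} (hφ : Function.Injective φ) (hc : ∀ x, Commute e x) (hn : e ∉ φ.range) :
    Function.Injective (prodHom e he φ hc) := by
  rw [injective_iff_map_eq_one]
  intro x hx
  rw [prodHom_apply] at hx
  have h0 : x.1.toAdd = 0 := by
    refine eq_zero_of_pow_val_mem he hn _ ?_
    rw [eq_inv_of_mul_eq_one_left hx]
    exact inv_mem ⟨_, rfl⟩
  rw [h0, ZMod.val_zero, pow_zero, one_mul] at hx
  exact Prod.ext (congrArg Multiplicative.ofAdd h0) (hφ (hx.trans (map_one φ).symm))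

/-- A semidirect product embedded in a group is the whole group as soon as its range contains
a subgroup `M` and an element `x` that generate the group. -/
theorem surjective_of_le_range {T : Type*} [Group T] {H : Type*} [Group H] (φ : T →* H)
    (M : Subgroup H) (x : H) (hgen : ∀ h : H, ∃ k : ℕ, x ^ k * h ∈ M)
    (hM : ∀ m ∈ M, m ∈ φ.range) (hx : x ∈ φ.range) : Function.Surjective φ := by
  intro h
  obtain ⟨k, hk⟩ := hgen h
  exact ((Subgroup.mul_mem_cancel_left _ (pow_mem hx k)).1 (hM _ hk) : h ∈ φ.range)

/-! ### Embedding the nonabelian groups of the list -/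

theorem conj_pow_eq {H : Type*} [Group H] {s a b : H} (h : s * a * s⁻¹ = b) (k : ℕ) :
    s * a ^ k * s⁻¹ = b ^ k := by
  rw [← h, conj_pow]

/-- Elements `g` of order `9` and `y` of order `3` with `y * g * y⁻¹ = g ^ 4` and `y` not a power
of `g` generate a copy of `C₉ ⋊ C₃`. -/
theorem exists_embedding_G27n4 {H : Type*} [Group H] {g y : H} (hg : g ^ 9 = 1) (hg3 : g ^ 3 ≠ 1)
    (hy : y ^ 3 = 1) (hyg : ∀ i : ℕ, y ≠ g ^ i) (hc : y * g * y⁻¹ = g ^ 4) :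
    ∃ φ : G27n4 →* H, Function.Injective φ ∧ g ∈ φ.range ∧ y ∈ φ.range ∧
      ∀ r ∈ φ.range, ∃ i j : ℕ, r = g ^ i * y ^ j := by
  have ho : orderOf g = 9 := orderOf_eq_prime_pow (p := 3) (n := 1) (by simpa using hg3) hg
  have hcomp : ∀ x, cycHom 9 g hg (pow4Aut x) = y * cycHom 9 g hg x * y⁻¹ := by
    intro x
    rw [cycHom_apply _ _ _ x, conj_pow_eq hc, ← pow_mul, mul_comm, pow_mul, ← cycHom_apply 9 g hg x,
      ← map_pow]
    rfl
  refine ⟨semiHom _ y hy hcomp, semiHom_injective (cycHom_injective_of_orderOf 9 g hg ho) hy hcomp ?_,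
    ⟨SemidirectProduct.inl (Multiplicative.ofAdd ((1 : ℕ) : ZMod 9)), ?_⟩,
    ⟨SemidirectProduct.inr (Multiplicative.ofAdd ((1 : ℕ) : ZMod 3)), ?_⟩, ?_⟩
  · rintro ⟨x, hx⟩
    exact hyg _ (by rw [← hx, cycHom_apply])
  · rw [semiHom, SemidirectProduct.lift_inl, cycHom_ofAdd_natCast, pow_one]
  · rw [semiHom, SemidirectProduct.lift_inr, cycHom_ofAdd_natCast, pow_one]
  · rintro r ⟨x, rfl⟩
    exact ⟨_, _, by rw [semiHom_apply, cycHom_apply]⟩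

/-- Elements `m`, `z` that generate a copy of `C₃²` in `K` and an element `s ∉ K` of order `3` that
shears it generate a copy of `C₃² ⋊ C₃`, which meets `K` in that `C₃²` only. -/
theorem exists_embedding_G27n3 {H : Type*} [Group H] {K : Subgroup H} {m z s : H} (hm : m ^ 3 = 1)
    (hz : z ^ 3 = 1) (hs : s ^ 3 = 1) (hmz : Commute m z) (hmK : m ∈ K) (hzK : z ∈ K) (hsK : s ∉ K)
    (hind : ∀ i j : ZMod 3, m ^ i.val * z ^ j.val = 1 → i = 0 ∧ j = 0)
    (hcm : s * m * s⁻¹ = m * z) (hcz : s * z * s⁻¹ = z) :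
    ∃ φ : G27n3 →* H, Function.Injective φ ∧ m ∈ φ.range ∧ z ∈ φ.range ∧ s ∈ φ.range ∧
      ∀ r ∈ φ.range, r ∈ K → ∃ i j : ℕ, r = m ^ i * z ^ j := by
  let fn : Cyc 3 × Cyc 3 →* H := (cycHom 3 m hm).noncommCoprod (cycHom 3 z hz) fun x y => by
    rw [cycHom_apply, cycHom_apply]; exact hmz.pow_pow _ _
  have fn_apply : ∀ x, fn x = m ^ x.1.toAdd.val * z ^ x.2.toAdd.val := fun x => by
    rw [← cycHom_apply 3 m hm, ← cycHom_apply 3 z hz]; rfl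
  have hcomp : ∀ x, fn (shearAut x) = s * fn x * s⁻¹ := by
    intro x
    have e : fn (shearAut x) = cycHom 3 m hm x.1 * (cycHom 3 z hz x.1 * cycHom 3 z hz x.2) := by
      rw [← map_mul]; rfl
    rw [e, fn_apply, ← conj_mul, conj_pow_eq hcm, conj_pow_eq hcz, hmz.mul_pow, cycHom_apply,
      cycHom_apply, cycHom_apply, mul_assoc]
  have hfn : Function.Injective fn := by
    rw [injective_iff_map_eq_one]
    intro x hx
    rw [fn_apply] at hx
    obtain ⟨h1, h2⟩ := hind _ _ hx
    exact Prod.ext (congrArg Multiplicative.ofAdd h1) (congrArg Multiplicative.ofAdd h2)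
  have hfK : ∀ x, fn x ∈ K := fun x => by
    rw [fn_apply]; exact mul_mem (pow_mem hmK _) (pow_mem hzK _)
  refine ⟨semiHom fn s hs hcomp, semiHom_injective hfn hs hcomp ?_,
    ⟨SemidirectProduct.inl (Multiplicative.ofAdd ((1 : ℕ) : ZMod 3), 1), ?_⟩,
    ⟨SemidirectProduct.inl (1, Multiplicative.ofAdd ((1 : ℕ) : ZMod 3)), ?_⟩,
    ⟨SemidirectProduct.inr (Multiplicative.ofAdd ((1 : ℕ) : ZMod 3)), ?_⟩, ?_⟩
  · rintro ⟨x, hx⟩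
    exact hsK (hx ▸ hfK x)
  · rw [semiHom, SemidirectProduct.lift_inl]
    simp only [fn, MonoidHom.noncommCoprod_apply, cycHom_ofAdd_natCast, map_one, pow_one, mul_one]
  · rw [semiHom, SemidirectProduct.lift_inl]
    simp only [fn, MonoidHom.noncommCoprod_apply, cycHom_ofAdd_natCast, map_one, pow_one, one_mul]
  · rw [semiHom, SemidirectProduct.lift_inr, cycHom_ofAdd_natCast, pow_one]
  · rintro r ⟨x, rfl⟩ hr
    rw [semiHom_apply] at hr ⊢
    have h0 := eq_zero_of_pow_val_mem hs hsK _ ((K.mul_mem_cancel_left (hfK _)).1 hr)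
    exact ⟨_, _, by rw [h0, ZMod.val_zero, pow_zero, mul_one, fn_apply]⟩

/-- Elements `a`, `b`, `c` that generate a copy of `C₃³` in `K` and an element `s ∉ K` of order `3`
that permutes them cyclically generate a copy of `C₃³ ⋊ C₃`, which meets `K` in that `C₃³`
only. -/
theorem exists_embedding_G81n7 {H : Type*} [Group H] {K : Subgroup H} {a b c s : H}
    (ha : a ^ 3 = 1) (hb : b ^ 3 = 1) (hc : c ^ 3 = 1) (hs : s ^ 3 = 1) (hab : Commute a b)
    (hac : Commute a c) (hbc : Commute b c) (haK : a ∈ K) (hbK : b ∈ K) (hcK : c ∈ K) (hsK : s ∉ K)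
    (hind : ∀ i j k : ZMod 3, a ^ i.val * (b ^ j.val * c ^ k.val) = 1 → i = 0 ∧ j = 0 ∧ k = 0)
    (hsa : s * a * s⁻¹ = b) (hsb : s * b * s⁻¹ = c) (hsc : s * c * s⁻¹ = a) :
    ∃ φ : G81n7 →* H, Function.Injective φ ∧ a ∈ φ.range ∧ s ∈ φ.range ∧
      ∀ r ∈ φ.range, r ∈ K → ∃ i j k : ZMod 3, r = a ^ i.val * (b ^ j.val * c ^ k.val) := by
  let f2 : Cyc 3 × Cyc 3 →* H := (cycHom 3 b hb).noncommCoprod (cycHom 3 c hc) fun x y => by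
    rw [cycHom_apply, cycHom_apply]; exact hbc.pow_pow _ _
  have f2_apply : ∀ x, f2 x = b ^ x.1.toAdd.val * c ^ x.2.toAdd.val := fun x => by
    rw [← cycHom_apply 3 b hb, ← cycHom_apply 3 c hc]; rfl
  let fn : Cyc 3 × Cyc 3 × Cyc 3 →* H := (cycHom 3 a ha).noncommCoprod f2 fun x y => by
    rw [cycHom_apply, f2_apply]; exact (hab.pow_pow _ _).mul_right (hac.pow_pow _ _)
  have fn_apply : ∀ x, fn x = a ^ x.1.toAdd.val * (b ^ x.2.1.toAdd.val * c ^ x.2.2.toAdd.val) :=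
    fun x => by rw [← cycHom_apply 3 a ha, ← f2_apply]; rfl
  have hcomp : ∀ x, fn (rotAut x) = s * fn x * s⁻¹ := by
    intro x
    rw [fn_apply, fn_apply, ← conj_mul, ← conj_mul, conj_pow_eq hsa, conj_pow_eq hsb,
      conj_pow_eq hsc, ← mul_assoc (b ^ _), ((hab.pow_pow _ _).mul_right (hac.pow_pow _ _)).eq]
    rfl
  have hfn : Function.Injective fn := by
    rw [injective_iff_map_eq_one]
    intro x hx
    rw [fn_apply] at hx
    obtain ⟨h1, h2, h3⟩ := hind _ _ _ hx
    exact Prod.ext (congrArg Multiplicative.ofAdd h1)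
      (Prod.ext (congrArg Multiplicative.ofAdd h2) (congrArg Multiplicative.ofAdd h3))
  have hfK : ∀ x, fn x ∈ K := fun x => by
    rw [fn_apply]; exact mul_mem (pow_mem haK _) (mul_mem (pow_mem hbK _) (pow_mem hcK _))
  refine ⟨semiHom fn s hs hcomp, semiHom_injective hfn hs hcomp ?_,
    ⟨SemidirectProduct.inl (Multiplicative.ofAdd ((1 : ℕ) : ZMod 3), 1), ?_⟩,
    ⟨SemidirectProduct.inr (Multiplicative.ofAdd ((1 : ℕ) : ZMod 3)), ?_⟩, ?_⟩
  · rintro ⟨x, hx⟩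
    exact hsK (hx ▸ hfK x)
  · rw [semiHom, SemidirectProduct.lift_inl]
    simp only [fn, MonoidHom.noncommCoprod_apply, cycHom_ofAdd_natCast, map_one, pow_one, mul_one]
  · rw [semiHom, SemidirectProduct.lift_inr, cycHom_ofAdd_natCast, pow_one]
  · rintro r ⟨x, rfl⟩ hr
    rw [semiHom_apply] at hr ⊢
    have h0 := eq_zero_of_pow_val_mem hs hsK _ ((K.mul_mem_cancel_left (hfK _)).1 hr)
    exact ⟨x.left.1.toAdd, x.left.2.1.toAdd, x.left.2.2.toAdd, by
      rw [h0, ZMod.val_zero, pow_zero, mul_one, fn_apply]⟩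

/-! ### Cyclic extensions of subgroups of `𝔽₃⁴` on which the generator rotates three coordinates -/

/-- `H` is generated by a normal subgroup `M` of index `3` and an element `x`; the function `κ`
restricts to an embedding of `M` in `𝔽₃⁴`, for which conjugation by `x` rotates the first three
coordinates nontrivially, and `x ^ 3` has coordinates `(l, l, l, 0)`. -/
structure IsRotExt {H : Type*} [Group H] (M : Subgroup H) (κ : H → Fin 4 → ZMod 3) (x : H) :
    Prop where
  map_mul : ∀ a ∈ M, ∀ b ∈ M, κ (a * b) = κ a + κ b
  eq_one : ∀ a ∈ M, κ a = 0 → a = 1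
  conj_mem : ∀ a ∈ M, x * a * x⁻¹ ∈ M
  conj : ∀ a ∈ M, κ (x * a * x⁻¹) = ![κ a 2, κ a 0, κ a 1, κ a 3]
  not_mem : x ∉ M
  gen : ∀ h, ∃ k : ℕ, x ^ k * h ∈ M
  cube_mem : x ^ 3 ∈ M
  cube : ∃ l, κ (x ^ 3) = ![l, l, l, 0]
  nontriv : ∃ m ∈ M, κ m 0 ≠ κ m 1

namespace IsRotExt

variable {H : Type*} [Group H] {M : Subgroup H} {κ : H → Fin 4 → ZMod 3} {x : H}

theorem map_one (R : IsRotExt M κ x) : κ 1 = 0 := by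
  have := R.map_mul 1 M.one_mem 1 M.one_mem
  rw [mul_one] at this
  exact left_eq_add.1 this

theorem map_pow (R : IsRotExt M κ x) {a : H} (ha : a ∈ M) (k : ℕ) : κ (a ^ k) = (k : ZMod 3) • κ a := by
  induction k with
  | zero => simp [R.map_one]
  | succ k ih => rw [pow_succ, R.map_mul _ (pow_mem ha k) _ ha, ih]; push_cast; rw [add_smul, one_smul]

theorem map_inv (R : IsRotExt M κ x) {a : H} (ha : a ∈ M) : κ a⁻¹ = -κ a := by
  have := R.map_mul _ ha _ (inv_mem ha)
  rw [mul_inv_cancel, R.map_one] at this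
  exact eq_neg_of_add_eq_zero_right this.symm

theorem ext (R : IsRotExt M κ x) {a b : H} (ha : a ∈ M) (hb : b ∈ M) (h : κ a = κ b) : a = b := by
  have := R.eq_one (a * b⁻¹) (mul_mem ha (inv_mem hb))
    (by rw [R.map_mul _ ha _ (inv_mem hb), R.map_inv hb, h, add_neg_cancel])
  exact mul_inv_eq_one.1 this

theorem pow_three (R : IsRotExt M κ x) {a : H} (ha : a ∈ M) : a ^ 3 = 1 :=
  R.eq_one _ (pow_mem ha 3) (by rw [R.map_pow ha]; exact zero_smul _ _)

theorem commute (R : IsRotExt M κ x) {a b : H} (ha : a ∈ M) (hb : b ∈ M) : Commute a b :=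
  R.ext (mul_mem ha hb) (mul_mem hb ha) (by rw [R.map_mul _ ha _ hb, R.map_mul _ hb _ ha, add_comm])

/-- An element whose coordinates are fixed by the rotation is central. -/
theorem central (R : IsRotExt M κ x) {e : H} (he : e ∈ M) (h : κ (x * e * x⁻¹) = κ e) (y : H) :
    Commute e y := by
  have hx : Commute e x := by
    have h1 := R.ext (R.conj_mem _ he) he h
    exact (mul_inv_eq_iff_eq_mul.1 h1).symm
  obtain ⟨k, hk⟩ := R.gen y
  have h2 : Commute e (x ^ k * y) := R.commute he hk
  have h3 := (hx.pow_right k).inv_right.mul_right h2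
  rwa [inv_mul_cancel_left] at h3

/-- The two ways in which an embedding `φ : T → H` can exhaust `H`: either `M` has no element with
coordinates `(0, 0, 0, 1)` and `φ` is onto, or such an element splits off as a direct factor. -/
theorem mulEquiv_or (R : IsRotExt M κ x) {T : Type*} [Group T] (φ : T →* H)
    (hφ : Function.Injective φ) (hx : x ∈ φ.range)
    (hM : ∀ m ∈ M, ∃ r ∈ φ.range, r ∈ M ∧ κ m 0 = κ r 0 ∧ κ m 1 = κ r 1 ∧ κ m 2 = κ r 2)
    (hr : ∀ r ∈ φ.range, r ∈ M → κ r 0 = 0 → κ r 1 = 0 → κ r 2 = 0 → κ r 3 = 0) :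
    Nonempty (H ≃* T) ∨ Nonempty (H ≃* Cyc 3 × T) := by
  have key : ∀ m ∈ M, ∃ r ∈ φ.range, ∃ a ∈ M, m = a * r ∧ ∃ l, κ a = ![0, 0, 0, l] := by
    intro m hm
    obtain ⟨r, hrr, hrM, h0, h1, h2⟩ := hM m hm
    refine ⟨r, hrr, m * r⁻¹, mul_mem hm (inv_mem hrM), by group, κ m 3 - κ r 3, ?_⟩
    rw [R.map_mul _ hm _ (inv_mem hrM), R.map_inv hrM]
    ext i
    fin_cases i <;> simp [*, sub_eq_add_neg]
  by_cases he : ∃ e ∈ M, κ e = ![0, 0, 0, 1]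
  · right
    obtain ⟨e, heM, he⟩ := he
    have hc := R.central heM (by rw [R.conj _ heM, he]; rfl)
    have hinj := prodHom_injective (R.pow_three heM) hφ hc fun h => by
      have := hr e h heM (by rw [he]; rfl) (by rw [he]; rfl) (by rw [he]; rfl)
      rw [he] at this
      exact one_ne_zero this
    have hsub : ∀ r ∈ φ.range, r ∈ (prodHom e (R.pow_three heM) φ hc).range := by
      rintro r ⟨t, rfl⟩
      exact ⟨(1, t), by simp [prodHom_apply]⟩
    refine ⟨(MulEquiv.ofBijective _ ⟨hinj, surjective_of_le_range _ M x R.gen ?_ (hsub _ hx)⟩).symm⟩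
    intro m hm
    obtain ⟨r, hrr, a, ha, rfl, l, hl⟩ := key m hm
    refine mul_mem ⟨(Multiplicative.ofAdd l, 1), ?_⟩ (hsub r hrr)
    rw [prodHom_apply]
    refine R.ext (by simpa using pow_mem heM _) ha ?_
    simp only [_root_.map_one, mul_one]
    rw [R.map_pow heM, hl, he, toAdd_ofAdd, ZMod.natCast_zmod_val]
    ext i
    fin_cases i <;> simp
  · left
    refine ⟨(MulEquiv.ofBijective φ ⟨hφ, surjective_of_le_range _ M x R.gen ?_ hx⟩).symm⟩
    intro m hm
    obtain ⟨r, hrr, a, ha, rfl, l, hl⟩ := key m hm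
    refine mul_mem ?_ hrr
    by_cases h0 : l = 0
    · rw [R.eq_one a ha (by rw [hl, h0]; ext i; fin_cases i <;> rfl)]
      exact one_mem _
    · refine absurd ⟨a ^ l.val, pow_mem ha _, ?_⟩ he
      rw [R.map_pow ha, hl, ZMod.natCast_zmod_val]
      have : l * l = 1 := by clear hl; revert l; decide
      ext i
      fin_cases i <;> simp [this]

/-- An element of `𝔽₃³` with nonzero coordinate sum and its two rotations are linearly independent;
`circulant_surjective` says that they span. -/
theorem circulant_injective : ∀ a b c i j k : ZMod 3, a + b + c ≠ 0 → i * a + (j * c + k * b) = 0 →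
    i * b + (j * a + k * c) = 0 → i * c + (j * b + k * a) = 0 → i = 0 ∧ j = 0 ∧ k = 0 := by
  decide

theorem circulant_surjective : ∀ a b c a' b' c' : ZMod 3, a + b + c ≠ 0 →
    ∃ i j k : ZMod 3, a' = i * a + (j * c + k * b) ∧
    b' = i * b + (j * a + k * c) ∧ c' = i * c + (j * b + k * a) := by
  decide

/-- Multiplying `x` by `m` adds the norm of `m` under rotation to the coordinates of `x ^ 3`. -/
theorem pow_mul_cube (R : IsRotExt M κ x) {m : H} (hm : m ∈ M) {l : ZMod 3}
    (hl : κ (x ^ 3) = ![l, l, l, 0]) :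
    (m * x) ^ 3 ∈ M ∧ κ ((m * x) ^ 3) = ![l + (κ m 0 + κ m 1 + κ m 2),
      l + (κ m 0 + κ m 1 + κ m 2), l + (κ m 0 + κ m 1 + κ m 2), 0] := by
  have h1 := R.conj_mem _ hm
  have h2 := R.conj_mem _ h1
  have e : (m * x) ^ 3 = m * ((x * m * x⁻¹) * ((x * (x * m * x⁻¹) * x⁻¹) * x ^ 3)) := by
    simp only [pow_succ, pow_zero]; group
  rw [e]
  refine ⟨mul_mem hm (mul_mem h1 (mul_mem h2 R.cube_mem)), ?_⟩
  rw [R.map_mul _ hm _ (mul_mem h1 (mul_mem h2 R.cube_mem)),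
    R.map_mul _ h1 _ (mul_mem h2 R.cube_mem), R.map_mul _ h2 _ R.cube_mem, R.conj _ h1, R.conj _ hm,
    hl]
  have h3 : ∀ t : ZMod 3, t + (t + t) = 0 := by decide
  ext i
  fin_cases i <;> simp
  · ring
  · ring
  · ring
  · exact h3 _

/-- If the norm of `M` is nontrivial, then `x` can be chosen of order `3` and `H` is
`C₃ ≀ C₃`, up to a direct factor `C₃`. -/
theorem mulEquiv_G81n7 (R : IsRotExt M κ x) {m : H} (hm : m ∈ M)
    (hs : κ m 0 + κ m 1 + κ m 2 ≠ 0) : Nonempty (H ≃* G81n7) ∨ Nonempty (H ≃* Cyc 3 × G81n7) := by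
  obtain ⟨l, hl⟩ := R.cube
  -- `m ^ t * x` has trivial cube when `t` times the norm of `m` cancels `x ^ 3`
  obtain ⟨t, ht⟩ : ∃ t : ZMod 3, l + t * (κ m 0 + κ m 1 + κ m 2) = 0 :=
    ⟨-l / (κ m 0 + κ m 1 + κ m 2), by field_simp; ring⟩
  set n := m ^ t.val with hn
  have hnM : n ∈ M := pow_mem hm _
  have hκn : κ n = t • κ m := by rw [hn, R.map_pow hm, ZMod.natCast_zmod_val]
  obtain ⟨hc1, hc2⟩ := R.pow_mul_cube hnM hl
  have hs3 : (n * x) ^ 3 = 1 := by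
    refine R.eq_one _ hc1 ?_
    have ht' : l + ((t • κ m) 0 + (t • κ m) 1 + (t • κ m) 2) = 0 := by
      simp only [Pi.smul_apply, smul_eq_mul]; linear_combination ht
    rw [hc2, hκn, ht']
    ext i
    fin_cases i <;> rfl
  have hconj : ∀ a ∈ M, n * x * a * (n * x)⁻¹ = x * a * x⁻¹ := by
    intro a ha
    have := (R.commute hnM (R.conj_mem _ ha)).eq
    calc n * x * a * (n * x)⁻¹ = n * (x * a * x⁻¹) * n⁻¹ := by group
      _ = _ := by rw [this]; group
  have h1 := R.conj_mem _ hm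
  have h2 := R.conj_mem _ h1
  have hκ1 := R.conj _ hm
  have hκ2 := R.conj _ h1
  have hκ : ∀ i j k : ZMod 3, κ (m ^ i.val * ((x * m * x⁻¹) ^ j.val *
      (x * (x * m * x⁻¹) * x⁻¹) ^ k.val)) = ![i * κ m 0 + (j * κ m 2 + k * κ m 1),
      i * κ m 1 + (j * κ m 0 + k * κ m 2), i * κ m 2 + (j * κ m 1 + k * κ m 0),
      i * κ m 3 + (j * κ m 3 + k * κ m 3)] := by
    intro i j k
    rw [R.map_mul _ (pow_mem hm _) _ (mul_mem (pow_mem h1 _) (pow_mem h2 _)),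
      R.map_mul _ (pow_mem h1 _) _ (pow_mem h2 _), R.map_pow hm, R.map_pow h1, R.map_pow h2, hκ2,
      hκ1, ZMod.natCast_zmod_val, ZMod.natCast_zmod_val, ZMod.natCast_zmod_val]
    ext i
    fin_cases i <;> simp
  have hind : ∀ i j k : ZMod 3, m ^ i.val * ((x * m * x⁻¹) ^ j.val *
      (x * (x * m * x⁻¹) * x⁻¹) ^ k.val) = 1 → i = 0 ∧ j = 0 ∧ k = 0 := by
    intro i j k h
    have h := hκ i j k ▸ congrArg κ h
    rw [R.map_one] at h
    exact circulant_injective _ _ _ i j k hs (congrFun h 0) (congrFun h 1) (congrFun h 2)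
  have hrot : n * x * (x * (x * m * x⁻¹) * x⁻¹) * (n * x)⁻¹ = m := by
    rw [hconj _ h2]
    refine R.ext (R.conj_mem _ h2) hm ?_
    rw [R.conj _ h2, hκ2, hκ1]
    ext i
    fin_cases i <;> simp
  obtain ⟨φ, hφ, hmr, hxr, hrr⟩ := exists_embedding_G81n7 (K := M) (a := m) (b := x * m * x⁻¹)
    (c := x * (x * m * x⁻¹) * x⁻¹) (s := n * x) (R.pow_three hm) (R.pow_three h1) (R.pow_three h2)
    hs3 (R.commute hm h1) (R.commute hm h2) (R.commute h1 h2) hm h1 h2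
    (fun h => R.not_mem ((M.mul_mem_cancel_left hnM).1 h)) hind (hconj _ hm) (hconj _ h1) hrot
  have hxφ : x ∈ φ.range := (φ.range.mul_mem_cancel_left (pow_mem hmr _)).1 hxr
  refine R.mulEquiv_or φ hφ hxφ ?_ ?_
  · intro a _
    obtain ⟨i, j, k, e0, e1, e2⟩ := circulant_surjective _ _ _ (κ a 0) (κ a 1) (κ a 2) hs
    have hx1 := mul_mem (mul_mem hxφ hmr) (inv_mem hxφ)
    have hx2 := mul_mem (mul_mem hxφ hx1) (inv_mem hxφ)
    refine ⟨_, mul_mem (pow_mem hmr i.val) (mul_mem (pow_mem hx1 j.val) (pow_mem hx2 k.val)),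
      mul_mem (pow_mem hm _) (mul_mem (pow_mem h1 _) (pow_mem h2 _)), ?_⟩
    rw [hκ]
    exact ⟨e0, e1, e2⟩
  · intro r hr hrM r0 r1 r2
    obtain ⟨i, j, k, rfl⟩ := hrr r hr hrM
    rw [hκ] at r0 r1 r2 ⊢
    obtain ⟨rfl, rfl, rfl⟩ := circulant_injective _ _ _ i j k hs r0 r1 r2
    simp

/-- The vectors of `𝔽₃³` with coordinate sum `0` form a plane, spanned by the diagonal and any
nonconstant vector of this kind. -/
theorem coord_combination : ∀ a b c a' b' c' : ZMod 3, a + b + c = 0 → c - a ≠ 0 → a' + b' + c' = 0 →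
    ∃ i j : ZMod 3, a' = i * a + j * (c - a) ∧ b' = i * b + j * (c - a) ∧
      c' = i * c + j * (c - a) := by
  decide

theorem coord_independent : ∀ a b c d i j : ZMod 3, a + b + c = 0 → c - a = d → d ≠ 0 →
    i * a + j * d = 0 → i * b + j * d = 0 → i = 0 ∧ j = 0 := by
  decide

/-- If the norm of `M` is trivial, then `H` is nonabelian of order `27`, up to a direct
factor `C₃`; its exponent depends on whether `x` has order `3`. -/
theorem mulEquiv_G27 (R : IsRotExt M κ x) (hs : ∀ m ∈ M, κ m 0 + κ m 1 + κ m 2 = 0) :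
    (Nonempty (H ≃* G27n3) ∨ Nonempty (H ≃* Cyc 3 × G27n3)) ∨
    (Nonempty (H ≃* G27n4) ∨ Nonempty (H ≃* Cyc 3 × G27n4)) := by
  obtain ⟨l, hl⟩ := R.cube
  -- the commutator `[x, m]` is the diagonal element `(d, d, d, 0)`, and `d` can be prescribed
  have hm : ∀ d : ZMod 3, d ≠ 0 → ∃ m ∈ M, κ m 2 - κ m 0 = d := by
    intro d hd
    obtain ⟨m, hm, h01⟩ := R.nontriv
    have h2 : κ m 2 - κ m 0 ≠ 0 := by
      have aux : ∀ a b c : ZMod 3, a + b + c = 0 → a ≠ b → c - a ≠ 0 := by decide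
      exact aux _ _ _ (hs m hm) h01
    refine ⟨m ^ (d / (κ m 2 - κ m 0)).val, pow_mem hm _, ?_⟩
    rw [R.map_pow hm, ZMod.natCast_zmod_val, Pi.smul_apply, Pi.smul_apply, smul_eq_mul, smul_eq_mul,
      ← mul_sub, div_mul_cancel₀ _ h2]
  have hz : ∀ m ∈ M, ∀ d, κ m 2 - κ m 0 = d → κ (m⁻¹ * (x * m * x⁻¹)) = ![d, d, d, 0] := by
    intro m hm d hd
    rw [R.map_mul _ (inv_mem hm) _ (R.conj_mem _ hm), R.map_inv hm, R.conj _ hm]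
    have aux : ∀ a b c d : ZMod 3, a + b + c = 0 → c - a = d → -a + c = d ∧ -b + a = d ∧ -c + b = d := by
      decide
    obtain ⟨e1, e2, e3⟩ := aux _ _ _ _ (hs m hm) hd
    ext i
    fin_cases i <;> simp [e1, e2, e3]
  have hzc : ∀ z ∈ M, ∀ d, κ z = ![d, d, d, 0] → ∀ y, Commute z y := fun z hz d hd y =>
    R.central hz (by rw [R.conj _ hz, hd]; rfl) y
  by_cases h0 : l = 0
  · left
    obtain ⟨m, hmM, hd⟩ := hm 1 one_ne_zero
    have hzM := mul_mem (inv_mem hmM) (R.conj_mem _ hmM)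
    have hκz := hz m hmM 1 hd
    set z := m⁻¹ * (x * m * x⁻¹) with hzdef
    have hx3 : x ^ 3 = 1 := R.eq_one _ R.cube_mem (by rw [hl, h0]; ext i; fin_cases i <;> rfl)
    have hκ : ∀ i j : ℕ, κ (m ^ i * z ^ j) = (i : ZMod 3) • κ m + (j : ZMod 3) • ![1, 1, 1, 0] := by
      intro i j
      rw [R.map_mul _ (pow_mem hmM _) _ (pow_mem hzM _), R.map_pow hmM, R.map_pow hzM, hκz]
    have hind : ∀ i j : ℕ, κ (m ^ i * z ^ j) 0 = 0 → κ (m ^ i * z ^ j) 1 = 0 →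
        (i : ZMod 3) = 0 ∧ (j : ZMod 3) = 0 := by
      intro i j e0 e1
      rw [hκ] at e0 e1
      refine coord_independent _ _ _ 1 _ _ (hs m hmM) hd one_ne_zero ?_ ?_
      · simpa using e0
      · simpa using e1
    obtain ⟨φ, hφ, hmr, hzr, hxr, hrr⟩ := exists_embedding_G27n3 (K := M) (m := m) (z := z) (s := x)
      (R.pow_three hmM) (R.pow_three hzM) hx3 (R.commute hmM hzM) hmM hzM R.not_mem
      (fun i j h => by
        have := hind i.val j.val (by rw [h, R.map_one]; rfl) (by rw [h, R.map_one]; rfl)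
        simpa using this) (by rw [hzdef]; group)
      (by rw [← (hzc z hzM 1 hκz x).eq, mul_inv_cancel_right])
    refine R.mulEquiv_or φ hφ hxr ?_ ?_
    · intro a ha
      obtain ⟨i, j, e0, e1, e2⟩ := coord_combination _ _ _ _ _ _ (hs m hmM)
        (by rw [hd]; exact one_ne_zero) (hs a ha)
      refine ⟨_, mul_mem (pow_mem hmr i.val) (pow_mem hzr j.val),
        mul_mem (pow_mem hmM _) (pow_mem hzM _), ?_⟩
      rw [hκ, ZMod.natCast_zmod_val, ZMod.natCast_zmod_val]
      rw [hd] at e0 e1 e2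
      simp [e0, e1, e2]
    · intro r hr hrM r0 r1 _
      obtain ⟨i, j, rfl⟩ := hrr r hr hrM
      obtain ⟨hi, hj⟩ := hind i j r0 r1
      rw [hκ, hi, hj]
      simp
  · right
    -- the choice `d = -l` makes `m * x * m⁻¹ = x ^ 4`
    obtain ⟨m, hmM, hd⟩ := hm (-l) (neg_ne_zero.2 h0)
    have hzM := mul_mem (inv_mem hmM) (R.conj_mem _ hmM)
    have hκz := hz m hmM _ hd
    have hzx : m⁻¹ * (x * m * x⁻¹) = (x ^ 3)⁻¹ := by
      refine R.ext hzM (inv_mem R.cube_mem) ?_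
      rw [hκz, R.map_inv R.cube_mem, hl]
      ext i
      fin_cases i <;> simp
    have hx3c := (hzc _ R.cube_mem l hl m).eq
    have hconj : m * x * m⁻¹ = x ^ 4 := by
      have e1 : x * m = m * (x ^ 3)⁻¹ * x := by rw [← hzx]; group
      have e2 : m * (x ^ 3)⁻¹ = (x ^ 3)⁻¹ * m := by
        rw [eq_inv_mul_iff_mul_eq, ← mul_assoc, hx3c]; group
      rw [e2] at e1
      have e3 : m * x = x ^ 3 * (x * m) := by rw [e1]; group
      rw [e3]; group
    have hx9 : x ^ 9 = 1 := by
      rw [show 9 = 3 * 3 from rfl, pow_mul]; exact R.pow_three R.cube_mem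
    have hx3 : x ^ 3 ≠ 1 := fun h => by
      rw [h, R.map_one] at hl
      exact h0 (congrFun hl 0).symm
    obtain ⟨φ, hφ, hxr, hmr, hrr⟩ := exists_embedding_G27n4 hx9 hx3 (R.pow_three hmM) (fun i hi => by
      have : m * x * m⁻¹ = x := by rw [hi]; group
      rw [hconj, pow_succ] at this
      exact hx3 (mul_eq_right.1 this)) hconj
    have hpow : ∀ i : ℕ, x ^ i ∈ M → ∃ j : ZMod 3, κ (x ^ i) = j • ![l, l, l, 0] := by
      intro i hi
      have : x ^ i = (x ^ 3) ^ (i / 3) * x ^ (i % 3) := by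
        rw [← pow_mul, ← pow_add, Nat.div_add_mod]
      have h3 : x ^ (i % 3) ∈ M := by
        rw [this] at hi
        exact (M.mul_mem_cancel_left (pow_mem R.cube_mem _)).1 hi
      have hlt := Nat.mod_lt i (show 3 > 0 by norm_num)
      have : i % 3 = 0 := by
        by_contra hne
        obtain h | h : i % 3 = 1 ∨ i % 3 = 2 := by omega
        · rw [h, pow_one] at h3
          exact R.not_mem h3
        · rw [h] at h3
          refine R.not_mem ((M.mul_mem_cancel_left h3).1 ?_)
          rw [← pow_succ]
          exact R.cube_mem
      refine ⟨(i / 3 : ℕ), ?_⟩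
      rw [← hl, ← R.map_pow R.cube_mem, ← pow_mul, Nat.mul_div_cancel' (Nat.dvd_of_mod_eq_zero this)]
    refine R.mulEquiv_or φ hφ hxr ?_ ?_
    · intro a ha
      obtain ⟨i, j, e0, e1, e2⟩ := coord_combination _ _ _ _ _ _ (hs m hmM)
        (by rw [hd]; exact neg_ne_zero.2 h0) (hs a ha)
      refine ⟨_, mul_mem (pow_mem hmr i.val) (pow_mem (inv_mem (pow_mem hxr 3)) j.val),
        mul_mem (pow_mem hmM _) (pow_mem (inv_mem R.cube_mem) _), ?_⟩
      rw [R.map_mul _ (pow_mem hmM _) _ (pow_mem (inv_mem R.cube_mem) _), R.map_pow hmM,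
        R.map_pow (inv_mem R.cube_mem), R.map_inv R.cube_mem, hl, ZMod.natCast_zmod_val,
        ZMod.natCast_zmod_val]
      rw [hd] at e0 e1 e2
      simp [e0, e1, e2]
    · intro r hr hrM r0 r1 _
      obtain ⟨i, j, rfl⟩ := hrr r hr
      have hxi := (M.mul_mem_cancel_right (pow_mem hmM _)).1 hrM
      obtain ⟨k, hk⟩ := hpow i hxi
      have hκ : κ (x ^ i * m ^ j) = k • ![l, l, l, 0] + (j : ZMod 3) • κ m := by
        rw [R.map_mul _ hxi _ (pow_mem hmM _), R.map_pow hmM, hk]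
      rw [hκ] at r0 r1 ⊢
      simp only [Pi.add_apply, Pi.smul_apply, smul_eq_mul] at r0 r1 ⊢
      obtain ⟨hj, -⟩ := coord_independent _ _ _ (-l) (j : ZMod 3) (-k) (hs m hmM) hd
        (neg_ne_zero.2 h0) (by simpa [add_comm] using r0) (by simpa [add_comm] using r1)
      simp [hj]

theorem inListG3 {H : Type} [Group H] {M : Subgroup H} {κ : H → Fin 4 → ZMod 3} {x : H}
    (R : IsRotExt M κ x) : InListG3 H := by
  unfold InListG3
  by_cases hs : ∀ m ∈ M, κ m 0 + κ m 1 + κ m 2 = 0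
  · have := R.mulEquiv_G27 hs
    tauto
  · push Not at hs
    obtain ⟨m, hm, h⟩ := hs
    have := R.mulEquiv_G81n7 hm h
    tauto

end IsRotExt

/-! ### Recognition of the remaining groups of the list -/

theorem inListG3_of_exponent_three {H : Type} [Group H] [Nontrivial H] [Finite H]
    (hcomm : ∀ a b : H, a * b = b * a) (h3 : ∀ a : H, a ^ 3 = 1) (hcard : Nat.card H ≤ 3 ^ 4) :
    InListG3 H := by
  let : CommGroup H := { (inferInstance : Group H) with mul_comm := hcomm }
  let : Module (ZMod 3) (Additive H) := AddCommGroup.zmodModule fun a => h3 a.toMul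
  have : Finite (Additive H) := ‹Finite H›
  have : Module.Finite (ZMod 3) (Additive H) := Module.Finite.of_finite
  have hc : Nat.card H = 3 ^ Module.finrank (ZMod 3) (Additive H) := by
    have := Module.natCard_eq_pow_finrank (K := ZMod 3) (V := Additive H)
    rwa [Nat.card_zmod] at this
  have hle : Module.finrank (ZMod 3) (Additive H) ≤ 4 := by
    rw [hc] at hcard
    exact (Nat.pow_le_pow_iff_right (by norm_num)).1 hcard
  have hpos : 0 < Module.finrank (ZMod 3) (Additive H) := by
    by_contra h0
    rw [Nat.eq_zero_of_not_pos h0, pow_zero] at hc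
    exact (Finite.one_lt_card (α := H)).ne' hc
  obtain ⟨d, hd⟩ : ∃ d, d = Module.finrank (ZMod 3) (Additive H) := ⟨_, rfl⟩
  rw [← hd] at hle hpos
  have e2 : Multiplicative (ZMod 3 × ZMod 3) ≃* Cyc 3 × Cyc 3 := MulEquiv.prodMultiplicative _ _
  have e3 : Multiplicative (ZMod 3 × ZMod 3 × ZMod 3) ≃* Cyc 3 × Cyc 3 × Cyc 3 :=
    (MulEquiv.prodMultiplicative _ _).trans ((MulEquiv.refl _).prodCongr e2)
  have e4 : Multiplicative (ZMod 3 × ZMod 3 × ZMod 3 × ZMod 3) ≃* Cyc 3 × Cyc 3 × Cyc 3 × Cyc 3 :=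
    (MulEquiv.prodMultiplicative _ _).trans ((MulEquiv.refl _).prodCongr e3)
  unfold InListG3
  interval_cases d
  · have e : Additive H ≃ₗ[ZMod 3] ZMod 3 := LinearEquiv.ofFinrankEq _ _ (by simp [← hd])
    exact .inl ⟨AddEquiv.toMultiplicativeRight e.toAddEquiv⟩
  · have e : Additive H ≃ₗ[ZMod 3] ZMod 3 × ZMod 3 := LinearEquiv.ofFinrankEq _ _ (by simp [← hd])
    exact .inr (.inr (.inl ⟨(AddEquiv.toMultiplicativeRight e.toAddEquiv).trans e2⟩))
  · have e : Additive H ≃ₗ[ZMod 3] ZMod 3 × ZMod 3 × ZMod 3 :=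
      LinearEquiv.ofFinrankEq _ _ (by simp [← hd])
    exact .inr (.inr (.inr (.inr (.inr (.inr (.inl
      ⟨(AddEquiv.toMultiplicativeRight e.toAddEquiv).trans e3⟩))))))
  · have e : Additive H ≃ₗ[ZMod 3] ZMod 3 × ZMod 3 × ZMod 3 × ZMod 3 :=
      LinearEquiv.ofFinrankEq _ _ (by simp [← hd])
    exact .inr (.inr (.inr (.inr (.inr (.inr (.inr (.inr (.inr (.inr (.inl
      ⟨(AddEquiv.toMultiplicativeRight e.toAddEquiv).trans e4⟩))))))))))

theorem inListG3_of_injective_C9_C3 {H : Type} [Group H] [Nontrivial H] (f : H →* Cyc 9 × Cyc 3)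
    (hf : Function.Injective f) : InListG3 H := by
  have : Finite H := Finite.of_injective f hf
  have hcomm : ∀ a b : H, a * b = b * a := fun a b => hf (by rw [map_mul, map_mul, mul_comm])
  have hT : Nat.card (Cyc 9 × Cyc 3) = 27 := by
    rw [Nat.card_prod]; exact congrArg₂ (· * ·) (Nat.card_zmod 9) (Nat.card_zmod 3)
  have hdvd : Nat.card H ∣ 27 := hT ▸ Subgroup.card_dvd_of_injective f hf
  by_cases h3 : ∀ a : H, a ^ 3 = 1
  · exact inListG3_of_exponent_three hcomm h3 ((Nat.le_of_dvd (by norm_num) hdvd).trans (by norm_num))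
  · push Not at h3
    obtain ⟨g, hg⟩ := h3
    have hg9 : g ^ 9 = 1 := hf (by
      rw [map_pow, map_one]; generalize f g = t; revert t; decide)
    have ho : orderOf g = 9 := orderOf_eq_prime_pow (p := 3) (n := 1) (by simpa using hg) hg9
    have h9 : 9 ∣ Nat.card H := ho ▸ orderOf_dvd_natCard g
    obtain h | h : Nat.card H = 9 ∨ Nat.card H = 27 := by
      have := Nat.le_of_dvd (by norm_num) hdvd
      obtain ⟨k, hk⟩ := h9
      rw [hk] at hdvd this ⊢
      have hk3 : k ≤ 3 := by omega
      interval_cases k <;> revert hdvd <;> decide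
    · have hcyc : IsCyclic H := isCyclic_of_orderOf_eq_card g (ho.trans h.symm)
      exact .inr (.inl ⟨mulEquivOfCyclicCardEq (h.trans (Nat.card_zmod 9).symm)⟩)
    · have hb := (Nat.bijective_iff_injective_and_card f).2 ⟨hf, h.trans hT.symm⟩
      exact .inr (.inr (.inr (.inl ⟨MulEquiv.ofBijective f hb⟩)))

/-- `H` is generated by a subgroup `M` of `C₉ × C₃` of exponent `9` and an element `x` of order `3`
that acts on `M` by `m ↦ m ^ 4`. -/
theorem inListG3_of_conj_eq_pow_four {H : Type} [Group H] (M : Subgroup H)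
    (f : M →* Cyc 9 × Cyc 3) (hf : Function.Injective f) (x : H) (hx3 : x ^ 3 = 1) (hxM : x ∉ M)
    (gen : ∀ h, ∃ k : ℕ, x ^ k * h ∈ M) (hconj : ∀ m ∈ M, x * m * x⁻¹ = m ^ 4)
    (hg : ∃ g ∈ M, g ^ 3 ≠ 1) : InListG3 H := by
  obtain ⟨g, hgM, hg3⟩ := hg
  have hcomm : ∀ a ∈ M, ∀ b ∈ M, Commute a b := fun a ha b hb =>
    congrArg Subtype.val (hf (by rw [map_mul, map_mul, mul_comm]) : (⟨a, ha⟩ * ⟨b, hb⟩ : M) = ⟨b, hb⟩ * ⟨a, ha⟩)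
  have hg9 : g ^ 9 = 1 := congrArg Subtype.val (hf (by
      rw [map_pow, map_one]; generalize f _ = t; revert t; decide) : (⟨g, hgM⟩ : M) ^ 9 = 1)
  obtain ⟨φ, hφ, hgr, hxr, hrr⟩ := exists_embedding_G27n4 hg9 hg3 hx3
    (fun i hi => hxM (hi ▸ pow_mem hgM i)) (hconj g hgM)
  set t := f ⟨g, hgM⟩ with ht
  have ht3 : t.1 ^ 3 ≠ 1 := fun h => hg3 (congrArg Subtype.val (hf (by
    rw [map_pow, map_one, ← ht]
    refine Prod.ext h ?_
    generalize t = u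
    revert u; decide) : (⟨g, hgM⟩ : M) ^ 3 = 1))
  -- modulo powers of `g`, the first coordinate of an element of `M` vanishes
  have key : ∀ m ∈ M, ∃ i : ℕ, ∃ a : M, m = a * g ^ i ∧ (f a).1 = 1 := by
    intro m hm
    have aux : ∀ u v : Cyc 9, u ^ 3 ≠ 1 → ∃ i : Fin 9, v = u ^ i.val := by decide
    obtain ⟨i, hi⟩ := aux t.1 (f ⟨m, hm⟩).1 ht3
    refine ⟨i, ⟨m, hm⟩ * (⟨g, hgM⟩ ^ (i : ℕ))⁻¹, by simp, ?_⟩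
    rw [map_mul, map_inv, map_pow, ← ht, Prod.fst_mul, Prod.fst_inv, Prod.pow_fst, hi, mul_inv_cancel]
  by_cases he : ∃ e : M, f e = (1, Multiplicative.ofAdd 1)
  · obtain ⟨⟨e, heM⟩, he⟩ := he
    have he3 : e ^ 3 = 1 := congrArg Subtype.val (hf (by
      rw [map_pow, map_one, he]; rfl) : (⟨e, heM⟩ : M) ^ 3 = 1)
    have hex : Commute e x := by
      have := hconj e heM
      rw [pow_succ, he3, one_mul] at this
      exact (mul_inv_eq_iff_eq_mul.1 this).symm
    have hc : ∀ y, Commute e y := by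
      intro y
      obtain ⟨k, hk⟩ := gen y
      have h3 := (hex.pow_right k).inv_right.mul_right (hcomm e heM _ hk)
      rwa [inv_mul_cancel_left] at h3
    have hinj := prodHom_injective he3 hφ hc fun h => by
      obtain ⟨i, j, hij⟩ := hrr e h
      have hxj : x ^ j ∈ M := (M.mul_mem_cancel_left (pow_mem hgM i)).1 (hij ▸ heM)
      have hj : x ^ j = 1 := by
        have h0 := eq_zero_of_pow_val_mem hx3 hxM (j : ZMod 3)
          (by rwa [ZMod.val_natCast, ← pow_mod_orderOf, orderOf_eq_prime hx3
            (fun h => hxM (h ▸ M.one_mem)), Nat.mod_mod, ← orderOf_eq_prime hx3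
            (fun h => hxM (h ▸ M.one_mem)), pow_mod_orderOf])
        obtain ⟨q, rfl⟩ := (ZMod.natCast_eq_zero_iff j 3).1 h0
        rw [pow_mul, hx3, one_pow]
      rw [hj, mul_one] at hij
      have hfe : f ⟨e, heM⟩ = t ^ i := by
        rw [ht, ← map_pow]; exact congrArg f (Subtype.ext hij)
      rw [he] at hfe
      have h9 : t ^ i = t ^ (i % 9) := by
        conv_lhs => rw [← Nat.div_add_mod i 9, pow_add, pow_mul]
        have : t ^ 9 = 1 := by generalize t = u; revert u; decide
        rw [this, one_pow, one_mul]
      rw [h9] at hfe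
      have aux : ∀ u : Cyc 9 × Cyc 3, u.1 ^ 3 ≠ 1 → ∀ i : Fin 9,
          (1, Multiplicative.ofAdd 1) ≠ u ^ i.val := by decide
      exact aux t ht3 ⟨i % 9, Nat.mod_lt _ (by norm_num)⟩ hfe
    have hsub : ∀ r ∈ φ.range, r ∈ (prodHom e he3 φ hc).range := by
      rintro r ⟨t, rfl⟩
      exact ⟨(1, t), by simp [prodHom_apply]⟩
    have hiso : Nonempty (H ≃* Cyc 3 × G27n4) := by
      refine ⟨(MulEquiv.ofBijective _ ⟨hinj,
        surjective_of_le_range _ M x gen ?_ (hsub _ hxr)⟩).symm⟩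
      intro m hm
      obtain ⟨i, a, rfl, ha⟩ := key m hm
      refine mul_mem ⟨((f a).2, 1), ?_⟩ (hsub _ (pow_mem hgr i))
      rw [prodHom_apply, map_one, mul_one]
      refine congrArg Subtype.val (hf ?_ : (⟨e, heM⟩ : M) ^ _ = a)
      rw [map_pow, he]
      refine Prod.ext (by simp [ha]) ?_
      generalize f a = u
      revert u; decide
    unfold InListG3
    tauto
  · have hiso : Nonempty (H ≃* G27n4) := by
      refine ⟨(MulEquiv.ofBijective φ ⟨hφ, surjective_of_le_range _ M x gen ?_ hxr⟩).symm⟩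
      intro m hm
      obtain ⟨i, a, rfl, ha⟩ := key m hm
      refine mul_mem ?_ (pow_mem hgr i)
      have h2 : (f a).2 = 1 := by
        by_contra h2
        refine he ⟨a ^ (f a).2.toAdd.val, ?_⟩
        rw [map_pow]
        refine Prod.ext (by simp [ha]) ?_
        simp only [Prod.pow_snd]
        revert h2
        generalize (f a).2 = u
        revert u; decide
      rw [hf ((Prod.ext ha h2).trans (map_one f).symm : f a = f 1)]
      exact one_mem _
    unfold InListG3
    tauto

theorem InListG3.congr {G H : Type} [Group G] [Group H] (e : G ≃* H) (h : InListG3 H) :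
    InListG3 G := by
  have key : ∀ (T : Type) [Group T], Nonempty (H ≃* T) → Nonempty (G ≃* T) :=
    fun T _ ⟨f⟩ => ⟨e.trans f⟩
  unfold InListG3 at h ⊢
  rcases h with h | h | h | h | h | h | h | h | h | h | h | h
  all_goals have := key _ h; tauto

theorem InListG3.card_le {G : Type} [Group G] (h : InListG3 G) : Finite G ∧ Nat.card G ≤ 3 ^ 5 := by
  have key : ∀ (T : Type) [Group T], Nat.card T ≠ 0 → Nat.card T ≤ 3 ^ 5 → Nonempty (G ≃* T) →
      Finite G ∧ Nat.card G ≤ 3 ^ 5 := fun T _ h0 hT ⟨f⟩ => by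
    rw [Nat.card_congr f.toEquiv]
    have := Nat.finite_of_card_ne_zero h0
    exact ⟨Finite.of_equiv T f.symm.toEquiv, hT⟩
  have h3 : Nat.card (Cyc 3) = 3 := Nat.card_zmod 3
  have h9 : Nat.card (Cyc 9) = 9 := Nat.card_zmod 9
  unfold InListG3 at h
  rcases h with h | h | h | h | h | h | h | h | h | h | h | h <;> refine key _ ?_ ?_ h <;>
    simp only [Nat.card_prod, SemidirectProduct.card, h3, h9] <;> norm_num

/-! ### Joint eigenvectors of commuting operators of finite order -/


theorem isSemisimple_of_pow_eq_one {V : Type*} [AddCommGroup V] [Module ℂ V] {f : End ℂ V} {n : ℕ}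
    (hn : n ≠ 0) (hf : f ^ n = 1) : f.IsSemisimple := by
  refine End.isSemisimple_of_squarefree_aeval_eq_zero (p := Polynomial.X ^ n - Polynomial.C 1) ?_ ?_
  · exact (Polynomial.separable_X_pow_sub_C (1 : ℂ) (Nat.cast_ne_zero.2 hn) one_ne_zero).squarefree
  · simp [hf]

theorem exists_basis_joint_eigenvectors {V : Type*} [AddCommGroup V] [Module ℂ V]
    [FiniteDimensional ℂ V] {d : ℕ} (hd : finrank ℂ V = d) {ι : Type*} (f : ι → End ℂ V)
    (hc : ∀ i j, Commute (f i) (f j)) (hf : ∀ i, ∃ n : ℕ, n ≠ 0 ∧ f i ^ n = 1) :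
    ∃ (b : Basis (Fin d) ℂ V) (w : Fin d → ι → ℂ), ∀ k i, f i (b k) = w k i • b k := by
  have hss : ∀ i, (f i).IsFinitelySemisimple := fun i => by
    obtain ⟨n, hn, h⟩ := hf i
    exact (isSemisimple_of_pow_eq_one hn h).isFinitelySemisimple
  have htop := End.iSup_iInf_maxGenEigenspace_eq_top_of_iSup_maxGenEigenspace_eq_top_of_commute f
    (fun i j _ => hc i j) (fun i => End.iSup_maxGenEigenspace_eq_top (f i))
  let s : Set V := {v | ∃ χ : ι → ℂ, ∀ i, f i v = χ i • v}
  have hs : ⊤ ≤ Submodule.span ℂ s := by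
    rw [← htop]
    refine iSup_le fun χ v hv => Submodule.subset_span ⟨χ, fun i => ?_⟩
    have := (Submodule.mem_iInf _).1 hv i
    rwa [(hss i).maxGenEigenspace_eq_eigenspace, End.mem_eigenspace_iff] at this
  let b := Basis.ofSpan hs
  have hb : ∀ k, b k ∈ s := fun k => Basis.ofSpan_subset hs ⟨k, rfl⟩
  have := FiniteDimensional.fintypeBasisIndex b
  let e := Fintype.equivFinOfCardEq ((finrank_eq_card_basis b).symm.trans hd)
  choose w hw using hb
  exact ⟨b.reindex e, fun k => w (e.symm k), fun k i => by rw [Basis.reindex_apply]; exact hw _ i⟩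

/-- The joint eigenspace of a family of operators for a family of eigenvalues. -/
def jointEigenspace {V : Type*} [AddCommGroup V] [Module ℂ V] {ι : Type*} (f : ι → End ℂ V)
    (χ : ι → ℂ) : Submodule ℂ V :=
  ⨅ i, (f i).eigenspace (χ i)

theorem mem_jointEigenspace {V : Type*} [AddCommGroup V] [Module ℂ V] {ι : Type*}
    {f : ι → End ℂ V} {χ : ι → ℂ} {v : V} : v ∈ jointEigenspace f χ ↔ ∀ i, f i v = χ i • v := by
  simp [jointEigenspace, Submodule.mem_iInf]

section

variable {V : Type*} [AddCommGroup V] [Module ℂ V] {ι κ : Type*} [Fintype κ] {f : ι → End ℂ V}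
  {b : Basis κ ℂ V} {w : κ → ι → ℂ}

theorem jointEigenspace_eq_span (hb : ∀ k i, f i (b k) = w k i • b k) (χ : ι → ℂ) :
    jointEigenspace f χ = Submodule.span ℂ (b '' {k | w k = χ}) := by
  apply le_antisymm
  · intro v hv
    rw [mem_jointEigenspace] at hv
    rw [Basis.mem_span_image]
    intro k hk
    funext i
    have h1 : b.repr (f i v) k = w k i * b.repr v k := by
      conv_lhs => rw [← b.sum_repr v]
      simp only [map_sum, map_smul, hb, Finsupp.coe_finsetSum, Finset.sum_apply, Finsupp.smul_apply,
        Basis.repr_self, smul_eq_mul]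
      rw [Finset.sum_eq_single k]
      · simp [mul_comm]
      · intro j _ hj
        simp [hj]
      · simp
    rw [hv i, map_smul, Finsupp.smul_apply, smul_eq_mul] at h1
    exact (mul_right_cancel₀ (Finsupp.mem_support_iff.1 hk) h1).symm
  · rw [Submodule.span_le]
    rintro _ ⟨k, rfl, rfl⟩
    exact mem_jointEigenspace.2 (hb k)

theorem finrank_jointEigenspace [DecidableEq (ι → ℂ)] (hb : ∀ k i, f i (b k) = w k i • b k)
    (χ : ι → ℂ) : finrank ℂ (jointEigenspace f χ) = (Finset.univ.filter fun k => w k = χ).card := by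
  rw [jointEigenspace_eq_span hb, Set.image_eq_range]
  have hli : LinearIndependent ℂ fun k : {k | w k = χ} => b k :=
    b.linearIndependent.comp _ Subtype.val_injective
  rw [finrank_span_eq_card hli, ← Set.toFinset_card]
  congr 1
  ext
  simp

end

/-! ### Eigenvalues of symmetries of a nondegenerate cubic form -/

/-- `ρ` is a faithful representation on a five-dimensional space that preserves the trilinear
form `T`; the cubic form `v ↦ T v v v` has no critical point besides the origin. -/
structure IsCubicRep {P V : Type*} [Group P] [AddCommGroup V] [Module ℂ V] (ρ : P →* End ℂ V)
    (T : V →ₗ[ℂ] V →ₗ[ℂ] V →ₗ[ℂ] ℂ) : Prop where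
  finrank_eq : finrank ℂ V = 5
  nondeg : ∀ v ≠ 0, ∃ u, T v v u ≠ 0
  inv : ∀ p a b c, T (ρ p a) (ρ p b) (ρ p c) = T a b c
  injective : Function.Injective ρ

/-- Six distinct elements of a type with five elements cannot exist. -/
theorem not_six_distinct {s : List (Fin 5)} (hs : s.Nodup) (hl : s.length = 6) : False := by
  have := hs.length_le_card
  simp [hl] at this

theorem exists_binary_quadratic_zero (α β γ : ℂ) :
    ∃ x y : ℂ, (x ≠ 0 ∨ y ≠ 0) ∧ x ^ 2 * α + x * y * β + y ^ 2 * γ = 0 := by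
  by_cases hα : α = 0
  · exact ⟨1, 0, .inl one_ne_zero, by simp [hα]⟩
  · obtain ⟨s, hs⟩ := IsAlgClosed.exists_eq_mul_self (discrim α β γ)
    obtain ⟨x, hx⟩ := exists_quadratic_eq_zero hα ⟨s, hs⟩
    exact ⟨x, 1, .inr one_ne_zero, by linear_combination hx⟩

theorem exists_perm_extending {i j k : Fin 5} (hij : i ≠ j) (hik : i ≠ k) (hjk : j ≠ k) :
    ∃ σ : Equiv.Perm (Fin 5), σ 0 = i ∧ σ 1 = j ∧ σ 2 = k := by
  obtain ⟨g, hg⟩ := Finset.exists_equiv_extend_of_card_eq (α := Fin 5) (β := Fin 5)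
    (t := Finset.univ) (by simp) (s := {0, 1, 2}) (f := ![i, j, k, i, i]) (Finset.subset_univ _)
    (by intro x hx y hy hxy; revert hx hy hxy; fin_cases x <;> fin_cases y <;> simp [*, Ne.symm, eq_comm])
  exact ⟨g.trans (Equiv.subtypeUnivEquiv fun x => Finset.mem_univ x), hg 0 (by simp), hg 1 (by simp),
    hg 2 (by simp)⟩

namespace IsCubicRep

variable {P V : Type*} [Group P] [AddCommGroup V] [Module ℂ V] {ρ : P →* End ℂ V}
  {T : V →ₗ[ℂ] V →ₗ[ℂ] V →ₗ[ℂ] ℂ}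

theorem exists_basis_ne_zero (R : IsCubicRep ρ T) (b : Basis (Fin 5) ℂ V) {v : V} (hv : v ≠ 0) :
    ∃ j, T v v (b j) ≠ 0 := by
  by_contra! h
  obtain ⟨u, hu⟩ := R.nondeg v hv
  exact hu (LinearMap.congr_fun (b.ext h : T v v = 0) u)

theorem weight_eq (R : IsCubicRep ρ T) {p : P} {u v : V} {y z : ℂ} (hv : ρ p v = z • v)
    (hu : ρ p u = y • u) (h : T v v u ≠ 0) : z ^ 2 * y = 1 := by
  have := R.inv p v v u
  rw [hv, hu] at this
  simp only [map_smul, LinearMap.smul_apply, smul_eq_mul] at this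
  exact mul_right_cancel₀ h (by linear_combination this)

variable {b : Basis (Fin 5) ℂ V} {p : P} {d : Fin 5 → ℂ}

theorem exists_eigenvalue_inv_sq (R : IsCubicRep ρ T) (hb : ∀ k, ρ p (b k) = d k • b k)
    (k : Fin 5) : ∃ j, d k ^ 2 * d j = 1 := by
  obtain ⟨j, hj⟩ := R.exists_basis_ne_zero b (b.ne_zero k)
  exact ⟨j, R.weight_eq (hb k) (hb j) hj⟩

theorem eigenvalue_ne_zero (R : IsCubicRep ρ T) (hb : ∀ k, ρ p (b k) = d k • b k) (k : Fin 5) :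
    d k ≠ 0 := by
  obtain ⟨j, hj⟩ := R.exists_eigenvalue_inv_sq hb k
  rintro h
  simp [h] at hj

/-- A double eigenvalue `z` with `z ^ 3 ≠ 1` forces `z⁻²` to be a double eigenvalue: otherwise
the gradient of the cubic form on the eigenspace of `z` has a single component, a quadratic form
in two variables, which has a zero. -/
theorem exists_double_eigenvalue (R : IsCubicRep ρ T) (hb : ∀ k, ρ p (b k) = d k • b k)
    {i j : Fin 5} (hij : i ≠ j) (hd : d i = d j) :
    ∃ k l, k ≠ l ∧ d i ^ 2 * d k = 1 ∧ d i ^ 2 * d l = 1 := by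
  obtain ⟨k, hk⟩ := R.exists_eigenvalue_inv_sq hb i
  by_contra! hcon
  obtain ⟨x, y, hxy, h0⟩ := exists_binary_quadratic_zero (T (b i) (b i) (b k))
    (T (b i) (b j) (b k) + T (b j) (b i) (b k)) (T (b j) (b j) (b k))
  set v := x • b i + y • b j with hv
  have hv0 : v ≠ 0 := by
    intro h
    have h1 := congrArg (fun u => b.repr u i) h
    have h2 := congrArg (fun u => b.repr u j) h
    simp [hv, hij.symm] at h1
    simp [hv, hij] at h2
    rcases hxy with h | h <;> contradiction
  have hpv : ρ p v = d i • v := by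
    rw [hv, map_add, map_smul, map_smul, hb, hb, ← hd, smul_add, smul_comm x, smul_comm y]
  obtain ⟨l, hl⟩ := R.exists_basis_ne_zero b hv0
  have hlw := R.weight_eq hpv (hb l) hl
  have hkl : k = l := by
    by_contra hne
    exact hcon k l hne hk hlw
  subst hkl
  refine hl ?_
  simp only [hv, map_add, map_smul, LinearMap.add_apply, LinearMap.smul_apply, smul_eq_mul]
  linear_combination h0

/-- The set of eigenvalues is stable under `z ↦ z⁻²` and has at most five elements; a root of
unity of order `3 ^ m` with `m ≥ 3` would have an orbit of length at least `9`. -/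
theorem eigenvalue_pow_nine (R : IsCubicRep ρ T) (hP : IsPGroup 3 P)
    (hb : ∀ k, ρ p (b k) = d k • b k) (k : Fin 5) : d k ^ 9 = 1 := by
  have hpow : ∀ n : ℕ, ∀ k, (ρ p ^ n) (b k) = d k ^ n • b k := by
    intro n
    induction n with
    | zero => simp
    | succ n ih => intro k; rw [pow_succ, End.mul_apply, hb, map_smul, ih, smul_smul, pow_succ']
  obtain ⟨m, hm⟩ := hP p
  have h3m : d k ^ 3 ^ m = 1 := by
    have h1 := hpow (3 ^ m) k
    rw [← map_pow, hm, map_one, End.one_apply] at h1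
    have : (d k ^ 3 ^ m - 1) • b k = 0 := by rw [sub_smul, one_smul, ← h1, sub_self]
    exact sub_eq_zero.1 ((smul_eq_zero.1 this).resolve_right (b.ne_zero k))
  choose next hnext using R.exists_eigenvalue_inv_sq hb
  have hd0 := R.eigenvalue_ne_zero hb
  have hit : ∀ n : ℕ, d (next^[n] k) = d k ^ ((-2 : ℤ) ^ n) := by
    intro n
    induction n with
    | zero => simp
    | succ n ih =>
      rw [Function.iterate_succ_apply', eq_inv_of_mul_eq_one_right (hnext _), ih, pow_succ (-2 : ℤ),
        zpow_mul]
      simp [zpow_neg]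
  obtain ⟨s, t, hst, he⟩ := Fintype.exists_ne_map_eq_of_card_lt
    (fun n : Fin 6 => next^[n.val] k) (by simp)
  have he' := congrArg d he
  simp only [hit] at he'
  obtain ⟨j, -, hj⟩ := (Nat.dvd_prime_pow Nat.prime_three).1 (orderOf_dvd_of_pow_eq_one h3m)
  have hdvd : (3 : ℤ) ^ j ∣ (-2) ^ s.val - (-2) ^ t.val := by
    have : d k ^ ((-2 : ℤ) ^ s.val - (-2) ^ t.val) = 1 := by
      rw [zpow_sub₀ (hd0 k), he', div_self (zpow_ne_zero _ (hd0 k))]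
    have h2 := orderOf_dvd_iff_zpow_eq_one.2 (show (Units.mk0 _ (hd0 k)) ^ ((-2 : ℤ) ^ s.val - (-2) ^ t.val)
      = 1 from Units.ext (by simpa using this))
    rw [← orderOf_units, Units.val_mk0, hj] at h2
    exact_mod_cast h2
  have hj2 : j ≤ 2 := by
    by_contra hj3
    have h27 : (27 : ℤ) ∣ (-2) ^ s.val - (-2) ^ t.val :=
      (pow_dvd_pow (3 : ℤ) (show 3 ≤ j by omega)).trans hdvd
    have aux : ∀ s t : Fin 6, s ≠ t → ¬ (27 : ℤ) ∣ (-2) ^ s.val - (-2) ^ t.val := by decide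
    exact aux s t hst h27
  exact orderOf_dvd_iff_pow_eq_one.1 (hj ▸ (pow_dvd_pow 3 hj2))

/-- An eigenvalue `z` of order `9` comes with `z⁻² = z ^ 7` and `z⁻⁸ = z ^ 4`. All three are simple,
since doubling one would double all, and the two remaining eigenvalues are cube roots of unity,
since another eigenvalue of order `9` would come with three eigenvalues of its own. -/
theorem eigenvalue_dichotomy (R : IsCubicRep ρ T) (hP : IsPGroup 3 P)
    (hb : ∀ k, ρ p (b k) = d k • b k) : (∀ k, d k ^ 3 = 1) ∨ ∃ σ : Equiv.Perm (Fin 5),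
      d (σ 0) ^ 3 ≠ 1 ∧ d (σ 1) = d (σ 0) ^ 7 ∧ d (σ 2) = d (σ 0) ^ 4 ∧
      d (σ 3) ^ 3 = 1 ∧ d (σ 4) ^ 3 = 1 := by
  by_cases h3 : ∀ k, d k ^ 3 = 1
  · exact .inl h3
  right
  push Not at h3
  have h9 := R.eigenvalue_pow_nine hP hb
  have hpow : ∀ z y : ℂ, z ^ 9 = 1 → z ^ 2 * y = 1 → y = z ^ 7 := fun z y hz hy => by
    linear_combination z ^ 7 * hy - y * hz
  have hz0 : ∀ z : ℂ, z ^ 9 = 1 → z ≠ 0 := by rintro z hz rfl; norm_num at hz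
  have hne : ∀ z : ℂ, z ^ 9 = 1 → z ^ 3 ≠ 1 → z ≠ z ^ 7 ∧ z ≠ z ^ 4 ∧ z ^ 7 ≠ z ^ 4 := by
    intro z hz hz3
    have h0 := hz0 z hz
    refine ⟨fun h => hz3 ?_, fun h => hz3 ?_, fun h => hz3 ?_⟩
    · have h6 : z ^ 6 = 1 := mul_left_cancel₀ h0 (by linear_combination -h)
      linear_combination hz - z ^ 3 * h6
    · exact mul_left_cancel₀ h0 (by linear_combination -h)
    · exact mul_left_cancel₀ (pow_ne_zero 4 h0) (by linear_combination h)
  have horb : ∀ k, ∃ k1 k2, d k1 = d k ^ 7 ∧ d k2 = d k ^ 4 := by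
    intro k
    obtain ⟨k1, e1⟩ := R.exists_eigenvalue_inv_sq hb k
    have e1 := hpow _ _ (h9 k) e1
    obtain ⟨k2, e2⟩ := R.exists_eigenvalue_inv_sq hb k1
    have e2 := hpow _ _ (h9 k1) e2
    refine ⟨k1, k2, e1, ?_⟩
    rw [e2, e1]
    linear_combination (d k ^ 4 * (1 + d k ^ 9 + d k ^ 18 + d k ^ 27 + d k ^ 36)) * h9 k
  have hdouble : ∀ i j, i ≠ j → d i = d j → ∃ k l, k ≠ l ∧ d k = d i ^ 7 ∧ d l = d i ^ 7 := by
    intro i j hij hd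
    obtain ⟨k, l, hkl, e1, e2⟩ := R.exists_double_eigenvalue hb hij hd
    exact ⟨k, l, hkl, hpow _ _ (h9 i) e1, hpow _ _ (h9 i) e2⟩
  have hsimple : ∀ i j, i ≠ j → d i = d j → d i ^ 3 = 1 := by
    intro i j hij hd
    by_contra hi3
    obtain ⟨k, l, hkl, ek, el⟩ := hdouble i j hij hd
    obtain ⟨m, n, hmn, em, en⟩ := hdouble k l hkl (ek.trans el.symm)
    have h74 : d k ^ 7 = d i ^ 4 := by
      rw [ek]
      linear_combination (d i ^ 4 * (1 + d i ^ 9 + d i ^ 18 + d i ^ 27 + d i ^ 36)) * h9 i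
    rw [h74] at em en
    obtain ⟨n1, n2, n3⟩ := hne _ (h9 i) hi3
    refine not_six_distinct (s := [i, j, k, l, m, n]) ?_ rfl
    have := fun x y (h : d x ≠ d y) (hxy : x = y) => h (congrArg d hxy)
    simp only [List.nodup_cons, List.mem_cons, List.not_mem_nil, or_false, not_or, not_false_eq_true,
      List.nodup_nil, and_true]
    refine ⟨⟨hij, ?_, ?_, ?_, ?_⟩, ⟨?_, ?_, ?_, ?_⟩, ⟨hkl, ?_, ?_⟩, ⟨?_, ?_⟩, hmn⟩ <;> apply this <;>
      simp only [ek, el, em, en, ← hd] <;> assumption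
  obtain ⟨i, hi⟩ := h3
  obtain ⟨j, k, ej, ek⟩ := horb i
  obtain ⟨n1, n2, n3⟩ := hne _ (h9 i) hi
  have hinj := fun x y (h : d x ≠ d y) (hxy : x = y) => h (congrArg d hxy)
  obtain ⟨σ, rfl, rfl, rfl⟩ := exists_perm_extending (i := i) (j := j) (k := k)
    (hinj _ _ (by rwa [ej])) (hinj _ _ (by rwa [ek])) (hinj _ _ (by rwa [ej, ek]))
  have hrest : ∀ l, σ 0 ≠ l → σ 1 ≠ l → σ 2 ≠ l → d l ^ 3 = 1 := by
    intro l l0 l1 l2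
    by_contra hl3
    obtain ⟨j', k', ej', ek'⟩ := horb l
    obtain ⟨m1, m2, m3⟩ := hne _ (h9 l) hl3
    have hcube : ∀ x y, d x ^ 3 = d (σ 0) ^ 3 → d y ^ 3 = d l ^ 3 → x ≠ y := by
      rintro x y hx hy rfl
      rw [hx] at hy
      -- equal cubes place `d l` in `{z, z ^ 7, z ^ 4}`
      have : (d l - d (σ 0)) * (d l - d (σ 1)) * (d l - d (σ 2)) = 0 := by
        set z := d (σ 0)
        set y := d l
        have hz9 : z ^ 9 = 1 := h9 _
        have hu : z ^ 6 + z ^ 3 + 1 = 0 := by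
          have : (z ^ 3 - 1) * (z ^ 6 + z ^ 3 + 1) = 0 := by linear_combination hz9
          exact (mul_eq_zero.1 this).resolve_left (sub_ne_zero.2 hi)
        rw [ej, ek]
        linear_combination -hy + (-(z * y ^ 2) + z ^ 5 * y) * hu - z ^ 3 * hz9
      rcases mul_eq_zero.1 this with h | h
      · rcases mul_eq_zero.1 h with h | h
        · exact hi (hsimple _ _ l0 (sub_eq_zero.1 h).symm)
        · exact hl3 ((sub_eq_zero.1 h) ▸ hsimple _ _ l1 (sub_eq_zero.1 h).symm)
      · exact hl3 ((sub_eq_zero.1 h) ▸ hsimple _ _ l2 (sub_eq_zero.1 h).symm)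
    have c7 : ∀ z : ℂ, z ^ 9 = 1 → (z ^ 7) ^ 3 = z ^ 3 := fun z hz => by
      linear_combination (z ^ 3 * (1 + z ^ 9)) * hz
    have c4 : ∀ z : ℂ, z ^ 9 = 1 → (z ^ 4) ^ 3 = z ^ 3 := fun z hz => by
      linear_combination z ^ 3 * hz
    have e0 : d (σ 1) ^ 3 = d (σ 0) ^ 3 := by rw [ej, c7 _ (h9 _)]
    have e1 : d (σ 2) ^ 3 = d (σ 0) ^ 3 := by rw [ek, c4 _ (h9 _)]
    have e2 : d j' ^ 3 = d l ^ 3 := by rw [ej', c7 _ (h9 _)]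
    have e3 : d k' ^ 3 = d l ^ 3 := by rw [ek', c4 _ (h9 _)]
    refine not_six_distinct (s := [σ 0, σ 1, σ 2, l, j', k']) ?_ rfl
    simp only [List.nodup_cons, List.mem_cons, List.not_mem_nil, or_false, not_or, not_false_eq_true,
      List.nodup_nil, and_true]
    exact ⟨⟨hinj _ _ (by rwa [ej]), hinj _ _ (by rwa [ek]), l0, hcube _ _ rfl e2, hcube _ _ rfl e3⟩,
      ⟨hinj _ _ (by rwa [ej, ek]), l1, hcube _ _ e0 e2, hcube _ _ e0 e3⟩,
      ⟨l2, hcube _ _ e1 e2, hcube _ _ e1 e3⟩, ⟨hinj _ _ (by rwa [ej']), hinj _ _ (by rwa [ek'])⟩,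
      hinj _ _ (by rwa [ej', ek'])⟩
  have hσ := fun x y (h : x ≠ y) => σ.injective.ne h
  exact ⟨σ, hi, ej, ek, hrest _ (hσ _ _ (by decide)) (hσ _ _ (by decide)) (hσ _ _ (by decide)),
    hrest _ (hσ _ _ (by decide)) (hσ _ _ (by decide)) (hσ _ _ (by decide))⟩

end IsCubicRep

namespace IsCubicRep

variable {P V : Type*} [Group P] [AddCommGroup V] [Module ℂ V] {ρ : P →* End ℂ V}
  {T : V →ₗ[ℂ] V →ₗ[ℂ] V →ₗ[ℂ] ℂ}

theorem finiteDimensional (R : IsCubicRep ρ T) : FiniteDimensional ℂ V :=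
  FiniteDimensional.of_finrank_pos (by rw [R.finrank_eq]; norm_num)

theorem exists_eigenbasis (R : IsCubicRep ρ T) (hP : IsPGroup 3 P) (p : P) :
    ∃ (b : Basis (Fin 5) ℂ V) (d : Fin 5 → ℂ), ∀ k, ρ p (b k) = d k • b k := by
  have := R.finiteDimensional
  obtain ⟨b, w, hb⟩ := exists_basis_joint_eigenvectors R.finrank_eq (fun _ : Unit => ρ p)
    (fun _ _ => Commute.refl _) (fun _ => by
      obtain ⟨n, hn⟩ := hP p
      exact ⟨3 ^ n, by positivity, by rw [← map_pow, hn, map_one]⟩)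
  exact ⟨b, fun k => w k (), fun k => hb k ()⟩

theorem eq_one_of_basis (R : IsCubicRep ρ T) {p : P} (b : Basis (Fin 5) ℂ V)
    (h : ∀ k, ρ p (b k) = b k) : p = 1 :=
  R.injective (by rw [map_one]; exact b.ext h)

theorem pow_apply {p : P} {v : V} {z : ℂ} (h : ρ p v = z • v) (n : ℕ) :
    ρ (p ^ n) v = z ^ n • v := by
  induction n with
  | zero => simp
  | succ n ih => rw [pow_succ, map_mul, End.mul_apply, h, map_smul, ih, smul_smul, pow_succ']

theorem pow_nine (R : IsCubicRep ρ T) (hP : IsPGroup 3 P) (p : P) : p ^ 9 = 1 := by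
  obtain ⟨b, d, hb⟩ := R.exists_eigenbasis hP p
  exact R.eq_one_of_basis b fun k => by
    rw [pow_apply (hb k), R.eigenvalue_pow_nine hP hb, one_smul]

/-- The cube of a symmetry fixes everything or fixes exactly a plane. -/
theorem finrank_fixed_cube (R : IsCubicRep ρ T) (hP : IsPGroup 3 P) (p : P) :
    p ^ 3 = 1 ∨ finrank ℂ (jointEigenspace (fun _ : Unit => ρ (p ^ 3)) fun _ => 1) = 2 := by
  classical
  obtain ⟨b, d, hb⟩ := R.exists_eigenbasis hP p
  rcases R.eigenvalue_dichotomy hP hb with h | ⟨σ, h0, h1, h2, h3, h4⟩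
  · exact .inl (R.eq_one_of_basis b fun k => by rw [pow_apply (hb k), h, one_smul])
  · right
    rw [finrank_jointEigenspace (w := fun k _ => d k ^ 3) (fun k _ => pow_apply (hb k) 3),
      ← Finset.card_map σ.symm.toEmbedding]
    have h9 := R.eigenvalue_pow_nine hP hb (σ 0)
    have h1' : d (σ 1) ^ 3 ≠ 1 := by
      rw [h1]; intro h; apply h0; linear_combination h - (d (σ 0) ^ 3 * (1 + d (σ 0) ^ 9)) * h9
    have h2' : d (σ 2) ^ 3 ≠ 1 := by
      rw [h2]; intro h; apply h0; linear_combination h - (d (σ 0) ^ 3) * h9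
    rw [show Finset.map _ _ = ({3, 4} : Finset (Fin 5)) from ?_]
    · rfl
    ext k
    simp only [Finset.mem_map_equiv, Equiv.symm_symm, Finset.mem_filter, Finset.mem_univ, true_and,
      funext_iff, forall_const]
    fin_cases k <;> simp_all

theorem trace_eq_sum (b : Basis (Fin 5) ℂ V) {f : End ℂ V} {d : Fin 5 → ℂ}
    (hb : ∀ k, f (b k) = d k • b k) : LinearMap.trace ℂ V f = ∑ k, d k := by
  rw [LinearMap.trace_eq_matrix_trace ℂ b, Matrix.trace]
  refine Finset.sum_congr rfl fun k _ => ?_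
  rw [Matrix.diag_apply, LinearMap.toMatrix_apply, hb]
  simp

theorem eq_one_of_norm_one_of_sum {d : Fin 5 → ℂ} (hd : ∀ k, ‖d k‖ = 1) (hs : ∑ k, d k = 5) (k : Fin 5) :
    d k = 1 := by
  have hre : ∀ k, (d k).re ≤ 1 := fun k => (Complex.re_le_norm _).trans (hd k).le
  have hsum : ∑ k, (1 - (d k).re) = 0 := by
    have := congrArg Complex.re hs
    rw [Complex.re_sum] at this
    rw [Finset.sum_sub_distrib, this]
    norm_num
  have h1 := (Finset.sum_eq_zero_iff_of_nonneg fun k _ => sub_nonneg.2 (hre k)).1 hsum k (Finset.mem_univ k)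
  have hre1 : (d k).re = 1 := by linarith
  have h2 := Complex.sq_norm (d k)
  rw [hd, Complex.normSq_apply, hre1] at h2
  exact Complex.ext hre1 (by simpa using (show (d k).im * (d k).im = 0 by linarith))

/-- Burnside's argument: the exponent of `P` divides `9`, so the traces of `P` take finitely many
values, and an element is determined by the traces of its products with a spanning set. -/
theorem finite (R : IsCubicRep ρ T) (hP : IsPGroup 3 P) : Finite P := by
  have := R.finiteDimensional
  let S : Set ℂ := Set.range fun d : Fin 5 → rootsOfUnity 9 ℂ => ∑ k, ((d k : ℂˣ) : ℂ)
  have hS : S.Finite := Set.finite_range _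
  have htr : ∀ p, LinearMap.trace ℂ V (ρ p) ∈ S ∧ (LinearMap.trace ℂ V (ρ p) = 5 → p = 1) := by
    intro p
    obtain ⟨b, d, hb⟩ := R.exists_eigenbasis hP p
    have h9 := R.eigenvalue_pow_nine hP hb
    rw [trace_eq_sum b hb]
    refine ⟨⟨fun k => rootsOfUnity.mkOfPowEq (d k) (h9 k), by simp⟩, fun h => ?_⟩
    refine R.eq_one_of_basis b fun k => ?_
    rw [hb, eq_one_of_norm_one_of_sum (fun k => Complex.norm_eq_one_of_pow_eq_one (h9 k) (by norm_num)) h,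
      one_smul]
  obtain ⟨s, hsub, hspan, hli⟩ := exists_linearIndependent ℂ (Set.range ρ)
  have : Finite s := hli.finite
  have : Finite S := hS
  refine Finite.of_injective (β := s → S) (fun g β => ⟨LinearMap.trace ℂ V (ρ g * β), ?_⟩) ?_
  · obtain ⟨q, hq⟩ := hsub β.2
    rw [← hq, ← map_mul]
    exact (htr _).1
  · intro g h hgh
    have hall : ∀ x ∈ Submodule.span ℂ s, LinearMap.trace ℂ V (ρ g * x) = LinearMap.trace ℂ V (ρ h * x) := by
      intro x hx
      induction hx using Submodule.span_induction with
      | mem x hx => exact congrArg Subtype.val (congrFun hgh ⟨x, hx⟩)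
      | zero => simp
      | add x y _ _ hx hy => rw [mul_add, mul_add, map_add, map_add, hx, hy]
      | smul c x _ hx => rw [mul_smul_comm, mul_smul_comm, map_smul, map_smul, hx]
    have h1 := hall (ρ h⁻¹) (hspan ▸ Submodule.subset_span ⟨_, rfl⟩)
    rw [← map_mul, ← map_mul, mul_inv_cancel, map_one, LinearMap.trace_one, R.finrank_eq] at h1
    exact mul_inv_eq_one.1 ((htr _).2 (by simpa using h1))

end IsCubicRep

/-! ### Self-centralizing abelian normal subgroups -/

/-- A nilpotent finite group has an abelian normal subgroup that is its own centralizer: take a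
maximal abelian normal subgroup `A`; an element of the centralizer outside `A` that lies as low as
possible in the upper central series could be added to it. -/
theorem exists_normal_self_centralizing (P : Type*) [Group P] [Finite P] [Group.IsNilpotent P] :
    ∃ A : Subgroup P, A.Normal ∧ (∀ a ∈ A, ∀ b ∈ A, a * b = b * a) ∧
      ∀ g, (∀ a ∈ A, g * a = a * g) → g ∈ A := by
  obtain ⟨A, hA⟩ := (Set.toFinite {A : Subgroup P | A.Normal ∧ ∀ a ∈ A, ∀ b ∈ A, a * b = b * a}).exists_maximal
    ⟨⊥, inferInstance, by simp⟩
  obtain ⟨hN, hc⟩ := hA.prop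
  refine ⟨A, hN, hc, ?_⟩
  by_contra! hcon
  have hex : ∃ n, ∃ g ∈ Subgroup.upperCentralSeries P n, (∀ a ∈ A, g * a = a * g) ∧ g ∉ A := by
    obtain ⟨g, hg, hgA⟩ := hcon
    obtain ⟨n, hn⟩ := Group.IsNilpotent.nilpotent P
    exact ⟨n, g, hn ▸ Subgroup.mem_top g, hg, hgA⟩
  classical
  obtain ⟨c, hcn, hcc, hcA⟩ := Nat.find_spec hex
  have hmin := fun m => Nat.find_min hex (m := m)
  set n := Nat.find hex with hn
  have hcomm : ∀ g, c * g * c⁻¹ * g⁻¹ ∈ A := by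
    intro g
    cases hn0 : n with
    | zero =>
      rw [hn0, Subgroup.upperCentralSeries_zero, Subgroup.mem_bot] at hcn
      exact absurd (hcn ▸ A.one_mem) hcA
    | succ m =>
      rw [hn0, Subgroup.mem_upperCentralSeries_succ_iff] at hcn
      by_contra hg
      refine hmin m (by omega) ⟨_, hcn g, fun a ha => ?_, hg⟩
      have h1 : g⁻¹ * a * g ∈ A := by simpa using hN.conj_mem a ha g⁻¹
      have h2 := hcc _ h1
      have h3 := hcc _ ha
      have h3' : c⁻¹ * a = a * c⁻¹ := by rw [inv_mul_eq_iff_eq_mul, ← mul_assoc, h3]; group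
      have h2' : c⁻¹ * (g⁻¹ * a * g) = (g⁻¹ * a * g) * c⁻¹ := by
        rw [inv_mul_eq_iff_eq_mul, ← mul_assoc, h2]; group
      calc c * g * c⁻¹ * g⁻¹ * a = c * g * (c⁻¹ * (g⁻¹ * a * g)) * g⁻¹ := by group
        _ = c * a * (g * c⁻¹ * g⁻¹) := by rw [h2']; group
        _ = a * (c * g * c⁻¹ * g⁻¹) := by rw [h3]; group
  let B := Subgroup.closure ((A : Set P) ∪ {c})
  have hAB : A ≤ B := fun a ha => Subgroup.subset_closure (.inl ha)
  have hcB : c ∈ B := Subgroup.subset_closure (.inr rfl)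
  have hBc : IsMulCommutative B := by
    apply Subgroup.isMulCommutative_closure
    rintro a (ha | rfl) b (hb | rfl)
    · exact hc a ha b hb
    · exact (hcc a ha).symm
    · exact hcc b hb
    · rfl
  have hBN : B.Normal := by
    refine ⟨fun b hb g => ?_⟩
    induction hb using Subgroup.closure_induction with
    | mem y hy =>
      rcases hy with hy | rfl
      · exact hAB (hN.conj_mem y hy g)
      · have h1 := hAB (inv_mem (hcomm g))
        have : g * y * g⁻¹ = (y * g * y⁻¹ * g⁻¹)⁻¹ * y := by group
        rw [this]
        exact mul_mem h1 hcB
    | one => simp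
    | mul y z _ _ hy hz => rw [← conj_mul]; exact mul_mem hy hz
    | inv y _ hy => rw [← conj_inv]; exact inv_mem hy
  exact hcA (hA.le_of_ge ⟨hBN, fun a ha b hb => congrArg Subtype.val
    (hBc.is_comm.comm ⟨a, ha⟩ ⟨b, hb⟩)⟩ hAB hcB)

/-! ### Permutation of the weights of an abelian normal subgroup -/

namespace IsCubicRep

variable {P V : Type*} [Group P] [AddCommGroup V] [Module ℂ V] {ρ : P →* End ℂ V}
  {T : V →ₗ[ℂ] V →ₗ[ℂ] V →ₗ[ℂ] ℂ} {A : Subgroup P}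

/-- The conjugate of a weight of a normal subgroup. -/
def twist [A.Normal] (p : P) (χ : A → ℂ) : A → ℂ :=
  fun a => χ (MulAut.conjNormal p⁻¹ a)

theorem twist_mul [A.Normal] (p q : P) (χ : A → ℂ) : twist (p * q) χ = twist p (twist q χ) := by
  funext a
  simp only [twist, mul_inv_rev, map_mul, MulAut.mul_apply]

theorem twist_one [A.Normal] (χ : A → ℂ) : twist 1 χ = χ := by
  funext a
  simp [twist]

theorem twist_of_mem [A.Normal] (hA : ∀ a ∈ A, ∀ b ∈ A, a * b = b * a) {p : P} (hp : p ∈ A)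
    (χ : A → ℂ) : twist p χ = χ := by
  funext a
  refine congrArg χ (Subtype.ext ?_)
  rw [MulAut.conjNormal_apply, hA _ (inv_mem hp) _ a.2]
  group

theorem twist_injective [A.Normal] (p : P) : Function.Injective (twist (A := A) p) := by
  intro χ ψ h
  rw [← twist_one χ, ← twist_one ψ, ← inv_mul_cancel p, twist_mul, twist_mul, h]

/-- The weight space of a subgroup for a given weight. -/
abbrev weightSpace (ρ : P →* End ℂ V) (χ : A → ℂ) : Submodule ℂ V :=
  jointEigenspace (fun a : A => ρ a) χ

theorem apply_mem_weightSpace [A.Normal] (p : P) {χ : A → ℂ} {v : V} (hv : v ∈ weightSpace ρ χ) :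
    ρ p v ∈ weightSpace ρ (twist p χ) := by
  rw [mem_jointEigenspace] at hv ⊢
  intro a
  have h1 := hv (MulAut.conjNormal p⁻¹ a)
  have h2 : (a : P) * p = p * (MulAut.conjNormal p⁻¹ a : A) := by
    rw [MulAut.conjNormal_apply]; group
  rw [← End.mul_apply, ← map_mul, h2, map_mul, End.mul_apply, h1, map_smul]
  rfl

theorem apply_injective (p : P) : Function.Injective (ρ p) := by
  intro u v h
  have := congrArg (ρ p⁻¹) h
  rwa [← End.mul_apply, ← End.mul_apply, ← map_mul, inv_mul_cancel, map_one] at this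

theorem finrank_weightSpace_twist [A.Normal] [FiniteDimensional ℂ V] (p : P) (χ : A → ℂ) :
    finrank ℂ (weightSpace ρ (twist p χ)) = finrank ℂ (weightSpace ρ χ) := by
  have key : ∀ (p : P) (χ : A → ℂ),
      finrank ℂ (weightSpace ρ χ) ≤ finrank ℂ (weightSpace ρ (twist p χ)) := by
    intro p χ
    refine LinearMap.finrank_le_finrank_of_injective
      (f := (ρ p).restrict fun v hv => apply_mem_weightSpace p hv) ?_
    intro u v h
    exact Subtype.ext (apply_injective (ρ := ρ) p (congrArg Subtype.val h))
  refine le_antisymm ?_ (key p χ)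
  have := key p⁻¹ (twist p χ)
  rwa [← twist_mul, inv_mul_cancel, twist_one] at this

variable {b : Basis (Fin 5) ℂ V} {w : Fin 5 → A → ℂ}

open Classical in
/-- The multiplicity of a weight. -/
noncomputable def multiplicity (w : Fin 5 → A → ℂ) (χ : A → ℂ) : ℕ :=
  (Finset.univ.filter fun k => w k = χ).card

theorem multiplicity_twist [A.Normal] [FiniteDimensional ℂ V]
    (hb : ∀ k (a : A), ρ a (b k) = w k a • b k) (p : P)
    (χ : A → ℂ) : multiplicity w (twist p χ) = multiplicity w χ := by
  classical
  have h1 := finrank_weightSpace_twist (ρ := ρ) p χ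
  rw [weightSpace, weightSpace, finrank_jointEigenspace hb, finrank_jointEigenspace hb] at h1
  unfold multiplicity
  convert h1

theorem exists_of_multiplicity_pos {χ : A → ℂ} (h : 0 < multiplicity w χ) : ∃ k, w k = χ := by
  classical
  obtain ⟨k, hk⟩ := Finset.card_pos.1 h
  exact ⟨k, (Finset.mem_filter.1 hk).2⟩

theorem multiplicity_pos (k : Fin 5) : 0 < multiplicity w (w k) := by
  classical
  exact Finset.card_pos.2 ⟨k, Finset.mem_filter.2 ⟨Finset.mem_univ k, rfl⟩⟩

theorem exists_weight_eq_twist [A.Normal] [FiniteDimensional ℂ V]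
    (hb : ∀ k (a : A), ρ a (b k) = w k a • b k) (p : P)
    (k : Fin 5) : ∃ j, w j = twist p (w k) :=
  exists_of_multiplicity_pos (by rw [multiplicity_twist hb]; exact multiplicity_pos k)

/-- An element that fixes all weights centralizes the subgroup. -/
theorem mem_of_twist_eq (R : IsCubicRep ρ T) [A.Normal]
    (hcent : ∀ g, (∀ a ∈ A, g * a = a * g) → g ∈ A)
    (hb : ∀ k (a : A), ρ a (b k) = w k a • b k) {p : P} (hp : ∀ k, twist p (w k) = w k) : p ∈ A := by
  refine hcent p fun a ha => ?_
  have h1 : (MulAut.conjNormal p⁻¹ (⟨a, ha⟩ : A) : P) = a := by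
    refine R.injective (b.ext fun k => ?_)
    rw [hb, hb k ⟨a, ha⟩, ← congrFun (hp k) ⟨a, ha⟩]
    rfl
  rw [MulAut.conjNormal_apply] at h1
  conv_lhs => rw [← h1]
  group

/-- `P / A` acts faithfully on at most five weights, and `3 ^ 2` does not divide `5!`. -/
theorem index_eq (R : IsCubicRep ρ T) (hP : IsPGroup 3 P) [Finite P] [A.Normal]
    (hA : ∀ a ∈ A, ∀ b ∈ A, a * b = b * a) (hcent : ∀ g, (∀ a ∈ A, g * a = a * g) → g ∈ A)
    (hb : ∀ k (a : A), ρ a (b k) = w k a • b k) : A.index = 1 ∨ A.index = 3 := by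
  have := R.finiteDimensional
  let Ω := Set.range w
  let act : MulAction P Ω :=
    { smul := fun p χ => ⟨twist p χ.1, by
        obtain ⟨_, k, rfl⟩ := χ
        exact exists_weight_eq_twist hb p k⟩
      one_smul := fun χ => Subtype.ext (twist_one χ.1)
      mul_smul := fun p q χ => Subtype.ext (twist_mul p q χ.1) }
  have hker : (MulAction.toPermHom P Ω).ker = A := by
    ext p
    rw [MonoidHom.mem_ker]
    constructor
    · intro h
      exact R.mem_of_twist_eq hcent hb fun k =>
        congrArg Subtype.val (Equiv.congr_fun h ⟨w k, k, rfl⟩)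
    · intro h
      ext χ : 1
      exact Subtype.ext (twist_of_mem hA h χ.1)
  have hfin : Finite Ω := Set.finite_range w
  have hcard : Nat.card Ω ≤ 5 := by
    have := Nat.card_le_card_of_surjective (Set.rangeFactorization w) Set.rangeFactorization_surjective
    simpa using this
  have hdvd : A.index ∣ 120 := by
    rw [← hker, Subgroup.index_ker]
    refine (Subgroup.card_subgroup_dvd_card _).trans ?_
    rw [Nat.card_perm]
    exact Nat.factorial_dvd_factorial hcard
  obtain ⟨n, hn⟩ := hP.index A
  rw [hn] at hdvd ⊢
  have : n < 2 := by
    by_contra h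
    have h9 : 9 ∣ 120 := (pow_dvd_pow 3 (not_lt.1 h)).trans hdvd
    norm_num at h9
  interval_cases n <;> simp

end IsCubicRep

/-! ### Monomial bases -/

/-- The basis `b` diagonalizes the normal subgroup `A` with weights `w`, and `x`, which together
with `A` generates the group, permutes the first three basis vectors cyclically up to a scalar, and
has the remaining two as eigenvectors. The values of `w` outside `A` are irrelevant. -/
structure IsMonomialBasis {P V : Type*} [Group P] [AddCommGroup V] [Module ℂ V] (ρ : P →* End ℂ V)
    (A : Subgroup P) (x : P) (b : Basis (Fin 5) ℂ V) (w : Fin 5 → P → ℂ) : Prop where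
  apply : ∀ a ∈ A, ∀ k, ρ a (b k) = w k a • b k
  apply_zero : ρ x (b 0) = b 1
  apply_one : ρ x (b 1) = b 2
  apply_three : ∃ μ : ℂ, ρ x (b 3) = μ • b 3
  apply_four : ∃ ν : ℂ, ρ x (b 4) = ν • b 4
  normal : A.Normal
  center_mem : ∀ g, (∀ p, g * p = p * g) → g ∈ A
  not_mem : x ∉ A
  cube_mem : x ^ 3 ∈ A
  gen : ∀ h, ∃ k : ℕ, x ^ k * h ∈ A
  nontriv : ∃ a ∈ A, w 0 a ≠ w 1 a

namespace IsCubicRep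

variable {P V : Type*} [Group P] [AddCommGroup V] [Module ℂ V] {ρ : P →* End ℂ V}
  {T : V →ₗ[ℂ] V →ₗ[ℂ] V →ₗ[ℂ] ℂ} {A : Subgroup P} {b : Basis (Fin 5) ℂ V} {w : Fin 5 → A → ℂ}

theorem twist_eq_of_index_three [A.Normal] (hA : ∀ a ∈ A, ∀ b ∈ A, a * b = b * a)
    (hi : A.index = 3) (x : P) (χ : A → ℂ) : twist x (twist x (twist x χ)) = χ := by
  rw [← twist_mul, ← twist_mul]
  refine twist_of_mem hA ?_ χ
  have := Subgroup.pow_index_mem A x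
  rw [hi] at this
  rwa [pow_succ, pow_two] at this

/-- A weight moved by `x` has an orbit of three weights. -/
theorem twist_ne [A.Normal] (hA : ∀ a ∈ A, ∀ b ∈ A, a * b = b * a) (hi : A.index = 3) {x : P}
    {χ : A → ℂ} (h : twist x χ ≠ χ) : χ ≠ twist x χ ∧ χ ≠ twist x (twist x χ) ∧
      twist x χ ≠ twist x (twist x χ) := by
  refine ⟨h.symm, fun h' => ?_, fun h' => h (twist_injective x h').symm⟩
  have := twist_eq_of_index_three hA hi x χ
  rw [← h'] at this
  exact h this

/-- If `x` moves a weight, the three weights in its orbit are simple, and `x` fixes the two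
remaining weights (with multiplicity), since another orbit would have three more elements. -/
theorem exists_perm_weights (R : IsCubicRep ρ T) [A.Normal]
    (hA : ∀ a ∈ A, ∀ b ∈ A, a * b = b * a) (hi : A.index = 3)
    (hb : ∀ k (a : A), ρ a (b k) = w k a • b k) {x : P} {i : Fin 5} (hx : twist x (w i) ≠ w i) :
    ∃ σ : Equiv.Perm (Fin 5), σ 0 = i ∧ w (σ 1) = twist x (w (σ 0)) ∧
      w (σ 2) = twist x (w (σ 1)) ∧ twist x (w (σ 3)) = w (σ 3) ∧ twist x (w (σ 4)) = w (σ 4) ∧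
      ∀ l, ∀ m < (3 : Fin 5), w (σ l) = w (σ m) → l = m := by
  classical
  have := R.finiteDimensional
  have h012 : ∀ m < (3 : Fin 5), m = 0 ∨ m = 1 ∨ m = 2 := by decide
  obtain ⟨n1, n2, n3⟩ := twist_ne hA hi hx
  obtain ⟨j, hj⟩ := exists_weight_eq_twist hb x i
  obtain ⟨k, hk⟩ := exists_weight_eq_twist hb x j
  have hinj : ∀ p q, w p ≠ w q → p ≠ q := fun p q h hpq => h (congrArg w hpq)
  rw [← hj] at n1 n3
  rw [← hj, ← hk] at n2
  rw [← hk] at n3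
  obtain ⟨σ, rfl, rfl, rfl⟩ := exists_perm_extending (hinj _ _ n1) (hinj _ _ n2) (hinj _ _ n3)
  have hm1 : multiplicity w (w (σ 1)) = multiplicity w (w (σ 0)) := by rw [hj, multiplicity_twist hb]
  have hm2 : multiplicity w (w (σ 2)) = multiplicity w (w (σ 0)) := by
    rw [hk, multiplicity_twist hb, hm1]
  have hm : multiplicity w (w (σ 0)) ≤ 1 := by
    have hle : (Finset.univ.filter (fun k => w k = w (σ 0)) ∪ (Finset.univ.filter (fun k => w k = w (σ 1)) ∪
      Finset.univ.filter (fun k => w k = w (σ 2)))).card ≤ 5 := Finset.card_le_univ _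
    have d1 : Disjoint (Finset.univ.filter (fun k => w k = w (σ 1)))
        (Finset.univ.filter (fun k => w k = w (σ 2))) :=
      Finset.disjoint_filter.2 fun k _ h1 h2 => n3 (h1.symm.trans h2)
    have d2 : Disjoint (Finset.univ.filter (fun k => w k = w (σ 0)))
        (Finset.univ.filter (fun k => w k = w (σ 1)) ∪ Finset.univ.filter (fun k => w k = w (σ 2))) :=
      Finset.disjoint_union_right.2
        ⟨Finset.disjoint_filter.2 fun k _ h1 h2 => n1 (h1.symm.trans h2),
          Finset.disjoint_filter.2 fun k _ h1 h2 => n2 (h1.symm.trans h2)⟩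
    rw [Finset.card_union_of_disjoint d2, Finset.card_union_of_disjoint d1] at hle
    unfold multiplicity at hm1 hm2 ⊢
    omega
  have hsimple : ∀ p q, multiplicity w (w q) ≤ 1 → w p = w q → p = q := by
    intro p q hq hpq
    unfold multiplicity at hq
    exact Finset.card_le_one.1 hq p (Finset.mem_filter.2 ⟨Finset.mem_univ _, hpq⟩) q
      (Finset.mem_filter.2 ⟨Finset.mem_univ _, rfl⟩)
  have hs : ∀ l, ∀ m < (3 : Fin 5), w (σ l) = w (σ m) → l = m := by
    intro l m hm3 h
    refine σ.injective (hsimple _ _ ?_ h)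
    rcases h012 m hm3 with rfl | rfl | rfl
    · exact hm
    · exact hm1.trans_le hm
    · exact hm2.trans_le hm
  have hback : twist x (w (σ 2)) = w (σ 0) := by
    rw [hk, hj, twist_eq_of_index_three hA hi]
  have hfix : ∀ l, (∀ m < (3 : Fin 5), l ≠ m) → twist x (w (σ l)) = w (σ l) := by
    intro l hl
    by_contra hne
    obtain ⟨p1, p2, p3⟩ := twist_ne hA hi hne
    obtain ⟨j', hj'⟩ := exists_weight_eq_twist hb x (σ l)
    obtain ⟨k', hk'⟩ := exists_weight_eq_twist hb x j'
    rw [← hj'] at p1 p3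
    rw [← hj', ← hk'] at p2
    rw [← hk'] at p3
    have c0 : ∀ m < (3 : Fin 5), w (σ m) ≠ w (σ l) := fun m hm h => hl m hm (hs l m hm h.symm)
    have step : ∀ u v : A → ℂ, twist x u = v → ∀ u' v' : A → ℂ, twist x u' = v' → u ≠ u' → v ≠ v' := by
      rintro u _ rfl u' _ rfl h h'
      exact h (twist_injective x h')
    have c1 : ∀ m < (3 : Fin 5), w (σ m) ≠ w j' := by
      intro m hm
      rcases h012 m hm with rfl | rfl | rfl
      · exact step _ _ hback _ _ hj'.symm (c0 2 (by decide))
      · exact step _ _ hj.symm _ _ hj'.symm (c0 0 (by decide))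
      · exact step _ _ hk.symm _ _ hj'.symm (c0 1 (by decide))
    have c2 : ∀ m < (3 : Fin 5), w (σ m) ≠ w k' := by
      intro m hm
      rcases h012 m hm with rfl | rfl | rfl
      · exact step _ _ hback _ _ hk'.symm (c1 2 (by decide))
      · exact step _ _ hj.symm _ _ hk'.symm (c1 0 (by decide))
      · exact step _ _ hk.symm _ _ hk'.symm (c1 1 (by decide))
    refine not_six_distinct (s := [σ 0, σ 1, σ 2, σ l, j', k']) ?_ rfl
    simp only [List.nodup_cons, List.mem_cons, List.not_mem_nil, or_false, not_or, not_false_eq_true,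
      List.nodup_nil, and_true]
    exact ⟨⟨hinj _ _ n1, hinj _ _ n2, hinj _ _ (c0 0 (by decide)), hinj _ _ (c1 0 (by decide)),
      hinj _ _ (c2 0 (by decide))⟩, ⟨hinj _ _ n3, hinj _ _ (c0 1 (by decide)),
      hinj _ _ (c1 1 (by decide)), hinj _ _ (c2 1 (by decide))⟩, ⟨hinj _ _ (c0 2 (by decide)),
      hinj _ _ (c1 2 (by decide)), hinj _ _ (c2 2 (by decide))⟩, ⟨hinj _ _ p1, hinj _ _ p2⟩,
      hinj _ _ p3⟩
  exact ⟨σ, rfl, hj, hk, hfix 3 (by decide), hfix 4 (by decide), hs⟩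

/-- Two joint eigenvectors of `A` with weights fixed by `x` span a plane that can be diagonalized
for `A` and `x` together. -/
theorem exists_joint_eigenvectors_plane (R : IsCubicRep ρ T) (hP : IsPGroup 3 P) [A.Normal]
    (hA : ∀ a ∈ A, ∀ b ∈ A, a * b = b * a)
    (hb : ∀ k (a : A), ρ a (b k) = w k a • b k) {x : P} {i j : Fin 5} (hij : i ≠ j)
    (hi : twist x (w i) = w i) (hj : twist x (w j) = w j)
    (hw : ∀ k, w k = w i ∨ w k = w j → k = i ∨ k = j) :
    ∃ c : Fin 2 → V, Submodule.span ℂ (Set.range c) = Submodule.span ℂ {b i, b j} ∧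
      ∀ k, (∀ a : A, ∃ z : ℂ, ρ a (c k) = z • c k) ∧ ∃ z : ℂ, ρ x (c k) = z • c k := by
  have := R.finiteDimensional
  set U := Submodule.span ℂ {b i, b j} with hU
  have hws : ∀ l, l = i ∨ l = j → weightSpace ρ (w l) ≤ U := by
    intro l hl
    rw [weightSpace, jointEigenspace_eq_span hb]
    refine Submodule.span_mono ?_
    rintro _ ⟨k, hk, rfl⟩
    have : k = i ∨ k = j := hw k (by rcases hl with rfl | rfl; exacts [.inl hk, .inr hk])
    rcases this with rfl | rfl <;> simp
  have hmem : ∀ l, b l ∈ weightSpace ρ (w l) := fun l => mem_jointEigenspace.2 fun a => hb l a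
  have hstab : ∀ p : P, twist p (w i) = w i → twist p (w j) = w j → ∀ v ∈ U, ρ p v ∈ U := by
    intro p h1 h2 v hv
    obtain ⟨s, t, rfl⟩ := Submodule.mem_span_pair.1 hv
    rw [map_add, map_smul, map_smul]
    refine U.add_mem (U.smul_mem _ ?_) (U.smul_mem _ ?_)
    · have := apply_mem_weightSpace p (hmem i)
      rw [h1] at this
      exact hws i (.inl rfl) this
    · have := apply_mem_weightSpace p (hmem j)
      rw [h2] at this
      exact hws j (.inr rfl) this
  let I := {p : P // p ∈ A ∨ p = x}
  have hI : ∀ p : I, ∀ v ∈ U, ρ p v ∈ U := by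
    rintro ⟨p, hp | rfl⟩
    · exact hstab p (twist_of_mem hA hp _) (twist_of_mem hA hp _)
    · exact hstab p hi hj
  have hAx : ∀ a ∈ A, ∀ v ∈ U, ρ a (ρ x v) = ρ x (ρ a v) := by
    intro a ha v hv
    obtain ⟨s, t, rfl⟩ := Submodule.mem_span_pair.1 hv
    have e : ∀ l, twist x (w l) = w l → ρ a (ρ x (b l)) = ρ x (ρ a (b l)) := by
      intro l hl
      have h1 := apply_mem_weightSpace x (hmem l)
      rw [hl] at h1
      have h2 := mem_jointEigenspace.1 h1 ⟨a, ha⟩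
      rw [hb l ⟨a, ha⟩, map_smul]
      exact h2
    simp only [map_add, map_smul, e i hi, e j hj]
  have hrank : finrank ℂ U = 2 := by
    have hli : LinearIndependent ℂ ![b i, b j] := by
      rw [LinearIndependent.pair_iff]
      intro s t hst
      have h1 := congrArg (fun u => b.repr u i) hst
      have h2 := congrArg (fun u => b.repr u j) hst
      simp [hij.symm] at h1
      simp [hij] at h2
      exact ⟨h1, h2⟩
    have := finrank_span_eq_card hli
    rwa [Matrix.range_cons, Matrix.range_cons, Matrix.range_empty, Set.union_empty,
      Set.singleton_union] at this
  obtain ⟨c, z, hc⟩ := exists_basis_joint_eigenvectors hrank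
    (fun p : I => (ρ p).restrict (hI p)) (by
      rintro ⟨p, hp⟩ ⟨q, hq⟩
      refine LinearMap.ext fun v => Subtype.ext ?_
      change ρ p (ρ q v) = ρ q (ρ p v)
      rcases hp with hp | rfl <;> rcases hq with hq | rfl
      · rw [← End.mul_apply, ← End.mul_apply, ← map_mul, ← map_mul, hA p hp q hq]
      · exact hAx p hp v v.2
      · exact (hAx q hq v v.2).symm
      · rfl) (by
      intro p
      refine ⟨9, by norm_num, LinearMap.ext fun v => Subtype.ext ?_⟩
      rw [End.pow_restrict]
      change (ρ p ^ 9) v = v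
      rw [← map_pow, R.pow_nine hP, map_one, End.one_apply])
  refine ⟨fun k => c k, ?_, fun k => ⟨fun a => ⟨z k ⟨a, .inl a.2⟩, congrArg Subtype.val (hc k ⟨a, .inl a.2⟩)⟩,
    ⟨z k ⟨x, .inr rfl⟩, congrArg Subtype.val (hc k ⟨x, .inr rfl⟩)⟩⟩⟩
  have h1 : (Set.range fun k => (c k : V)) = U.subtype '' Set.range c := by
    rw [← Set.range_comp]; rfl
  rw [h1, Submodule.span_image, c.span_eq, Submodule.map_top, Submodule.range_subtype]

/-- A group of symmetries is diagonal, or it has a diagonal subgroup of index `3` and an element that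
rotates three of the basis vectors. -/
theorem exists_monomial_basis (R : IsCubicRep ρ T) (hP : IsPGroup 3 P) [Finite P] :
    (∃ (b : Basis (Fin 5) ℂ V) (w : Fin 5 → P → ℂ), ∀ k p, ρ p (b k) = w k p • b k) ∨
    ∃ (A : Subgroup P) (x : P) (b : Basis (Fin 5) ℂ V) (w : Fin 5 → P → ℂ),
      IsMonomialBasis ρ A x b w := by
  have := R.finiteDimensional
  have : Fact (Nat.Prime 3) := ⟨Nat.prime_three⟩
  have := hP.isNilpotent
  obtain ⟨A, hN, hA, hcent⟩ := exists_normal_self_centralizing P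
  obtain ⟨b, w, hb⟩ := exists_basis_joint_eigenvectors R.finrank_eq (fun a : A => ρ a)
    (fun a a' => by
      change ρ a * ρ a' = ρ a' * ρ a
      rw [← map_mul, ← map_mul, hA a a.2 a' a'.2])
    (fun a => ⟨9, by norm_num, by rw [← map_pow, R.pow_nine hP, map_one]⟩)
  rcases R.index_eq hP hA hcent hb with hi | hi
  · left
    rw [Subgroup.index_eq_one] at hi
    exact ⟨b, fun k p => w k ⟨p, hi ▸ Subgroup.mem_top p⟩, fun k p => hb k ⟨p, _⟩⟩
  right
  obtain ⟨x, hx⟩ : ∃ x, x ∉ A := by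
    by_contra! h
    rw [(Subgroup.eq_top_iff' A).2 h, Subgroup.index_top] at hi
    norm_num at hi
  obtain ⟨i, hxi⟩ : ∃ i, twist x (w i) ≠ w i := by
    by_contra! h
    exact hx (R.mem_of_twist_eq hcent hb h)
  obtain ⟨σ, rfl, h1, h2, h3, h4, hs⟩ := R.exists_perm_weights hA hi hb hxi
  obtain ⟨c, hcspan, hc⟩ := R.exists_joint_eigenvectors_plane hP hA hb
    (show σ 3 ≠ σ 4 from σ.injective.ne (by decide)) h3 h4 (by
      intro k hk
      obtain ⟨l, rfl⟩ := σ.surjective k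
      have key : ∀ m : Fin 5, m = 3 ∨ m = 4 → w (σ l) = w (σ m) → l = 3 ∨ l = 4 := by
        intro m hm h
        by_contra hl
        have hl3 : l < 3 := (by decide : ∀ l : Fin 5, ¬(l = 3 ∨ l = 4) → l < 3) l hl
        have := hs m l hl3 h.symm
        subst this
        exact hl hm
      rcases hk with h | h
      · exact (key 3 (.inl rfl) h).imp (congrArg σ) (congrArg σ)
      · exact (key 4 (.inr rfl) h).imp (congrArg σ) (congrArg σ))
  have hmem : ∀ l, b l ∈ weightSpace ρ (w l) := fun l => mem_jointEigenspace.2 fun a => hb l a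
  have hm1 : ρ x (b (σ 0)) ∈ weightSpace ρ (w (σ 1)) := h1 ▸ apply_mem_weightSpace x (hmem _)
  have hm2 : ρ x (ρ x (b (σ 0))) ∈ weightSpace ρ (w (σ 2)) := h2 ▸ apply_mem_weightSpace x hm1
  have hline : ∀ m < (3 : Fin 5), ∀ v ∈ weightSpace ρ (w (σ m)), v ≠ 0 →
      b (σ m) ∈ Submodule.span ℂ {v} := by
    intro m hm v hv hv0
    rw [weightSpace, jointEigenspace_eq_span hb] at hv
    have hset : b '' {k | w k = w (σ m)} = {b (σ m)} := by
      ext u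
      constructor
      · rintro ⟨k, hk, rfl⟩
        obtain ⟨l, rfl⟩ := σ.surjective k
        rw [hs l m hm hk]; rfl
      · rintro rfl
        exact ⟨_, rfl, rfl⟩
    rw [hset] at hv
    obtain ⟨z, rfl⟩ := Submodule.mem_span_singleton.1 hv
    have hz : z ≠ 0 := by rintro rfl; simp at hv0
    exact Submodule.mem_span_singleton.2 ⟨z⁻¹, by rw [smul_smul, inv_mul_cancel₀ hz, one_smul]⟩
  have hne : ∀ v, v ≠ 0 → ρ x v ≠ 0 := fun v hv h =>
    hv (apply_injective (ρ := ρ) x (h.trans (map_zero _).symm))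
  let e : Fin 5 → V := ![b (σ 0), ρ x (b (σ 0)), ρ x (ρ x (b (σ 0))), c 0, c 1]
  have hspan : ⊤ ≤ Submodule.span ℂ (Set.range e) := by
    have he : ∀ k, e k ∈ Submodule.span ℂ (Set.range e) := fun k => Submodule.subset_span ⟨k, rfl⟩
    have hsing : ∀ k, Submodule.span ℂ {e k} ≤ Submodule.span ℂ (Set.range e) := fun k =>
      Submodule.span_mono (Set.singleton_subset_iff.2 ⟨k, rfl⟩)
    have hplane : Submodule.span ℂ {b (σ 3), b (σ 4)} ≤ Submodule.span ℂ (Set.range e) := by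
      rw [← hcspan]
      refine Submodule.span_mono ?_
      rintro _ ⟨k, rfl⟩
      fin_cases k
      · exact ⟨3, rfl⟩
      · exact ⟨4, rfl⟩
    rw [← b.span_eq, Submodule.span_le]
    rintro _ ⟨k, rfl⟩
    obtain ⟨l, rfl⟩ := σ.surjective k
    have : l = 0 ∨ l = 1 ∨ l = 2 ∨ l = 3 ∨ l = 4 := by revert l; decide
    rcases this with rfl | rfl | rfl | rfl | rfl
    · exact he 0
    · exact hsing 1 (hline 1 (by decide) _ hm1 (hne _ (b.ne_zero _)))
    · exact hsing 2 (hline 2 (by decide) _ hm2 (hne _ (hne _ (b.ne_zero _))))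
    · exact hplane (Submodule.subset_span (by simp))
    · exact hplane (Submodule.subset_span (by simp))
  let B := basisOfTopLeSpanOfCardEqFinrank e hspan (by simp [R.finrank_eq])
  have hB : ∀ k, B k = e k := fun k => by simp [B]
  have hdiag : ∀ (k : Fin 5) (a : P), ∃ z : ℂ, a ∈ A → ρ a (e k) = z • e k := by
    intro k a
    by_cases ha : a ∈ A
    · have : k = 0 ∨ k = 1 ∨ k = 2 ∨ k = 3 ∨ k = 4 := by revert k; decide
      rcases this with rfl | rfl | rfl | rfl | rfl
      · exact ⟨_, fun _ => hb (σ 0) ⟨a, ha⟩⟩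
      · exact ⟨_, fun _ => mem_jointEigenspace.1 hm1 ⟨a, ha⟩⟩
      · exact ⟨_, fun _ => mem_jointEigenspace.1 hm2 ⟨a, ha⟩⟩
      · obtain ⟨z, hz⟩ := (hc 0).1 ⟨a, ha⟩
        exact ⟨z, fun _ => hz⟩
      · obtain ⟨z, hz⟩ := (hc 1).1 ⟨a, ha⟩
        exact ⟨z, fun _ => hz⟩
    · exact ⟨0, fun h => absurd h ha⟩
  choose W hW using hdiag
  refine ⟨A, x, B, W, ⟨fun a ha k => ?_, ?_, ?_, ?_, ?_, hN, fun g hg => hcent g fun a _ => hg a, hx, ?_, ?_, ?_⟩⟩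
  · rw [hB]; exact hW k a ha
  · rw [hB, hB]; rfl
  · rw [hB, hB]; rfl
  · rw [hB]; exact (hc 0).2
  · rw [hB]; exact (hc 1).2
  · have := Subgroup.pow_index_mem A x
    rwa [hi] at this
  · intro h
    have hx1 : (x : P ⧸ A) ≠ 1 := fun h => hx ((QuotientGroup.eq_one_iff x).1 h)
    obtain ⟨k, hk⟩ := mem_powers_of_prime_card (p := 3) (G := P ⧸ A) hi hx1 (g' := (h : P ⧸ A)⁻¹)
    refine ⟨k, (QuotientGroup.eq_one_iff _).1 ?_⟩
    rw [QuotientGroup.mk_mul, QuotientGroup.mk_pow]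
    exact mul_eq_one_iff_eq_inv.2 hk
  · obtain ⟨a, ha⟩ := Function.ne_iff.1 hxi
    refine ⟨a, a.2, fun h => ha ?_⟩
    have e0 := hW 0 a a.2
    have e1 := hW 1 a a.2
    have f0 : ρ a (e 0) = w (σ 0) a • e 0 := hb (σ 0) a
    have f1 : ρ a (e 1) = w (σ 1) a • e 1 := mem_jointEigenspace.1 hm1 a
    have g0 := smul_left_injective ℂ (b.ne_zero (σ 0)) (e0.symm.trans f0)
    have g1 := smul_left_injective ℂ (hne _ (b.ne_zero (σ 0))) (e1.symm.trans f1)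
    rw [← h1]
    exact g1.symm.trans (h.symm.trans g0)

end IsCubicRep

/-! ### Groups of symmetries in a monomial basis -/

open Classical in
/-- A logarithm on the complex `n`-th roots of unity, with value `0` elsewhere. -/
noncomputable def rootLog (n : ℕ) [NeZero n] (z : ℂ) : ZMod n :=
  if h : z ^ n = 1 then
    (mulEquivOfCyclicCardEq (G := rootsOfUnity n ℂ) (G' := Cyc n)
      ((Complex.card_rootsOfUnity n).trans (Nat.card_zmod n).symm)
      (rootsOfUnity.mkOfPowEq z h)).toAdd
  else 0

theorem rootLog_mul {n : ℕ} [NeZero n] {y z : ℂ} (hy : y ^ n = 1) (hz : z ^ n = 1) :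
    rootLog n (y * z) = rootLog n y + rootLog n z := by
  have hyz : (y * z) ^ n = 1 := by rw [mul_pow, hy, hz, one_mul]
  rw [rootLog, rootLog, rootLog, dif_pos hy, dif_pos hz, dif_pos hyz, ← toAdd_mul, ← map_mul]
  congr 2
  ext
  simp

theorem rootLog_inj {n : ℕ} [NeZero n] {y z : ℂ} (hy : y ^ n = 1) (hz : z ^ n = 1)
    (h : rootLog n y = rootLog n z) : y = z := by
  rw [rootLog, rootLog, dif_pos hy, dif_pos hz] at h
  have := (mulEquivOfCyclicCardEq _).injective (Multiplicative.toAdd.injective h)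
  simpa using congrArg (fun u : rootsOfUnity n ℂ => ((u : ℂˣ) : ℂ)) this

theorem rootLog_one {n : ℕ} [NeZero n] : rootLog n 1 = 0 := by
  have := rootLog_mul (n := n) (one_pow n) (one_pow n)
  rw [mul_one] at this
  exact left_eq_add.1 this

theorem eq_one_of_rootLog {n : ℕ} [NeZero n] {z : ℂ} (hz : z ^ n = 1) (h : rootLog n z = 0) :
    z = 1 :=
  rootLog_inj hz (one_pow n) (h.trans rootLog_one.symm)

/-- Two eigenvalues of which each is related to one of the two by `z ↦ z⁻²` are
cube roots of unity. -/
theorem pow_three_of_closed_pair {y z : ℂ} (hy : y ^ 9 = 1) (hz : z ^ 9 = 1)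
    (h1 : y ^ 2 * y = 1 ∨ y ^ 2 * z = 1) (h2 : z ^ 2 * y = 1 ∨ z ^ 2 * z = 1) :
    y ^ 3 = 1 ∧ z ^ 3 = 1 := by
  have key : ∀ u v : ℂ, u ^ 3 = 1 → v ^ 9 = 1 → v ^ 2 * u = 1 → v ^ 3 = 1 := by
    intro u v hu hv h
    have h6 : v ^ 6 = 1 := by
      have : (v ^ 2 * u) ^ 3 = 1 := by rw [h, one_pow]
      linear_combination this - v ^ 6 * hu
    linear_combination hv - v ^ 3 * h6
  rcases h1 with h | h <;> rcases h2 with h' | h'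
  · have h3 : y ^ 3 = 1 := by linear_combination h
    exact ⟨h3, key _ _ h3 hz h'⟩
  · exact ⟨by linear_combination h, by linear_combination h'⟩
  · exact ⟨by linear_combination (y ^ 2 * z + 1) * h - y ^ 3 * h',
      by linear_combination (z ^ 2 * y + 1) * h' - z ^ 3 * h⟩
  · have h3 : z ^ 3 = 1 := by linear_combination h'
    exact ⟨key _ _ h3 hy h, h3⟩

/-- The subgroup of elements that fix a vector. -/
def fixer {P V : Type*} [Group P] [AddCommGroup V] [Module ℂ V] (ρ : P →* End ℂ V) (v : V) :
    Subgroup P where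
  carrier := {p | ρ p v = v}
  one_mem' := by simp
  mul_mem' {p q} hp hq := by
    change ρ (p * q) v = v
    rw [map_mul, End.mul_apply, hq, hp]
  inv_mem' {p} hp := by
    change ρ p⁻¹ v = v
    conv_lhs => rw [← show ρ p v = v from hp]
    rw [← End.mul_apply, ← map_mul, inv_mul_cancel, map_one, End.one_apply]

theorem mem_fixer {P V : Type*} [Group P] [AddCommGroup V] [Module ℂ V] {ρ : P →* End ℂ V} {v : V}
    {p : P} : p ∈ fixer ρ v ↔ ρ p v = v := Iff.rfl

/-- A vector that every group element multiplies by a cube root of unity. -/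
def IsCubicEigenvector {P V : Type*} [Group P] [AddCommGroup V] [Module ℂ V] (ρ : P →* End ℂ V)
    (v : V) : Prop :=
  v ≠ 0 ∧ ∀ p, ∃ z : ℂ, z ^ 3 = 1 ∧ ρ p v = z • v

/-- `s` acts as the scalar `ω`, a primitive cube root of unity. -/
structure IsCubeRootScalar {P V : Type*} [Group P] [AddCommGroup V] [Module ℂ V] (ρ : P →* End ℂ V)
    (s : P) (ω : ℂ) : Prop where
  prim : IsPrimitiveRoot ω 3
  apply : ∀ v, ρ s v = ω • v

namespace IsCubicRep

section Scalar

variable {P V : Type*} [Group P] [AddCommGroup V] [Module ℂ V] {ρ : P →* End ℂ V}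
  {T : V →ₗ[ℂ] V →ₗ[ℂ] V →ₗ[ℂ] ℂ} {s : P} {ω : ℂ}

theorem scalar_commute (R : IsCubicRep ρ T) (hs : IsCubeRootScalar ρ s ω) (p : P) : s * p = p * s :=
  R.injective (LinearMap.ext fun v => by
    rw [map_mul, map_mul, End.mul_apply, End.mul_apply, hs.apply, hs.apply, map_smul])

theorem scalar_pow_three (R : IsCubicRep ρ T) (hs : IsCubeRootScalar ρ s ω) : s ^ 3 = 1 :=
  R.injective (LinearMap.ext fun v => by
    rw [pow_apply (hs.apply v), hs.prim.pow_eq_one, one_smul, map_one, End.one_apply])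

/-- An element with a cube root of unity as eigenvalue fixes the eigenvector after
multiplication by a scalar. -/
theorem exists_mul_scalar_mem_fixer (hs : IsCubeRootScalar ρ s ω) {p : P} {v : V} {z : ℂ}
    (hz : z ^ 3 = 1) (hp : ρ p v = z • v) : ∃ j : ℕ, p * s ^ j ∈ fixer ρ v := by
  obtain ⟨i, hi, rfl⟩ := hs.prim.eq_pow_of_pow_eq_one hz
  refine ⟨3 - i, ?_⟩
  rw [mem_fixer, map_mul, End.mul_apply, pow_apply (hs.apply v), map_smul, hp, smul_smul, ← pow_add,
    Nat.sub_add_cancel hi.le, hs.prim.pow_eq_one, one_smul]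

theorem eigenvalue_mul {b : Basis (Fin 5) ℂ V} {w : Fin 5 → P → ℂ} {p q : P} {k : Fin 5}
    (hp : ρ p (b k) = w k p • b k) (hq : ρ q (b k) = w k q • b k)
    (hpq : ρ (p * q) (b k) = w k (p * q) • b k) : w k (p * q) = w k p * w k q := by
  rw [map_mul, End.mul_apply, hq, map_smul, hp, smul_smul] at hpq
  rw [mul_comm (w k p)]
  exact (smul_left_injective ℂ (b.ne_zero k) hpq).symm

end Scalar

variable {P : Type} {V : Type*} [Group P] [AddCommGroup V] [Module ℂ V] {ρ : P →* End ℂ V}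
  {T : V →ₗ[ℂ] V →ₗ[ℂ] V →ₗ[ℂ] ℂ}

/-- For a diagonal group all weights are cube roots of unity, or an element with an eigenvalue of
order `9` shows how the weights pair up; then two weights determine the others on the fixer. -/
theorem inListG3_of_diagonal (R : IsCubicRep ρ T) (hP : IsPGroup 3 P) [Finite P]
    {b : Basis (Fin 5) ℂ V} {w : Fin 5 → P → ℂ} (hb : ∀ k p, ρ p (b k) = w k p • b k) :
    ∃ v, IsCubicEigenvector ρ v ∧ (Nontrivial (fixer ρ v) → InListG3 (fixer ρ v)) := by
  have hmul : ∀ k p q, w k (p * q) = w k p * w k q := fun k p q =>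
    eigenvalue_mul (hb k p) (hb k q) (hb k (p * q))
  have h9 : ∀ k p, w k p ^ 9 = 1 := fun k p =>
    R.eigenvalue_pow_nine hP (d := fun k => w k p) (fun k => hb k p) k
  have hfix : ∀ k p, p ∈ fixer ρ (b k) → w k p = 1 := by
    intro k p hp
    rw [mem_fixer, hb] at hp
    exact smul_left_injective ℂ (b.ne_zero k) (hp.trans (one_smul ℂ _).symm)
  by_cases hexp : ∀ p : P, p ^ 3 = 1
  · have h3 : ∀ k p, w k p ^ 3 = 1 := by
      intro k p
      have := pow_apply (hb k p) 3
      rw [hexp, map_one, End.one_apply] at this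
      exact smul_left_injective ℂ (b.ne_zero k) (this.symm.trans (one_smul ℂ _).symm)
    refine ⟨b 4, ⟨b.ne_zero 4, fun p => ⟨_, h3 4 p, hb 4 p⟩⟩, fun hnt => ?_⟩
    refine inListG3_of_exponent_three (fun p q => Subtype.ext ?_) (fun p => Subtype.ext (hexp p)) ?_
    · refine R.injective (b.ext fun k => ?_)
      change ρ (p * q) (b k) = ρ (q * p) (b k)
      rw [hb, hb, hmul, hmul, mul_comm]
    · have hinj : Function.Injective fun (p : fixer ρ (b 4)) (k : Fin 4) =>
          rootLog 3 (w k.castSucc p) := by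
        intro p q hpq
        refine Subtype.ext (R.injective (b.ext fun k => ?_))
        rw [hb, hb]
        congr 1
        induction k using Fin.lastCases with
        | last => exact (hfix 4 p p.2).trans (hfix 4 q q.2).symm
        | cast k => exact rootLog_inj (h3 _ _) (h3 _ _) (congrFun hpq k)
      have := Nat.card_le_card_of_injective _ hinj
      simpa using this
  · push Not at hexp
    obtain ⟨g, hg⟩ := hexp
    obtain h | ⟨σ, n0, e1, e2, e3, e4⟩ :=
      R.eigenvalue_dichotomy hP (d := fun k => w k g) (fun k => hb k g)
    · exact absurd (R.eq_one_of_basis b fun k => by rw [pow_apply (hb k g), h, one_smul]) hg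
    -- the weight that pairs with `w k` is determined by its value at `g`
    have hrel : ∀ k, ∃ j, ∀ p, w (σ k) p ^ 2 * w (σ j) p = 1 := by
      intro k
      obtain ⟨j, hj⟩ := R.exists_basis_ne_zero b (b.ne_zero (σ k))
      obtain ⟨j, rfl⟩ := σ.surjective j
      exact ⟨j, fun p => R.weight_eq (hb _ p) (hb _ p) hj⟩
    have h9g := h9 (σ 0) g
    set z := w (σ 0) g with hz
    -- the cubes of the eigenvalues of `g` tell the first three indices from the last two
    have hcases : ∀ j : Fin 5, j = 0 ∨ j = 1 ∨ j = 2 ∨ j = 3 ∨ j = 4 := by decide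
    have c0 : ∀ k < (3 : Fin 5), w (σ k) g ^ 3 = z ^ 3 := by
      intro k hk
      rcases (by decide : ∀ k < (3 : Fin 5), k = 0 ∨ k = 1 ∨ k = 2) k hk with rfl | rfl | rfl
      · rfl
      · rw [e1]; linear_combination (z ^ 3 * (1 + z ^ 9)) * h9g
      · rw [e2]; linear_combination z ^ 3 * h9g
    have c1 : ∀ k : Fin 5, ¬k < 3 → w (σ k) g ^ 3 = 1 := by
      intro k hk
      rcases (by decide : ∀ k : Fin 5, ¬k < 3 → k = 3 ∨ k = 4) k hk with rfl | rfl
      · exact e3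
      · exact e4
    have hlt : ∀ k j, (∀ p, w (σ k) p ^ 2 * w (σ j) p = 1) → (k < 3 ↔ j < 3) := by
      intro k j h
      have hc : (w (σ k) g ^ 3) ^ 2 * w (σ j) g ^ 3 = 1 := by
        have : (w (σ k) g ^ 2 * w (σ j) g) ^ 3 = 1 := by rw [h g, one_pow]
        linear_combination this
      by_cases hk : k < 3 <;> by_cases hj : j < 3 <;> simp only [hk, hj]
      · rw [c0 k hk, c1 j hj] at hc
        exact absurd (by linear_combination h9g - z ^ 3 * hc) n0
      · rw [c1 k hk, c0 j hj] at hc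
        exact absurd (by linear_combination hc) n0
    have rel0 : ∀ p, w (σ 0) p ^ 2 * w (σ 1) p = 1 := by
      obtain ⟨j, hj⟩ := hrel 0
      have hj3 := (hlt 0 j hj).1 (by decide)
      have hg := hj g
      rw [← hz] at hg
      rcases hcases j with rfl | rfl | rfl | rfl | rfl
      · exact absurd (by linear_combination hg) n0
      · exact hj
      · refine absurd (by rw [e2] at hg; linear_combination h9g - z ^ 3 * hg) n0
      · exact absurd hj3 (by decide)
      · exact absurd hj3 (by decide)
    have rel1 : ∀ p, w (σ 1) p ^ 2 * w (σ 2) p = 1 := by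
      obtain ⟨j, hj⟩ := hrel 1
      have hj3 := (hlt 1 j hj).1 (by decide)
      have hg := hj g
      rw [e1] at hg
      rcases hcases j with rfl | rfl | rfl | rfl | rfl
      · rw [← hz] at hg
        exact absurd (by linear_combination (1 + z ^ 9) * h9g - z ^ 3 * hg) n0
      · rw [e1] at hg
        exact absurd (by linear_combination hg - z ^ 3 * (1 + z ^ 9) * h9g) n0
      · exact hj
      · exact absurd hj3 (by decide)
      · exact absurd hj3 (by decide)
    have h34 : ∀ p, w (σ 3) p ^ 3 = 1 ∧ w (σ 4) p ^ 3 = 1 := by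
      have haux : ∀ k : Fin 5, ¬k < 3 →
          (∀ p, w (σ k) p ^ 2 * w (σ 3) p = 1) ∨ ∀ p, w (σ k) p ^ 2 * w (σ 4) p = 1 := by
        intro k hk
        obtain ⟨j, hj⟩ := hrel k
        have hj3 := fun h => hk ((hlt k j hj).2 h)
        rcases (by decide : ∀ k : Fin 5, ¬k < 3 → k = 3 ∨ k = 4) j hj3 with rfl | rfl
        · exact .inl hj
        · exact .inr hj
      exact fun p => pow_three_of_closed_pair (h9 _ p) (h9 _ p)
        ((haux 3 (by decide)).imp (fun h => h p) fun h => h p)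
        ((haux 4 (by decide)).imp (fun h => h p) fun h => h p)
    refine ⟨b (σ 4), ⟨b.ne_zero _, fun p => ⟨_, (h34 p).2, hb _ p⟩⟩, fun hnt => ?_⟩
    refine inListG3_of_injective_C9_C3
      { toFun := fun p => (.ofAdd (rootLog 9 (w (σ 0) p)), .ofAdd (rootLog 3 (w (σ 3) p)))
        map_one' := ?_
        map_mul' := ?_ } ?_
    · have h1 : ∀ k, w k 1 = 1 := fun k => by
        refine smul_left_injective ℂ (b.ne_zero k) ((hb k 1).symm.trans ?_)
        rw [map_one, End.one_apply]
        exact (one_smul ℂ _).symm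
      simp only [Subgroup.coe_one, h1, rootLog_one]
      rfl
    · intro p q
      simp only [Subgroup.coe_mul, hmul, rootLog_mul (h9 _ _) (h9 _ _),
        rootLog_mul (h34 _).1 (h34 _).1]
      rfl
    · intro p q hpq
      have f0 : w (σ 0) p = w (σ 0) q :=
        rootLog_inj (h9 _ _) (h9 _ _) (congrArg (fun u : Cyc 9 × Cyc 3 => u.1.toAdd) hpq)
      have f3 : w (σ 3) p = w (σ 3) q :=
        rootLog_inj (h34 _).1 (h34 _).1 (congrArg (fun u : Cyc 9 × Cyc 3 => u.2.toAdd) hpq)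
      have hcancel : ∀ x y y' : ℂ, x ^ 9 = 1 → x ^ 2 * y = 1 → x ^ 2 * y' = 1 → y = y' := by
        intro x y y' hx h h'
        linear_combination (x ^ 7) * (h - h') - (y - y') * hx
      have f1 : w (σ 1) p = w (σ 1) q := hcancel _ _ _ (h9 (σ 0) p) (rel0 p) (f0 ▸ rel0 q)
      have f2 : w (σ 2) p = w (σ 2) q := hcancel _ _ _ (h9 (σ 1) p) (rel1 p) (f1 ▸ rel1 q)
      have f4 : w (σ 4) p = w (σ 4) q := (hfix _ p p.2).trans (hfix _ q q.2).symm
      refine Subtype.ext (R.injective (b.ext fun k => ?_))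
      rw [hb, hb]
      congr 1
      obtain ⟨k, rfl⟩ := σ.surjective k
      rcases hcases k with rfl | rfl | rfl | rfl | rfl <;> assumption

end IsCubicRep

/-! ### Nonabelian groups of symmetries: weights of the monomial basis -/

/-- The permutation of the indices of a monomial basis. -/
def monomialStep : Fin 5 → Fin 5 := ![1, 2, 0, 3, 4]

namespace IsMonomialBasis

variable {P V : Type*} [Group P] [AddCommGroup V] [Module ℂ V] {ρ : P →* End ℂ V}
  {T : V →ₗ[ℂ] V →ₗ[ℂ] V →ₗ[ℂ] ℂ} {A : Subgroup P} {x : P} {b : Basis (Fin 5) ℂ V}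
  {w : Fin 5 → P → ℂ}

theorem map_mul (M : IsMonomialBasis ρ A x b w) {p q : P} (hp : p ∈ A) (hq : q ∈ A) (k : Fin 5) :
    w k (p * q) = w k p * w k q :=
  IsCubicRep.eigenvalue_mul (M.apply p hp k) (M.apply q hq k) (M.apply _ (mul_mem hp hq) k)

theorem map_one (M : IsMonomialBasis ρ A x b w) (k : Fin 5) : w k 1 = 1 := by
  refine smul_left_injective ℂ (b.ne_zero k) ((M.apply 1 A.one_mem k).symm.trans ?_)
  rw [_root_.map_one, End.one_apply]
  exact (one_smul ℂ _).symm

theorem map_pow (M : IsMonomialBasis ρ A x b w) {p : P} (hp : p ∈ A) (k : Fin 5) (n : ℕ) :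
    w k (p ^ n) = w k p ^ n := by
  induction n with
  | zero => rw [pow_zero, pow_zero, M.map_one]
  | succ n ih => rw [pow_succ, pow_succ, M.map_mul (pow_mem hp n) hp, ih]

theorem ext (M : IsMonomialBasis ρ A x b w) (R : IsCubicRep ρ T) {p q : P} (hp : p ∈ A) (hq : q ∈ A)
    (h : ∀ k, w k p = w k q) : p = q :=
  R.injective (b.ext fun k => by rw [M.apply p hp, M.apply q hq, h])

theorem commute (M : IsMonomialBasis ρ A x b w) (R : IsCubicRep ρ T) {p q : P} (hp : p ∈ A)
    (hq : q ∈ A) : p * q = q * p :=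
  M.ext R (mul_mem hp hq) (mul_mem hq hp) fun k => by
    rw [M.map_mul hp hq, M.map_mul hq hp, mul_comm]

theorem pow_nine (M : IsMonomialBasis ρ A x b w) (R : IsCubicRep ρ T) (hP : IsPGroup 3 P) {p : P}
    (hp : p ∈ A) (k : Fin 5) : w k p ^ 9 = 1 :=
  R.eigenvalue_pow_nine hP (d := fun k => w k p) (fun k => M.apply p hp k) k

theorem apply_two (M : IsMonomialBasis ρ A x b w) : ρ x (b 2) = w 0 (x ^ 3) • b 0 := by
  rw [← M.apply _ M.cube_mem, pow_succ, pow_two, _root_.map_mul, _root_.map_mul, End.mul_apply,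
    End.mul_apply, M.apply_zero, M.apply_one]

theorem exists_apply (M : IsMonomialBasis ρ A x b w) (k : Fin 5) :
    ∃ c : ℂ, ρ x (b k) = c • b (monomialStep k) := by
  rcases (by decide : ∀ k : Fin 5, k = 0 ∨ k = 1 ∨ k = 2 ∨ k = 3 ∨ k = 4) k with
    rfl | rfl | rfl | rfl | rfl
  · exact ⟨1, M.apply_zero.trans (one_smul ℂ _).symm⟩
  · exact ⟨1, M.apply_one.trans (one_smul ℂ _).symm⟩
  · exact ⟨_, M.apply_two⟩
  · exact M.apply_three
  · exact M.apply_four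

theorem conj_mem (M : IsMonomialBasis ρ A x b w) {a : P} (ha : a ∈ A) : x * a * x⁻¹ ∈ A :=
  M.normal.conj_mem a ha x

theorem conj (M : IsMonomialBasis ρ A x b w) {a : P} (ha : a ∈ A) (k : Fin 5) :
    w (monomialStep k) (x * a * x⁻¹) = w k a := by
  obtain ⟨c, hc⟩ := M.exists_apply k
  have hc0 : c ≠ 0 := by
    rintro rfl
    rw [zero_smul] at hc
    exact b.ne_zero k (IsCubicRep.apply_injective (ρ := ρ) x (hc.trans (_root_.map_zero _).symm))
  have h1 : ρ (x * a * x⁻¹) (ρ x (b k)) = ρ x (ρ a (b k)) := by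
    rw [← End.mul_apply, ← _root_.map_mul, ← End.mul_apply, ← _root_.map_mul,
      inv_mul_cancel_right]
  rw [M.apply a ha, map_smul, hc, map_smul, M.apply _ (M.conj_mem ha), smul_comm] at h1
  have := smul_right_injective V hc0 ((smul_comm _ _ _).trans (h1.trans (smul_comm _ _ _)))
  exact smul_left_injective ℂ (b.ne_zero _) this

theorem weight_cube (M : IsMonomialBasis ρ A x b w) :
    w 1 (x ^ 3) = w 0 (x ^ 3) ∧ w 2 (x ^ 3) = w 0 (x ^ 3) := by
  have h : x * x ^ 3 * x⁻¹ = x ^ 3 := by group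
  have h0 := M.conj M.cube_mem 0
  have h1 := M.conj M.cube_mem 1
  rw [h] at h0 h1
  exact ⟨h0, h1.trans h0⟩

theorem trilinear_step (M : IsMonomialBasis ρ A x b w) (R : IsCubicRep ρ T) {j k : Fin 5}
    (h : T (b k) (b k) (b j) ≠ 0) :
    T (b (monomialStep k)) (b (monomialStep k)) (b (monomialStep j)) ≠ 0 := by
  obtain ⟨c, hc⟩ := M.exists_apply k
  obtain ⟨d, hd⟩ := M.exists_apply j
  intro h0
  rw [← R.inv x, hc, hd] at h
  simp [h0] at h

/-- The cubic form pairs the rotated indices among themselves, and likewise the two fixed ones: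
otherwise rotation would give the three rotated weights equal squares, or make them equal. -/
theorem lt_three_iff (M : IsMonomialBasis ρ A x b w) (R : IsCubicRep ρ T) (hP : IsPGroup 3 P)
    {j k : Fin 5} (h : T (b k) (b k) (b j) ≠ 0) : k < 3 ↔ j < 3 := by
  have h' := M.trilinear_step R h
  have h'' := M.trilinear_step R h'
  have hw : ∀ {j k : Fin 5}, T (b k) (b k) (b j) ≠ 0 → ∀ a ∈ A, w k a ^ 2 * w j a = 1 :=
    fun h a ha => R.weight_eq (M.apply a ha _) (M.apply a ha _) h
  obtain ⟨a, ha, hne⟩ := M.nontriv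
  have h9 := M.pow_nine R hP ha
  have hsq : ∀ y z u : ℂ, y ^ 9 = 1 → z ^ 9 = 1 → u ^ 9 = 1 → y ^ 2 * u = 1 → z ^ 2 * u = 1 → y = z := by
    intro y z u hy hz hu h1 h2
    have hu0 : u ≠ 0 := by rintro rfl; norm_num at hu
    have h2 : y ^ 2 = z ^ 2 := mul_right_cancel₀ hu0 (h1.trans h2.symm)
    linear_combination (-y) * hy + z * hz + (y ^ 8 + y ^ 6 * z ^ 2 + y ^ 4 * z ^ 4 + y ^ 2 * z ^ 6 + z ^ 8) * h2
  have hlin : ∀ y z u : ℂ, u ^ 9 = 1 → u ^ 2 * y = 1 → u ^ 2 * z = 1 → y = z := by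
    intro y z u hu h1 h2
    linear_combination u ^ 7 * (h1 - h2) - (y - z) * hu
  by_contra hcon
  have e := hw h a ha
  have e' := hw h' a ha
  have e'' := hw h'' a ha
  have hcases : (k = 0 ∨ k = 1 ∨ k = 2) ∧ (j = 3 ∨ j = 4) ∨
      (k = 3 ∨ k = 4) ∧ (j = 0 ∨ j = 1 ∨ j = 2) := by
    revert hcon; clear h h' h'' e e' e''; revert j k; decide
  rcases hcases with ⟨rfl | rfl | rfl, rfl | rfl⟩ | ⟨rfl | rfl, rfl | rfl | rfl⟩ <;>
    simp only [monomialStep, Matrix.cons_val] at e e' e''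
  iterate 2 exact hne (hsq _ _ _ (h9 _) (h9 _) (h9 _) e e')
  iterate 2 exact hne (hsq _ _ _ (h9 _) (h9 _) (h9 _) e'' e)
  iterate 2 exact hne (hsq _ _ _ (h9 _) (h9 _) (h9 _) e' e'')
  all_goals first
    | exact hne (hlin _ _ _ (h9 _) e e')
    | exact hne (hlin _ _ _ (h9 _) e'' e)
    | exact hne (hlin _ _ _ (h9 _) e' e'')

theorem fixed_weight_pow_three (M : IsMonomialBasis ρ A x b w) (R : IsCubicRep ρ T)
    (hP : IsPGroup 3 P) {a : P} (ha : a ∈ A) : w 3 a ^ 3 = 1 ∧ w 4 a ^ 3 = 1 := by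
  have haux : ∀ k : Fin 5, ¬k < 3 → w k a ^ 2 * w 3 a = 1 ∨ w k a ^ 2 * w 4 a = 1 := by
    intro k hk
    obtain ⟨j, hj⟩ := R.exists_basis_ne_zero b (b.ne_zero k)
    have hj3 := fun h => hk ((M.lt_three_iff R hP hj).2 h)
    have hw := R.weight_eq (M.apply a ha _) (M.apply a ha _) hj
    rcases (by decide : ∀ k : Fin 5, ¬k < 3 → k = 3 ∨ k = 4) j hj3 with rfl | rfl
    · exact .inl hw
    · exact .inr hw
  exact pow_three_of_closed_pair (M.pow_nine R hP ha _) (M.pow_nine R hP ha _)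
    (haux 3 (by decide)) (haux 4 (by decide))

/-- The cube of the rotating element acts trivially on the two fixed lines, since a nontrivial
cube has exactly a plane of fixed vectors, and its three rotated weights agree. -/
theorem weight_cube_fixed (M : IsMonomialBasis ρ A x b w) (R : IsCubicRep ρ T) (hP : IsPGroup 3 P) :
    w 3 (x ^ 3) = 1 ∧ w 4 (x ^ 3) = 1 ∧ w 0 (x ^ 3) ^ 3 = 1 := by
  classical
  obtain ⟨h1, h2⟩ := M.weight_cube
  have h3 : w 0 (x ^ 3) ^ 3 = 1 := by
    obtain ⟨j, hj⟩ := R.exists_basis_ne_zero b (b.ne_zero 0)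
    have hj3 := (M.lt_three_iff R hP hj).1 (by decide)
    have hw := R.weight_eq (M.apply _ M.cube_mem _) (M.apply _ M.cube_mem _) hj
    rcases (by decide : ∀ k < (3 : Fin 5), k = 0 ∨ k = 1 ∨ k = 2) j hj3 with rfl | rfl | rfl
    · linear_combination hw
    · rw [h1] at hw; linear_combination hw
    · rw [h2] at hw; linear_combination hw
  suffices w 3 (x ^ 3) = 1 ∧ w 4 (x ^ 3) = 1 from ⟨this.1, this.2, h3⟩
  rcases R.finrank_fixed_cube hP x with hx | hx
  · rw [hx]
    exact ⟨M.map_one 3, M.map_one 4⟩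
  · rw [finrank_jointEigenspace (b := b) (w := fun k _ => w k (x ^ 3))
      (fun k _ => M.apply _ M.cube_mem k)] at hx
    have hmem : ∀ k, k ∈ (Finset.univ.filter fun k => (fun _ : Unit => w k (x ^ 3)) = fun _ => 1) ↔
        w k (x ^ 3) = 1 := fun k => by simp [funext_iff]
    set s := Finset.univ.filter fun k => (fun _ : Unit => w k (x ^ 3)) = fun _ => 1
    have h0 : w 0 (x ^ 3) ≠ 1 := by
      intro h0
      have hsub : ({0, 1, 2} : Finset (Fin 5)) ⊆ s := by
        intro k hk
        rw [hmem]
        simp only [Finset.mem_insert, Finset.mem_singleton] at hk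
        rcases hk with rfl | rfl | rfl
        · exact h0
        · exact h1.trans h0
        · exact h2.trans h0
      have := Finset.card_le_card hsub
      rw [hx] at this
      exact absurd this (by decide)
    have hsub : s ⊆ {3, 4} := by
      intro k hk
      rw [hmem] at hk
      rcases (by decide : ∀ k : Fin 5, k = 0 ∨ k = 1 ∨ k = 2 ∨ k = 3 ∨ k = 4) k with
        rfl | rfl | rfl | rfl | rfl
      · exact absurd hk h0
      · exact absurd (h1.symm.trans hk) h0
      · exact absurd (h2.symm.trans hk) h0
      · decide
      · decide
    have hs := Finset.eq_of_subset_of_card_le hsub (by rw [hx]; decide)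
    exact ⟨(hmem 3).1 (hs ▸ by decide), (hmem 4).1 (hs ▸ by decide)⟩


/-- Every group element acts on the last basis vector by a cube root of unity. -/
theorem isCubicEigenvector (M : IsMonomialBasis ρ A x b w) (R : IsCubicRep ρ T)
    (hP : IsPGroup 3 P) : IsCubicEigenvector ρ (b 4) := by
  refine ⟨b.ne_zero 4, fun p => ?_⟩
  obtain ⟨k, hk⟩ := M.gen p
  obtain ⟨ν, hν⟩ := M.apply_four
  have hν3 : ν ^ 3 = 1 := by
    have := IsCubicRep.pow_apply hν 3
    rw [M.apply _ M.cube_mem, (M.weight_cube_fixed R hP).2.1] at this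
    exact smul_left_injective ℂ (b.ne_zero 4) this.symm
  have hν0 : ν ^ k ≠ 0 := by
    refine pow_ne_zero k ?_
    rintro rfl
    norm_num at hν3
  have h3 := (M.fixed_weight_pow_three R hP hk).2
  refine ⟨w 4 (x ^ k * p) * (ν ^ k)⁻¹, ?_, ?_⟩
  · rw [mul_pow, h3, inv_pow, ← pow_mul, mul_comm k, pow_mul, hν3]
    simp
  · have h1 := M.apply _ hk 4
    refine IsCubicRep.apply_injective (ρ := ρ) (x ^ k) ?_
    rw [map_smul, IsCubicRep.pow_apply hν, smul_smul, inv_mul_cancel_right₀ hν0, ← h1,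
      _root_.map_mul, End.mul_apply]

end IsMonomialBasis

/-! ### Nonabelian groups of symmetries: isomorphism types -/

theorem pow_mul_mem_iff_of_mk_eq {P : Type*} [Group P] {A : Subgroup P} [A.Normal] {y z : P}
    (h : (y : P ⧸ A) = z) (k : ℕ) (p : P) : y ^ k * p ∈ A ↔ z ^ k * p ∈ A := by
  rw [← QuotientGroup.eq_one_iff, ← QuotientGroup.eq_one_iff, QuotientGroup.mk_mul,
    QuotientGroup.mk_mul, QuotientGroup.mk_pow, QuotientGroup.mk_pow, h]

namespace IsMonomialBasis

variable {P : Type} {V : Type*} [Group P] [AddCommGroup V] [Module ℂ V] {ρ : P →* End ℂ V}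
  {T : V →ₗ[ℂ] V →ₗ[ℂ] V →ₗ[ℂ] ℂ} {A : Subgroup P} {x : P} {b : Basis (Fin 5) ℂ V}
  {w : Fin 5 → P → ℂ} {s : P} {ω : ℂ}

theorem scalar_mem (M : IsMonomialBasis ρ A x b w) (R : IsCubicRep ρ T)
    (hs : IsCubeRootScalar ρ s ω) : s ∈ A :=
  M.center_mem s (R.scalar_commute hs)

theorem weight_eq_one_of_mem_fixer (M : IsMonomialBasis ρ A x b w) {a : P} (ha : a ∈ A)
    (h : a ∈ fixer ρ (b 4)) : w 4 a = 1 := by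
  rw [mem_fixer, M.apply a ha] at h
  exact smul_left_injective ℂ (b.ne_zero 4) (h.trans (one_smul ℂ _).symm)

theorem exists_mul_scalar_mem (M : IsMonomialBasis ρ A x b w) (R : IsCubicRep ρ T)
    (hP : IsPGroup 3 P) (hs : IsCubeRootScalar ρ s ω) (p : P) :
    ∃ j : ℕ, p * s ^ j ∈ fixer ρ (b 4) := by
  obtain ⟨z, hz, hp⟩ := (M.isCubicEigenvector R hP).2 p
  exact IsCubicRep.exists_mul_scalar_mem_fixer hs hz hp

theorem mul_scalar_pow_three (R : IsCubicRep ρ T) (hs : IsCubeRootScalar ρ s ω) (p : P) (j : ℕ) :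
    (p * s ^ j) ^ 3 = p ^ 3 := by
  have hc : Commute p (s ^ j) := Commute.pow_right (R.scalar_commute hs p).symm j
  rw [hc.mul_pow, ← pow_mul, mul_comm j, pow_mul, R.scalar_pow_three hs, one_pow, mul_one]

/-- The rotated weights are cube roots of unity: the fixer of the last basis vector embeds in
a group of coordinate rotations and diagonal matrices of exponent `3`. -/
theorem inListG3_of_pow_three (M : IsMonomialBasis ρ A x b w) (R : IsCubicRep ρ T)
    (hP : IsPGroup 3 P) (hs : IsCubeRootScalar ρ s ω) (h3 : ∀ a ∈ A, ∀ k, w k a ^ 3 = 1) :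
    InListG3 (fixer ρ (b 4)) := by
  have := M.normal
  have hsA := M.scalar_mem R hs
  obtain ⟨j, hj⟩ := M.exists_mul_scalar_mem R hP hs x
  have hmk : ((x * s ^ j : P) : P ⧸ A) = x := by
    rw [QuotientGroup.mk_mul, (QuotientGroup.eq_one_iff _).2 (pow_mem hsA j), mul_one]
  have hcube : ((⟨_, hj⟩ : fixer ρ (b 4)) ^ 3 : P) = x ^ 3 := mul_scalar_pow_three R hs x j
  have hconj : ∀ a : P, x * s ^ j * a * (x * s ^ j)⁻¹ = x * a * x⁻¹ := by
    intro a
    have hc : Commute (s ^ j) a := Commute.pow_left (R.scalar_commute hs a) j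
    rw [mul_assoc x, hc.eq, mul_inv_rev]
    group
  have hw0 := (M.weight_cube_fixed R hP)
  have hw1 := M.weight_cube
  refine IsRotExt.inListG3 (M := A.subgroupOf (fixer ρ (b 4))) (x := ⟨x * s ^ j, hj⟩)
    (κ := fun p k => rootLog 3 (w k.castSucc p)) ⟨?_, ?_, ?_, ?_, ?_, ?_, ?_, ?_, ?_⟩
  · intro a ha a' ha'
    rw [Subgroup.mem_subgroupOf] at ha ha'
    funext k
    simp only [Subgroup.coe_mul, M.map_mul ha ha', rootLog_mul (h3 _ ha _) (h3 _ ha' _),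
      Pi.add_apply]
  · intro a ha h
    rw [Subgroup.mem_subgroupOf] at ha
    refine Subtype.ext (M.ext R ha A.one_mem fun k => ?_)
    rw [Subgroup.coe_one, M.map_one]
    induction k using Fin.lastCases with
    | last => exact M.weight_eq_one_of_mem_fixer ha a.2
    | cast k => exact eq_one_of_rootLog (h3 _ ha _) (congrFun h k)
  · intro a ha
    rw [Subgroup.mem_subgroupOf] at ha ⊢
    change x * s ^ j * a * (x * s ^ j)⁻¹ ∈ A
    rw [hconj]
    exact M.conj_mem ha
  · intro a ha
    rw [Subgroup.mem_subgroupOf] at ha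
    have e : ((⟨x * s ^ j, hj⟩ * a * ⟨x * s ^ j, hj⟩⁻¹ : fixer ρ (b 4)) : P) = x * a * x⁻¹ := hconj a
    rw [e]
    funext k
    rcases (by decide : ∀ k : Fin 4, k = 0 ∨ k = 1 ∨ k = 2 ∨ k = 3) k with rfl | rfl | rfl | rfl
    · exact congrArg (rootLog 3) (M.conj ha 2)
    · exact congrArg (rootLog 3) (M.conj ha 0)
    · exact congrArg (rootLog 3) (M.conj ha 1)
    · exact congrArg (rootLog 3) (M.conj ha 3)
  · rw [Subgroup.mem_subgroupOf]
    intro h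
    exact M.not_mem ((QuotientGroup.eq_one_iff x).1 (hmk ▸ (QuotientGroup.eq_one_iff _).2 h))
  · intro h
    obtain ⟨k, hk⟩ := M.gen h
    exact ⟨k, (pow_mul_mem_iff_of_mk_eq hmk k h).2 hk⟩
  · rw [Subgroup.mem_subgroupOf, Subgroup.coe_pow, hcube]
    exact M.cube_mem
  · refine ⟨rootLog 3 (w 0 (x ^ 3)), ?_⟩
    rw [Subgroup.coe_pow, hcube]
    funext k
    rcases (by decide : ∀ k : Fin 4, k = 0 ∨ k = 1 ∨ k = 2 ∨ k = 3) k with rfl | rfl | rfl | rfl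
    · rfl
    · exact congrArg (rootLog 3) hw1.1
    · exact congrArg (rootLog 3) hw1.2
    · exact (congrArg (rootLog 3) hw0.1).trans rootLog_one
  · obtain ⟨a, ha, hne⟩ := M.nontriv
    obtain ⟨i, hi⟩ := M.exists_mul_scalar_mem R hP hs a
    have hsi := pow_mem hsA i
    refine ⟨⟨a * s ^ i, hi⟩, Subgroup.mem_subgroupOf.2 (mul_mem ha hsi), fun h => hne ?_⟩
    have h' : w 0 (a * s ^ i) = w 1 (a * s ^ i) :=
      rootLog_inj (h3 _ (mul_mem ha hsi) _) (h3 _ (mul_mem ha hsi) _) h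
    have hsc : ∀ k, w k (s ^ i) = ω ^ i := fun k =>
      smul_left_injective ℂ (b.ne_zero k)
        ((M.apply _ hsi k).symm.trans (IsCubicRep.pow_apply (hs.apply (b k)) i))
    rw [M.map_mul ha hsi, M.map_mul ha hsi, hsc, hsc] at h'
    exact mul_right_cancel₀ (pow_ne_zero i (hs.prim.ne_zero (by norm_num))) h'

/-- If `y` acts on the diagonal subgroup by `a ↦ a ^ 4`, multiplication by a diagonal element
turns `y` into an element of order `3`, since `(a * y) ^ 3 = a ^ 21 * y ^ 3`. -/
theorem inListG3_of_conj_pow_four (M : IsMonomialBasis ρ A x b w) (R : IsCubicRep ρ T)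
    (hP : IsPGroup 3 P) (hs : IsCubeRootScalar ρ s ω) {y : P} (hyA : y ∉ A)
    (hygen : ∀ h, ∃ k : ℕ, y ^ k * h ∈ A) (hconj : ∀ a ∈ A, y * a * y⁻¹ = a ^ 4)
    (hy3 : y ^ 3 ∈ A) (hw0 : w 0 (y ^ 3) ^ 3 = 1) (hw3 : w 3 (y ^ 3) = 1) (hw4 : w 4 (y ^ 3) = 1)
    (hdet : ∀ a ∈ A, w 0 a = 1 → w 1 a = 1 ∧ w 2 a = 1) (hg : ∃ g ∈ A, w 0 g ^ 3 ≠ 1) :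
    InListG3 (fixer ρ (b 4)) := by
  have := M.normal
  have hsA := M.scalar_mem R hs
  have h9 : ∀ {a}, a ∈ A → ∀ k, w k a ^ 9 = 1 := fun ha => M.pow_nine R hP ha
  have h34 : ∀ {a}, a ∈ A → w 3 a ^ 3 = 1 ∧ w 4 a ^ 3 = 1 := fun ha =>
    M.fixed_weight_pow_three R hP ha
  have hone : ∀ a ∈ A, w 0 a = 1 → w 3 a = 1 → w 4 a = 1 → a = 1 := by
    intro a ha e0 e3 e4
    refine M.ext R ha A.one_mem fun k => ?_
    rw [M.map_one]
    obtain ⟨e1, e2⟩ := hdet a ha e0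
    rcases (by decide : ∀ k : Fin 5, k = 0 ∨ k = 1 ∨ k = 2 ∨ k = 3 ∨ k = 4) k with
      rfl | rfl | rfl | rfl | rfl <;> assumption
  obtain ⟨g, hgA, hg3⟩ := hg
  have hprim : IsPrimitiveRoot (w 0 g ^ 3) 3 := by
    have : Fact (Nat.Prime 3) := ⟨Nat.prime_three⟩
    refine IsPrimitiveRoot.iff_orderOf.2 (orderOf_eq_prime ?_ hg3)
    rw [← pow_mul]
    exact h9 hgA 0
  obtain ⟨m, hm, hmw⟩ := hprim.eq_pow_of_pow_eq_one hw0
  -- `w 0 (g ^ 21) = w 0 g ^ 3 = c`, a primitive cube root of unity, and `w 0 (y ^ 3) = c ^ m`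
  obtain ⟨a, ha⟩ : ∃ a, a = g ^ (3 - m) := ⟨_, rfl⟩
  have haA : a ∈ A := ha ▸ pow_mem hgA _
  have hy1 : (a * y) ^ 3 = 1 := by
    have e : (a * y) ^ 3 = a * (y * a * y⁻¹) * (y * (y * a * y⁻¹) * y⁻¹) * y ^ 3 := by
      rw [show (a * y) ^ 3 = a * y * (a * y) * (a * y) by rw [pow_succ, pow_two]]
      group
    rw [e, hconj a haA, hconj _ (pow_mem haA 4), show a * a ^ 4 * (a ^ 4) ^ 4 = a ^ 21 by group]
    have hk : ∀ k, w k (a ^ 21 * y ^ 3) = w k a ^ 21 * w k (y ^ 3) := fun k => by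
      rw [M.map_mul (pow_mem haA _) hy3, M.map_pow haA]
    refine hone _ (mul_mem (pow_mem haA _) hy3) ?_ ?_ ?_
    · rw [hk, ← hmw, ha, M.map_pow hgA, ← pow_mul, ← pow_mul, ← pow_add,
        show (3 - m) * 21 + 3 * m = 9 * (7 - 2 * m) by omega, pow_mul, h9 hgA, one_pow]
    · rw [hk, hw3, mul_one, show 21 = 3 * 7 by norm_num, pow_mul, (h34 haA).1, one_pow]
    · rw [hk, hw4, mul_one, show 21 = 3 * 7 by norm_num, pow_mul, (h34 haA).2, one_pow]
  obtain ⟨j, hj⟩ := M.exists_mul_scalar_mem R hP hs (a * y)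
  have hmk : ((a * y * s ^ j : P) : P ⧸ A) = y := by
    rw [QuotientGroup.mk_mul, QuotientGroup.mk_mul, (QuotientGroup.eq_one_iff _).2 (pow_mem hsA j),
      (QuotientGroup.eq_one_iff _).2 haA, mul_one, one_mul]
  refine inListG3_of_conj_eq_pow_four (A.subgroupOf (fixer ρ (b 4)))
    { toFun := fun p => (.ofAdd (rootLog 9 (w 0 p.1)), .ofAdd (rootLog 3 (w 3 p.1)))
      map_one' := ?_
      map_mul' := ?_ } ?_ ⟨a * y * s ^ j, hj⟩ ?_ ?_ ?_ ?_ ?_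
  · simp only [Subgroup.coe_one, M.map_one, rootLog_one]
    rfl
  · intro p q
    have hp := Subgroup.mem_subgroupOf.1 p.2
    have hq := Subgroup.mem_subgroupOf.1 q.2
    simp only [Subgroup.coe_mul, M.map_mul hp hq, rootLog_mul (h9 hp _) (h9 hq _),
      rootLog_mul (h34 hp).1 (h34 hq).1]
    rfl
  · refine (injective_iff_map_eq_one _).2 fun p hp => ?_
    have hpA := Subgroup.mem_subgroupOf.1 p.2
    refine Subtype.ext (Subtype.ext (hone _ hpA ?_ ?_ (M.weight_eq_one_of_mem_fixer hpA p.1.2)))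
    · exact eq_one_of_rootLog (h9 hpA _) (congrArg (fun u : Cyc 9 × Cyc 3 => u.1.toAdd) hp)
    · exact eq_one_of_rootLog (h34 hpA).1 (congrArg (fun u : Cyc 9 × Cyc 3 => u.2.toAdd) hp)
  · exact Subtype.ext ((mul_scalar_pow_three R hs _ j).trans hy1)
  · rw [Subgroup.mem_subgroupOf]
    intro h
    exact hyA ((QuotientGroup.eq_one_iff y).1 (hmk ▸ (QuotientGroup.eq_one_iff _).2 h))
  · intro h
    obtain ⟨k, hk⟩ := hygen h
    exact ⟨k, (pow_mul_mem_iff_of_mk_eq hmk k h).2 hk⟩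
  · intro p hp
    rw [Subgroup.mem_subgroupOf] at hp
    refine Subtype.ext ?_
    change a * y * s ^ j * p * (a * y * s ^ j)⁻¹ = (p : P) ^ 4
    have hc : Commute (s ^ j) (p : P) := Commute.pow_left (R.scalar_commute hs _) j
    have e : a * y * s ^ j * p * (a * y * s ^ j)⁻¹ = a * (y * p * y⁻¹) * a⁻¹ := by
      rw [mul_assoc (a * y), hc.eq]
      group
    rw [e, hconj _ hp, M.commute R haA (pow_mem hp 4), mul_inv_cancel_right]
  · obtain ⟨i, hi⟩ := M.exists_mul_scalar_mem R hP hs g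
    refine ⟨⟨g * s ^ i, hi⟩, Subgroup.mem_subgroupOf.2 (mul_mem hgA (pow_mem hsA i)), fun h => hg3 ?_⟩
    have h' : (g * s ^ i) ^ 3 = 1 := congrArg Subtype.val h
    rw [mul_scalar_pow_three R hs] at h'
    rw [← M.map_pow hgA, h', M.map_one]

/-- The index paired with `0` decides the type: the rotated weights are cube roots of unity, or
conjugation by `x` or by `x ^ 2` raises diagonal elements to the fourth power. -/
theorem inListG3 (M : IsMonomialBasis ρ A x b w) (R : IsCubicRep ρ T) (hP : IsPGroup 3 P)
    (hs : IsCubeRootScalar ρ s ω) : InListG3 (fixer ρ (b 4)) := by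
  have h9 : ∀ {a}, a ∈ A → ∀ k, w k a ^ 9 = 1 := fun ha => M.pow_nine R hP ha
  have h34 : ∀ {a}, a ∈ A → w 3 a ^ 3 = 1 ∧ w 4 a ^ 3 = 1 := fun ha =>
    M.fixed_weight_pow_three R hP ha
  obtain ⟨hw3, hw4, hw0⟩ := M.weight_cube_fixed R hP
  obtain ⟨j, hj⟩ := R.exists_basis_ne_zero b (b.ne_zero 0)
  have hj3 := (M.lt_three_iff R hP hj).1 (by decide)
  have hj' := M.trilinear_step R hj
  have hj'' := M.trilinear_step R hj'
  have hw : ∀ {j k : Fin 5}, T (b k) (b k) (b j) ≠ 0 → ∀ a ∈ A, w k a ^ 2 * w j a = 1 :=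
    fun h a ha => R.weight_eq (M.apply a ha _) (M.apply a ha _) h
  have e := hw hj
  have e' := hw hj'
  have e'' := hw hj''
  have hpow : ∀ y z : ℂ, y ^ 9 = 1 → y ^ 2 * z = 1 → z = y ^ 7 := fun y z hy h => by
    linear_combination y ^ 7 * h - z * hy
  have hfour : ∀ y : ℂ, y ^ 3 = 1 → y = y ^ 4 ∧ y = y ^ 7 := fun y h =>
    ⟨by linear_combination (-y) * h, by linear_combination -(y + y ^ 4) * h⟩
  have hseven : ∀ y z : ℂ, y ^ 9 = 1 → y ^ 2 * z = 1 → y = z ^ 4 := fun y z hy h => by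
    rw [hpow y z hy h]
    linear_combination (-(y + y ^ 10 + y ^ 19)) * hy
  have hk5 := (by decide : ∀ k : Fin 5, k = 0 ∨ k = 1 ∨ k = 2 ∨ k = 3 ∨ k = 4)
  rcases (by decide : ∀ k < (3 : Fin 5), k = 0 ∨ k = 1 ∨ k = 2) j hj3 with rfl | rfl | rfl <;>
    simp only [monomialStep, Matrix.cons_val] at e e' e''
  · refine M.inListG3_of_pow_three R hP hs fun a ha k => ?_
    rcases hk5 k with rfl | rfl | rfl | rfl | rfl
    · linear_combination e a ha
    · linear_combination e' a ha
    · linear_combination e'' a ha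
    · exact (h34 ha).1
    · exact (h34 ha).2
  · refine M.inListG3_of_conj_pow_four R hP hs M.not_mem M.gen (fun a ha => ?_) M.cube_mem hw0 hw3 hw4
      (fun a ha h => ?_) ?_
    · refine M.ext R (M.conj_mem ha) (pow_mem ha 4) fun k => ?_
      rw [M.map_pow ha]
      rcases hk5 k with rfl | rfl | rfl | rfl | rfl
      · exact (M.conj ha 2).trans (hseven _ _ (h9 ha _) (e'' a ha))
      · exact (M.conj ha 0).trans (hseven _ _ (h9 ha _) (e a ha))
      · exact (M.conj ha 1).trans (hseven _ _ (h9 ha _) (e' a ha))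
      · exact (M.conj ha 3).trans (hfour _ (h34 ha).1).1
      · exact (M.conj ha 4).trans (hfour _ (h34 ha).2).1
    · have h1 : w 1 a = 1 := by simpa [h] using e a ha
      exact ⟨h1, by simpa [h1] using e' a ha⟩
    · by_contra! h
      obtain ⟨a, ha, hne⟩ := M.nontriv
      exact hne (by linear_combination w 1 a * h a ha - w 0 a * e a ha)
  · have hconj : ∀ a ∈ A, x * a * x⁻¹ = a ^ 7 := by
      intro a ha
      refine M.ext R (M.conj_mem ha) (pow_mem ha 7) fun k => ?_
      rw [M.map_pow ha]
      rcases hk5 k with rfl | rfl | rfl | rfl | rfl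
      · exact (M.conj ha 2).trans (hpow _ _ (h9 ha _) (e a ha))
      · exact (M.conj ha 0).trans (hpow _ _ (h9 ha _) (e' a ha))
      · exact (M.conj ha 1).trans (hpow _ _ (h9 ha _) (e'' a ha))
      · exact (M.conj ha 3).trans (hfour _ (h34 ha).1).2
      · exact (M.conj ha 4).trans (hfour _ (h34 ha).2).2
    have hcube : (x ^ 2) ^ 3 = (x ^ 3) ^ 2 := by group
    refine M.inListG3_of_conj_pow_four R hP hs (y := x ^ 2) (fun h => M.not_mem ?_) (fun h => ?_)
      (fun a ha => ?_) ?_ ?_ ?_ ?_ (fun a ha h => ?_) ?_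
    · have := mul_mem M.cube_mem (inv_mem h)
      rwa [show x ^ 3 * (x ^ 2)⁻¹ = x by group] at this
    · obtain ⟨k, hk⟩ := M.gen h
      refine ⟨2 * k, ?_⟩
      have := mul_mem (pow_mem M.cube_mem k) hk
      rwa [← mul_assoc, ← pow_mul, ← pow_add, show 3 * k + k = 2 * (2 * k) by omega, pow_mul] at this
    · have e49 : x ^ 2 * a * (x ^ 2)⁻¹ = x * (x * a * x⁻¹) * x⁻¹ := by
        rw [pow_two, mul_inv_rev]
        simp only [mul_assoc]
      rw [e49, hconj a ha, hconj _ (pow_mem ha 7)]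
      refine M.ext R (pow_mem (pow_mem ha 7) 7) (pow_mem ha 4) fun k => ?_
      rw [← pow_mul, M.map_pow ha, M.map_pow ha, show 7 * 7 = 9 * 5 + 4 by norm_num, pow_add, pow_mul,
        h9 ha, one_pow, one_mul]
    · rw [hcube]
      exact pow_mem M.cube_mem 2
    · rw [hcube, M.map_pow M.cube_mem, ← pow_mul, mul_comm 2, pow_mul, hw0, one_pow]
    · rw [hcube, M.map_pow M.cube_mem, hw3, one_pow]
    · rw [hcube, M.map_pow M.cube_mem, hw4, one_pow]
    · have h1 : w 2 a = 1 := by simpa [h] using e a ha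
      exact ⟨by simpa [h1] using e'' a ha, h1⟩
    · by_contra! h
      obtain ⟨a, ha, hne⟩ := M.nontriv
      have h6 : w 1 a ^ 6 = 1 := by
        have : (w 1 a ^ 2 * w 0 a) ^ 3 = 1 := by rw [e' a ha, one_pow]
        linear_combination this - w 1 a ^ 6 * h a ha
      have h3 : w 1 a ^ 3 = 1 := by linear_combination h9 ha 1 - w 1 a ^ 3 * h6
      exact hne (by linear_combination w 1 a * e' a ha - w 0 a * h3)

end IsMonomialBasis

/-- The vector is the last one of the monomial basis, or a suitable one of a diagonalizing basis. -/
theorem IsCubicRep.exists_inListG3_fixer {P : Type} {V : Type*} [Group P] [AddCommGroup V]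
    [Module ℂ V] {ρ : P →* End ℂ V} {T : V →ₗ[ℂ] V →ₗ[ℂ] V →ₗ[ℂ] ℂ} {s : P} {ω : ℂ}
    (R : IsCubicRep ρ T) (hP : IsPGroup 3 P) (hs : IsCubeRootScalar ρ s ω) :
    ∃ v, IsCubicEigenvector ρ v ∧ (Nontrivial (fixer ρ v) → InListG3 (fixer ρ v)) := by
  have := R.finite hP
  obtain ⟨b, w, hb⟩ | ⟨A, x, b, w, M⟩ := R.exists_monomial_basis hP
  · exact R.inListG3_of_diagonal hP hb
  · exact ⟨b 4, M.isCubicEigenvector R hP, fun _ => M.inListG3 R hP hs⟩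

/-! ### The symmetric trilinear form of a cubic form -/

namespace MvPolynomial

theorem pderiv_comm {σ R : Type*} [CommRing R] (i j : σ) (F : MvPolynomial σ R) :
    pderiv i (pderiv j F) = pderiv j (pderiv i F) := by
  classical
  have h : ⁅pderiv (R := R) i, pderiv (R := R) j⁆ = 0 :=
    derivation_ext fun k => by
      rw [Derivation.commutator_apply, pderiv_X, pderiv_X, Pi.single_apply, Pi.single_apply]
      split_ifs <;> simp
  have := congrArg (fun D => D F) h
  rw [Derivation.commutator_apply] at this
  exact sub_eq_zero.1 this

/-- Euler's identity for the values of a homogeneous polynomial. -/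
theorem IsHomogeneous.sum_mul_eval_pderiv {F : MvPolynomial (Fin 5) ℂ} {n : ℕ}
    (hF : F.IsHomogeneous n) (v : Fin 5 → ℂ) : ∑ i, v i * eval v (pderiv i F) = n * eval v F := by
  have := congrArg (eval v) hF.sum_X_mul_pderiv
  simpa [map_sum] using this

theorem IsHomogeneous.eval_eq_of_zero {F : MvPolynomial (Fin 5) ℂ} (hF : F.IsHomogeneous 0)
    (v : Fin 5 → ℂ) : eval v F = eval 0 F := by
  rw [totalDegree_eq_zero_iff_eq_C.1 (Nat.le_zero.1 hF.totalDegree_le)]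
  simp

theorem IsHomogeneous.exists_trilinear {F : MvPolynomial (Fin 5) ℂ} (hF : F.IsHomogeneous 3) :
    ∃ T : (Fin 5 → ℂ) →ₗ[ℂ] (Fin 5 → ℂ) →ₗ[ℂ] (Fin 5 → ℂ) →ₗ[ℂ] ℂ,
      (∀ v u, T v v u = 2 * ∑ i, eval v (pderiv i F) * u i) ∧
      (∀ a b c, T a b c = T b a c) ∧ ∀ a b c, T a b c = T a c b := by
  let c : Fin 5 → Fin 5 → Fin 5 → ℂ := fun i j k => eval 0 (pderiv i (pderiv j (pderiv k F)))
  let T : (Fin 5 → ℂ) →ₗ[ℂ] (Fin 5 → ℂ) →ₗ[ℂ] (Fin 5 → ℂ) →ₗ[ℂ] ℂ :=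
    ∑ i, ∑ j, ∑ k, c i j k • (LinearMap.proj i : (Fin 5 → ℂ) →ₗ[ℂ] ℂ).smulRight
      ((LinearMap.proj j : (Fin 5 → ℂ) →ₗ[ℂ] ℂ).smulRight (LinearMap.proj k : (Fin 5 → ℂ) →ₗ[ℂ] ℂ))
  have hT : ∀ u v w, T u v w = ∑ i, ∑ j, ∑ k, c i j k * (u i * (v j * w k)) := by
    intro u v w
    simp [T, LinearMap.sum_apply]
  refine ⟨T, fun v u => ?_, fun u v w => ?_, fun u v w => ?_⟩
  · have h1 : ∀ j k, eval v (pderiv j (pderiv k F)) = ∑ i, v i * c i j k := by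
      intro j k
      have hjk : (pderiv j (pderiv k F)).IsHomogeneous 1 := hF.pderiv.pderiv
      have := hjk.sum_mul_eval_pderiv v
      rw [Nat.cast_one, one_mul] at this
      rw [← this]
      refine Finset.sum_congr rfl fun i _ => ?_
      rw [(show (pderiv i (pderiv j (pderiv k F))).IsHomogeneous 0 from hjk.pderiv).eval_eq_of_zero]
    have h2 : ∀ k, 2 * eval v (pderiv k F) = ∑ j, v j * ∑ i, v i * c i j k := by
      intro k
      have := (show (pderiv k F).IsHomogeneous 2 from hF.pderiv).sum_mul_eval_pderiv v
      rw [Nat.cast_two] at this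
      rw [← this]
      exact Finset.sum_congr rfl fun j _ => by rw [h1]
    rw [hT, Finset.mul_sum, Finset.sum_comm, Finset.sum_congr rfl fun j _ => Finset.sum_comm,
      Finset.sum_comm]
    refine Finset.sum_congr rfl fun k _ => ?_
    rw [← mul_assoc, h2, Finset.sum_mul]
    refine Finset.sum_congr rfl fun j _ => ?_
    rw [Finset.mul_sum, Finset.sum_mul]
    exact Finset.sum_congr rfl fun i _ => by ring
  · rw [hT, hT, Finset.sum_comm]
    refine Finset.sum_congr rfl fun j _ => Finset.sum_congr rfl fun i _ => Finset.sum_congr rfl fun k _ => ?_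
    simp only [c, pderiv_comm i j]
    ring
  · rw [hT, hT]
    refine Finset.sum_congr rfl fun i _ => ?_
    rw [Finset.sum_comm]
    refine Finset.sum_congr rfl fun j _ => Finset.sum_congr rfl fun k _ => ?_
    simp only [c, pderiv_comm k j]
    ring

end MvPolynomial

/-- The polarization identity: a symmetric trilinear form is determined by its cubic form. -/
theorem six_mul_trilinear {V : Type*} [AddCommGroup V] [Module ℂ V]
    {T : V →ₗ[ℂ] V →ₗ[ℂ] V →ₗ[ℂ] ℂ} (h1 : ∀ a b c, T a b c = T b a c)
    (h2 : ∀ a b c, T a b c = T a c b) (a b c : V) :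
    6 * T a b c = T (a + b + c) (a + b + c) (a + b + c) - T (a + b) (a + b) (a + b) -
      T (a + c) (a + c) (a + c) - T (b + c) (b + c) (b + c) + T a a a + T b b b + T c c c := by
  simp only [map_add, LinearMap.add_apply]
  linear_combination (h2 a b c) + (h1 a b c) + (h1 a b c + h2 b a c) + (h2 a b c + h1 a c b) +
    (h2 a b c + h1 a c b + h2 c a b)

/-! ### Linear lifts of projective symmetries -/

theorem scalar_smul (u : ℂˣ) (v : Fin 5 → ℂ) :
    Matrix.GeneralLinearGroup.scalar (Fin 5) u • v = (u : ℂ) • v := by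
  change (Matrix.GeneralLinearGroup.scalar (Fin 5) u).val.mulVec v = _
  simp

namespace MvPolynomial

theorem IsHomogeneous.eval_smul {F : MvPolynomial (Fin 5) ℂ} (hF : F.IsHomogeneous 3) (z : ℂ)
    (v : Fin 5 → ℂ) : eval (z • v) F = z ^ 3 * eval v F := by
  rw [eval_eq', eval_eq', Finset.mul_sum]
  refine Finset.sum_congr rfl fun m hm => ?_
  have hm' : ∑ i, m i = 3 := by
    rw [← Finsupp.degree_eq_sum]
    exact (hF.degree_eq_sum_deg_support hm).symm
  simp only [Pi.smul_apply, smul_eq_mul, mul_pow, Finset.prod_mul_distrib,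
    Finset.prod_pow_eq_pow_sum, hm']
  ring

theorem exists_eval_ne_zero {F : MvPolynomial (Fin 5) ℂ} (hF : F ≠ 0) : ∃ v, eval v F ≠ 0 := by
  by_contra! h
  exact hF (funext fun v => by rw [h, map_zero])

/-- By the Nullstellensatz, a linear substitution that maps the zero locus of an irreducible cubic
form to itself multiplies the form by a constant. -/
theorem exists_eval_smul_eq {F : MvPolynomial (Fin 5) ℂ} (hF : F.IsHomogeneous 3)
    (hirr : Irreducible F) (A : GL (Fin 5) ℂ) (hA : ∀ v, eval v F = 0 → eval (A • v) F = 0) :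
    ∃ c : ℂ, c ≠ 0 ∧ ∀ v, eval (A • v) F = c * eval v F := by
  let f : Fin 5 → MvPolynomial (Fin 5) ℂ := fun i => ∑ j, C (A.val i j) * X j
  have hf : ∀ i, (f i).IsHomogeneous 1 := fun i =>
    IsHomogeneous.sum _ _ _ fun j _ => isHomogeneous_C_mul_X _ _
  have hE : ∀ v, eval v (aeval f F) = eval (A • v) F := by
    intro v
    rw [← coe_aeval_eq_eval, ← coe_aeval_eq_eval, RingHom.coe_coe, RingHom.coe_coe,
      comp_aeval_apply]
    congr 2
    funext i
    change aeval v (∑ j, C (A.val i j) * X j) = A.val.mulVec v i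
    simp [Matrix.mulVec, dotProduct]
  have hE0 : aeval f F ≠ 0 := by
    intro h
    obtain ⟨v, hv⟩ := exists_eval_ne_zero hirr.ne_zero
    have := hE (A⁻¹ • v)
    rw [h, map_zero, smul_inv_smul] at this
    exact hv this.symm
  have hmem : aeval f F ∈ vanishingIdeal ℂ (zeroLocus ℂ (Ideal.span {F})) := by
    rw [mem_vanishingIdeal_iff]
    intro v hv
    have h0 := hv F (Ideal.mem_span_singleton_self F)
    have haeval : ∀ p, aeval v p = eval v p := fun p => by rw [← coe_aeval_eq_eval, RingHom.coe_coe]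
    rw [haeval] at h0 ⊢
    rw [hE]
    exact hA v h0
  have hprime : (Ideal.span {F}).IsPrime := (Ideal.span_singleton_prime hirr.ne_zero).2 hirr.prime
  rw [vanishingIdeal_zeroLocus_eq_radical, hprime.radical, Ideal.mem_span_singleton] at hmem
  obtain ⟨Q, hQ⟩ := hmem
  have hQ0 : Q ≠ 0 := by rintro rfl; exact hE0 (by rw [hQ, mul_zero])
  have hdeg := congrArg totalDegree hQ
  rw [totalDegree_mul_of_isDomain hirr.ne_zero hQ0, hF.totalDegree hirr.ne_zero,
    (hF.aeval f hf).totalDegree hE0] at hdeg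
  have hQC := totalDegree_eq_zero_iff_eq_C.1 (show Q.totalDegree = 0 by omega)
  refine ⟨coeff 0 Q, fun h => hQ0 (by rw [hQC, h, map_zero]), fun v => ?_⟩
  rw [← hE, hQ, map_mul, mul_comm]
  congr 1
  conv_lhs => rw [hQC]
  exact eval_C _

/-- The linear symmetries of a form. -/
def linearStabilizer (F : MvPolynomial (Fin 5) ℂ) : Subgroup (GL (Fin 5) ℂ) where
  carrier := {A | ∀ v, eval (A • v) F = eval v F}
  one_mem' v := by rw [one_smul]
  mul_mem' {A B} hA hB v := by rw [mul_smul, hA, hB]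
  inv_mem' {A} hA v := by rw [← hA, smul_inv_smul]

/-- The linear symmetries of a form that represent an element of the projective group `G`. -/
def linearLift (F : MvPolynomial (Fin 5) ℂ) (G : Subgroup PGL(5, ℂ)) : Subgroup (GL (Fin 5) ℂ) :=
  G.comap Matrix.ProjGenLinGroup.mk ⊓ linearStabilizer F

/-- The representation of a group of matrices on column vectors. -/
noncomputable def linearLiftRep (F : MvPolynomial (Fin 5) ℂ) (G : Subgroup PGL(5, ℂ)) :
    linearLift F G →* End ℂ (Fin 5 → ℂ) :=
  (Matrix.toLinAlgEquiv' : Matrix (Fin 5) (Fin 5) ℂ ≃ₐ[ℂ] _).toMonoidHom.comp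
    ((Units.coeHom _).comp (linearLift F G).subtype)

theorem linearLiftRep_apply {F : MvPolynomial (Fin 5) ℂ} {G : Subgroup PGL(5, ℂ)}
    (p : linearLift F G) (v : Fin 5 → ℂ) : linearLiftRep F G p v = (p : GL (Fin 5) ℂ) • v := rfl

theorem exists_isCubicRep {F : MvPolynomial (Fin 5) ℂ} (hF : F.IsHomogeneous 3)
    (hsm : ∀ v, v ≠ 0 → eval v F = 0 → ∃ i, eval v (pderiv i F) ≠ 0) (G : Subgroup PGL(5, ℂ)) :
    ∃ T, IsCubicRep (linearLiftRep F G) T := by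
  obtain ⟨T, hT, h1, h2⟩ := hF.exists_trilinear
  have hcubic : ∀ v, T v v v = 6 * eval v F := by
    intro v
    have := hF.sum_mul_eval_pderiv v
    simp only [mul_comm (v _)] at this
    rw [hT, this]
    push_cast
    ring
  refine ⟨T, finrank_fin_fun ℂ, fun v hv => ?_, fun p a b c => ?_, fun p q h => ?_⟩
  · by_contra! h
    have hF0 : eval v F = 0 := by simpa [hcubic] using h v
    obtain ⟨i, hi⟩ := hsm v hv hF0
    have := h (Pi.single i 1)
    rw [hT] at this
    simp [Pi.single_apply, hi] at this
  · have hinv : ∀ v, T (linearLiftRep F G p v) (linearLiftRep F G p v) (linearLiftRep F G p v)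
        = T v v v := fun v => by
      rw [hcubic, hcubic, linearLiftRep_apply, p.2.2]
    have h6 : (6 : ℂ) ≠ 0 := by norm_num
    refine mul_left_cancel₀ h6 ?_
    rw [six_mul_trilinear h1 h2, six_mul_trilinear h1 h2 a b c]
    simp only [← map_add, hinv]
  · refine Subtype.ext (Units.ext ?_)
    exact (Matrix.toLinAlgEquiv' : Matrix (Fin 5) (Fin 5) ℂ ≃ₐ[ℂ] _).injective h

theorem exists_isCubeRootScalar {F : MvPolynomial (Fin 5) ℂ} (hF : F.IsHomogeneous 3)
    (G : Subgroup PGL(5, ℂ)) : ∃ s : linearLift F G, ∃ ω,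
      IsCubeRootScalar (linearLiftRep F G) s ω ∧ Matrix.ProjGenLinGroup.mk (s : GL (Fin 5) ℂ) = 1 := by
  have hω := Complex.isPrimitiveRoot_exp 3 (by norm_num)
  set ω := Complex.exp (2 * Real.pi * Complex.I / (3 : ℕ))
  let u : ℂˣ := Units.mk0 ω (hω.ne_zero (by norm_num))
  refine ⟨⟨Matrix.GeneralLinearGroup.scalar (Fin 5) u, ?_, fun v => ?_⟩, ω, ⟨hω, fun v => ?_⟩,
    Matrix.ProjGenLinGroup.mk_scalar u⟩
  · change Matrix.ProjGenLinGroup.mk _ ∈ G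
    rw [Matrix.ProjGenLinGroup.mk_scalar]
    exact G.one_mem
  · rw [scalar_smul, hF.eval_smul]
    change ω ^ 3 * _ = _
    rw [hω.pow_eq_one, one_mul]
  · rw [linearLiftRep_apply]
    exact scalar_smul u v

theorem eq_scalar_of_mk_eq_one {A : GL (Fin 5) ℂ} (h : Matrix.ProjGenLinGroup.mk A = 1) :
    ∃ u : ℂˣ, A = Matrix.GeneralLinearGroup.scalar (Fin 5) u := by
  rw [← map_one Matrix.ProjGenLinGroup.mk, eq_comm, Matrix.ProjGenLinGroup.mk_eq_mk_iff] at h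
  obtain ⟨u, hu⟩ := h
  exact ⟨u, by rw [← hu, one_mul]⟩

/-- The lift is a `3`-group, since a scalar that preserves a cubic form has order dividing `3`. -/
theorem isPGroup_linearLift {F : MvPolynomial (Fin 5) ℂ} (hF : F.IsHomogeneous 3) (hF0 : F ≠ 0)
    {G : Subgroup PGL(5, ℂ)} (hG : IsPGroup 3 G) : IsPGroup 3 (linearLift F G) := by
  intro p
  obtain ⟨k, hk⟩ := hG ⟨_, p.2.1⟩
  have hk' : Matrix.ProjGenLinGroup.mk ((p : GL (Fin 5) ℂ) ^ 3 ^ k) = 1 := by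
    rw [map_pow]
    exact congrArg Subtype.val hk
  obtain ⟨u, hu⟩ := eq_scalar_of_mk_eq_one hk'
  obtain ⟨v, hv⟩ := exists_eval_ne_zero hF0
  have hu3 : u ^ 3 = 1 := by
    have h1 := (pow_mem p.2 (3 ^ k)).2 v
    rw [hu, scalar_smul, hF.eval_smul] at h1
    exact Units.ext (mul_right_cancel₀ hv (by simpa using h1))
  refine ⟨k + 1, Subtype.ext ?_⟩
  rw [pow_succ, pow_mul, Subgroup.coe_pow, Subgroup.coe_pow, hu, ← map_pow, hu3, map_one]
  rfl

/-- A projective symmetry of a cubic hypersurface lifts to a linear symmetry of its equation,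
since the constant of `exists_eval_smul_eq` has a cube root. -/
theorem exists_mem_linearLift {F : MvPolynomial (Fin 5) ℂ} (hF : F.IsHomogeneous 3)
    (hirr : Irreducible F) {G : Subgroup PGL(5, ℂ)} (hG : G ≤ projAut (projZeroLocus F)) {g : PGL(5, ℂ)}
    (hg : g ∈ G) : ∃ A ∈ linearLift F G, Matrix.ProjGenLinGroup.mk A = g := by
  obtain ⟨A, rfl⟩ := Matrix.ProjGenLinGroup.mk_surjective g
  have hstab := MulAction.mem_stabilizer_iff.1 (hG hg)
  obtain ⟨c, hc0, hc⟩ := exists_eval_smul_eq hF hirr A fun v hv => by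
    by_cases hv0 : v = 0
    · rw [hv0, smul_zero, ← hv, hv0]
    · have h1 := Set.smul_mem_smul_set (a := Matrix.ProjGenLinGroup.mk A)
        ((mk_mem_projZeroLocus hF v hv0).2 hv)
      rw [hstab, Projectivization.PGL.mk_smul_mk] at h1
      exact (mk_mem_projZeroLocus hF _ _).1 h1
  obtain ⟨z, hz⟩ := IsAlgClosed.exists_pow_nat_eq c⁻¹ (n := 3) (by norm_num)
  have hz0 : z ≠ 0 := by
    rintro rfl
    exact inv_ne_zero hc0 (by rw [← hz]; norm_num)
  have hmk : Matrix.ProjGenLinGroup.mk (A * Matrix.GeneralLinearGroup.scalar (Fin 5) (Units.mk0 z hz0))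
      = Matrix.ProjGenLinGroup.mk A := by
    rw [map_mul, Matrix.ProjGenLinGroup.mk_scalar, mul_one]
  refine ⟨A * Matrix.GeneralLinearGroup.scalar (Fin 5) (Units.mk0 z hz0), ⟨?_, fun v => ?_⟩, hmk⟩
  · change Matrix.ProjGenLinGroup.mk _ ∈ G
    rwa [hmk]
  · rw [mul_smul, hc, scalar_smul, hF.eval_smul, Units.val_mk0, hz, mul_inv_cancel_left₀ hc0]

/-- A projective group of symmetries is isomorphic to the subgroup of its linear lift that fixes a
vector which the lift multiplies by cube roots of unity. -/
theorem nonempty_fixer_mulEquiv {F : MvPolynomial (Fin 5) ℂ} (hF : F.IsHomogeneous 3)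
    (hirr : Irreducible F) {G : Subgroup PGL(5, ℂ)} (hG : G ≤ projAut (projZeroLocus F))
    {v : Fin 5 → ℂ} (hv : IsCubicEigenvector (linearLiftRep F G) v) :
    Nonempty (fixer (linearLiftRep F G) v ≃* G) := by
  let φ : fixer (linearLiftRep F G) v →* G :=
    { toFun := fun p => ⟨Matrix.ProjGenLinGroup.mk (p : linearLift F G).1, p.1.2.1⟩
      map_one' := Subtype.ext (map_one _)
      map_mul' := fun p q => Subtype.ext (map_mul _ _ _) }
  refine ⟨MulEquiv.ofBijective φ ⟨?_, ?_⟩⟩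
  · refine (injective_iff_map_eq_one φ).2 fun p hp => ?_
    obtain ⟨u, hu⟩ := eq_scalar_of_mk_eq_one (congrArg Subtype.val hp)
    have hfix : (p : linearLift F G).1 • v = v := p.2
    rw [hu, scalar_smul] at hfix
    have hu1 : u = 1 := Units.ext (smul_left_injective ℂ hv.1 (hfix.trans (one_smul ℂ v).symm))
    refine Subtype.ext (Subtype.ext ?_)
    rw [hu, hu1, map_one]
    rfl
  · rintro ⟨g, hg⟩
    obtain ⟨A, hA, rfl⟩ := exists_mem_linearLift hF hirr hG hg
    obtain ⟨s, ω, hs, hs1⟩ := exists_isCubeRootScalar hF G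
    obtain ⟨z, hz, hzv⟩ := hv.2 ⟨A, hA⟩
    obtain ⟨j, hj⟩ := IsCubicRep.exists_mul_scalar_mem_fixer hs hz hzv
    refine ⟨⟨_, hj⟩, Subtype.ext ?_⟩
    change Matrix.ProjGenLinGroup.mk (A * (s : GL (Fin 5) ℂ) ^ j) = _
    rw [map_mul, map_pow, hs1, one_pow, mul_one]

end MvPolynomial

theorem theorem6p3 (X : Set (ℙ ℂ (Fin 5 → ℂ))) (hX : IsSmoothCubicThreefold X)
    (G : Subgroup PGL(5, ℂ)) (hG : G ≤ projAut X) (h3 : IsPGroup 3 G) :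
    (Nontrivial G → InListG3 G) ∧ Finite G ∧ Nat.card G ≤ 3 ^ 5 := by
  obtain ⟨F, hF, hirr, hsm, rfl⟩ := hX
  obtain ⟨T, R⟩ := MvPolynomial.exists_isCubicRep hF hsm G
  obtain ⟨s, ω, hs, -⟩ := MvPolynomial.exists_isCubeRootScalar hF G
  obtain ⟨v, hv, hlist⟩ :=
    R.exists_inListG3_fixer (MvPolynomial.isPGroup_linearLift hF hirr.ne_zero h3) hs
  obtain ⟨e⟩ := MvPolynomial.nonempty_fixer_mulEquiv hF hirr hG hv
  have hlistG : Nontrivial G → InListG3 G := fun hn =>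
    InListG3.congr e.symm (hlist e.toEquiv.nontrivial)
  refine ⟨hlistG, ?_⟩
  rcases subsingleton_or_nontrivial G with h | h
  · exact ⟨inferInstance, by rw [Nat.card_of_subsingleton (1 : G)]; norm_num⟩
  · exact (hlistG h).card_le
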